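/- Let $M$ be a superdomain of dimension $d|s$ with body an open set $U\subseteq\mathbb R^d$ and coordinates $Z^i$; write $(-)^i$ for the sign of the parity of $Z^i$, $\partial_i$ for left derivatives, and $(-)^{ij}$ etc. for the sign with the product of the parities in the exponent. Let $A=\begin{pmatrix}A_{ij}&A_i{}^j\\A^i{}_j&A^{ij}\end{pmatrix}$ be a generalized metric on $TM\oplus T^*M$: its entries are smooth superfunctions of parity $i+j$, with $$A_{ij}=(-)^{ij}A_{ji},\qquad A_i{}^j=(-)^{ij+j}A^j{}_i,\qquad A^{ij}=(-)^{ij+i+j}A^{ji},\qquad A\begin{pmatrix}0&1\\1&0\end{pmatrix}A=\begin{pmatrix}0&1\\1&0\end{pmatrix}.$$ Put $\mathbb U=A\begin{pmatrix}0&1\\1&0\end{pmatrix}=\begin{pmatrix}A_i{}^j&A_{ij}\\A^{ij}&A^i{}_j\end{pmatrix}$, acting on rows from the right, so $\mathbb U^2=1$; let $(TM\oplus T^*M)_\pm$ be its $(\pm1)$-eigenspaces and $\mathcal P_\pm=\frac12(1\pm\mathbb U)$. Consider the sigma model $$S=\int \partial_tZ^iP_i-\tfrac12(\partial_\sigma Z^i\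 P_i)\,A\begin{pmatrix}\partial_\sigma Z^j(-)^j\\P_j\end{pmatrix}$$ for smooth fields on a non-empty open worldsheet $W\subseteq\mathbb R^2$ with coordinates $(t,\sigma)$, where $P_i$ has the parity of $Z^i$ and the fields take values in an arbitrary finitely generated real Grassmann algebra. Its equations of motion are $$\partial_tZ^i=\tfrac12\Big[(-)^i(A^i{}_j\ A^{ij})\begin{pmatrix}\partial_\sigma Z^j(-)^j\\P_j\end{pmatrix}+(\partial_\sigma Z^j\ P_j)\begin{pmatrix}A_j{}^i\\A^{ji}\end{pmatrix}\Big],$$ $$\partial_tP_i=-\tfrac12\Big[(\partial_\sigma Z^k\ P_k)(-)^{ki}\,\partial_iA\begin{pmatrix}\partial_\sigma Z^j(-)^j\\P_j\end{pmatrix}-\partial_\sigma\Big((A_{ij}\ A_i{}^j)\begin{pmatrix}\partial_\sigma Z^j(-)^j\\P_j\end{pmatrix}\Big)-\partial_\sigma\Big((\partial_\sigma Z^j\ P_j)\begin{pmatrix}A_{ji}\\A^j{}_i\end{pmatrix}\Big)\Big].$$ Let $V$ be a smooth vector field and $F$ a smooth one-form on $M$ of the same parity $e=|V|=|F|$ (even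 or odd), with components $V^i$, $F_i=F(\partial_i)$ of parity $i+e$. The current of $(V,F)$ is $$j_z=(V\ F)\,\mathcal P_+\begin{pmatrix}P_j\\\partial_\sigma Z^j(-)^j\end{pmatrix},\qquad j_{\bar z}=(V\ F)\,\mathcal P_-\begin{pmatrix}P_j\\\partial_\sigma Z^j(-)^j\end{pmatrix},$$ and $\partial=\partial_t+\partial_\sigma$, $\bar\partial=\partial_t-\partial_\sigma$. Let $(dF)_{ij}=(-)^{ie}\partial_iF_j-(-)^{ij+je}\partial_jF_i$ and $$(\mathcal L_VA)_{ij}=V^k\partial_kA_{ij}+(-)^{ei}\partial_iV^kA_{kj}+(-)^{ij+ej}\partial_jV^kA_{ki},$$ $$(\mathcal L_VA)^{ij}=V^k\partial_kA^{ij}-(-)^{ei}A^{ik}\partial_kV^j-(-)^{i+j+ij+ej}A^{jk}\partial_kV^i,$$ $$(\mathcal L_VA)_i{}^j=V^k\partial_kA_i{}^j-(-)^{ei}A_i{}^k\partial_kV^j+(-)^{ei}\partial_iV^kA_k{}^j.$$ Then: 1. The current is conserved, i.e. $\bar\partial j_z+\partial j_{\bar z}=0$ on all solutions of the equations of motion,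 if and only if on $M$ $$(\mathcal L_VA)_{ij}=-[(dF)_{ik}A^k{}_j+(-)^{ij}(dF)_{jk}A^k{}_i],\quad(\mathcal L_VA)_i{}^j=-(dF)_{ik}A^{kj},\quad(\mathcal L_VA)^{ij}=0.\qquad(*)$$ 2. $(*)$ is equivalent to $$\mathcal L_{(V,F)}\mathbb U:=\mathcal L_V\mathbb U+\Big[\begin{pmatrix}0&dF\\0&0\end{pmatrix},\mathbb U\Big]=0 .$$ Here $\mathcal L_V\mathbb U$ is the Lie derivative of the endomorphism $\mathbb U$, whose components (with $a,b$ running over the components of a row $S=(X^i\ G_i)$) are determined by the Leibniz rule $\mathcal L_V(S\mathbb U)=(\mathcal L_VS)\mathbb U+(-)^{e|S|}S^a(-)^{ea}(\mathcal L_V\mathbb U)_{ab}$, where $\mathcal L_VS$ has components $V^k\partial_kX^i-(-)^{e|S|}X^k\partial_kV^i$ and $V^k\partial_kG_i+(-)^{ei+(i+k)|S|}\partial_iV^kG_k$; and the commutator is that of endomorphisms of parities $e$ and $0$, in components $[T,\mathbb U]_{ab}=T_{ac}\mathbb U_{cb}-(-)^{e(a+c)}\mathbb U_{ac}T_{cb}$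 (the matrix commutator if $e=0$). 3. $(V,F)\in(TM\oplus T^*M)_+$ if and only if $j_z=V^iP_i+F_i\partial_\sigma Z^i(-)^i$ and $j_{\bar z}=0$ for all fields; in this case $\bar\partial j_z+\partial j_{\bar z}=\bar\partial j_z$, so that $(*)$ holds if and only if the current is holomorphic, $\bar\partial j_z=0$ on all solutions. 4. $(V,F)\in(TM\oplus T^*M)_-$ if and only if $j_z=0$ and $j_{\bar z}=V^iP_i+F_i\partial_\sigma Z^i(-)^i$ for all fields; in this case $\bar\partial j_z+\partial j_{\bar z}=\partial j_{\bar z}$, so that $(*)$ holds if and only if the current is antiholomorphic, $\partial j_{\bar z}=0$ on all solutions. -/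

import Mathlib

open scoped ContDiff Matrix

namespace SuperSigma

/-! ### Grassmann algebras -/

/-- The real Grassmann algebra on `N` odd generators. -/
abbrev Gr (N : ℕ) : Type := ExteriorAlgebra ℝ (Fin N → ℝ)

/-- The Grassmann algebra is finite dimensional; its (canonical) topology is given here by the
sup norm of the coefficients in the monomial basis. -/
noncomputable instance (N : ℕ) : NormedAddCommGroup (Gr N) :=
  NormedAddCommGroup.induced (Gr N) (Finset (Fin N) → ℝ)
    ((Pi.basisFun ℝ (Fin N)).ExteriorAlgebra.equivFun : Gr N →ₗ[ℝ] (Finset (Fin N) → ℝ))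
    (Pi.basisFun ℝ (Fin N)).ExteriorAlgebra.equivFun.injective

noncomputable instance (N : ℕ) : NormedSpace ℝ (Gr N) :=
  NormedSpace.induced ℝ (Gr N) (Finset (Fin N) → ℝ)
    ((Pi.basisFun ℝ (Fin N)).ExteriorAlgebra.equivFun : Gr N →ₗ[ℝ] (Finset (Fin N) → ℝ))

/-- The even (`e = 0`) and odd (`e = 1`) part of the Grassmann algebra. -/
def Gr.parity (N : ℕ) (e : ZMod 2) : Submodule ℝ (Gr N) :=
  CliffordAlgebra.evenOdd (0 : QuadraticForm ℝ (Fin N → ℝ)) e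

theorem Gr.odd_mul_ι {N : ℕ} {x : Gr N} (hx : x ∈ Gr.parity N 1) (v : Fin N → ℝ) :
    x * ExteriorAlgebra.ι ℝ v = -(ExteriorAlgebra.ι ℝ v * x) := by
  have sw : ∀ a b : Fin N → ℝ, ExteriorAlgebra.ι ℝ a * ExteriorAlgebra.ι ℝ b
      = -(ExteriorAlgebra.ι ℝ b * ExteriorAlgebra.ι ℝ a) := fun a b =>
    eq_neg_of_add_eq_zero_left (ExteriorAlgebra.ι_add_mul_swap a b)
  induction x, hx using CliffordAlgebra.odd_induction with
  | ι w => exact sw w v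
  | add a b ha hb iha ihb => rw [add_mul, iha, ihb, mul_add, neg_add]
  | ι_mul_ι_mul m₁ m₂ a ha ih =>
    change ExteriorAlgebra.ι ℝ m₁ * ExteriorAlgebra.ι ℝ m₂ * a * _
      = -(_ * (ExteriorAlgebra.ι ℝ m₁ * ExteriorAlgebra.ι ℝ m₂ * a))
    rw [mul_assoc _ a, ih, ← mul_assoc (ExteriorAlgebra.ι ℝ v),
      ← mul_assoc (ExteriorAlgebra.ι ℝ v), sw v m₁, neg_mul,
      mul_assoc _ (ExteriorAlgebra.ι ℝ v), sw v m₂]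
    simp only [mul_neg, neg_neg, mul_assoc]

theorem Gr.odd_mul_odd {N : ℕ} {x y : Gr N} (hx : x ∈ Gr.parity N 1)
    (hy : y ∈ Gr.parity N 1) : y * x = -(x * y) := by
  induction x, hx using CliffordAlgebra.odd_induction with
  | ι w => exact Gr.odd_mul_ι hy w
  | add a b ha hb iha ihb => rw [mul_add, iha, ihb, add_mul, neg_add]
  | ι_mul_ι_mul m₁ m₂ a ha ih =>
    change y * (ExteriorAlgebra.ι ℝ m₁ * ExteriorAlgebra.ι ℝ m₂ * a)
      = -(ExteriorAlgebra.ι ℝ m₁ * ExteriorAlgebra.ι ℝ m₂ * a * y)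
    rw [mul_assoc _ a, ← neg_eq_iff_eq_neg.mpr ih, ← mul_assoc, ← mul_assoc, Gr.odd_mul_ι hy,
      neg_mul, mul_assoc _ y, Gr.odd_mul_ι hy]
    simp only [mul_neg, neg_neg, mul_assoc]

theorem Gr.odd_sq {N : ℕ} {x : Gr N} (hx : x ∈ Gr.parity N 1) : x * x = 0 := by
  have h := eq_neg_iff_add_eq_zero.mp (Gr.odd_mul_odd hx hx)
  rw [← two_smul ℝ] at h
  exact (smul_eq_zero.mp h).resolve_left two_ne_zero

/-! ### Superdomains and superfunctions -/

/-- Index set of the coordinates of a superdomain of dimension `d|s`. -/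
abbrev Idx (d s : ℕ) : Type := Fin d ⊕ Fin s

/-- Parity of the coordinate `Z^i`. -/
def par {d s : ℕ} : Idx d s → ZMod 2 := Sum.elim (fun _ => 0) (fun _ => 1)

/-- Parity of the index `a` of a component of a section of `TM ⊕ T^*M`. -/
def par₂ {d s : ℕ} : Idx d s ⊕ Idx d s → ZMod 2 := Sum.elim par par

/-- The sign `(-1)^a`. -/
noncomputable def sg (a : ZMod 2) : ℝ := if a = 0 then 1 else -1

/-- Superfunctions `f(x, θ) = ∑ f_I(x) θ^I`, as functions of `x` valued in the Grassmann algebra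
generated by the odd coordinates `θ`, with the pointwise product. Only their values on the body
`U` of the superdomain matter; smoothness on `U` and parity are imposed separately. -/
abbrev SFun (d s : ℕ) : Type := (Fin d → ℝ) → Gr s

def SFun.SmoothOn {d s : ℕ} (U : Set (Fin d → ℝ)) (f : SFun d s) : Prop := ContDiffOn ℝ ∞ f U

def SFun.HasParity {d s : ℕ} (U : Set (Fin d → ℝ)) (e : ZMod 2) (f : SFun d s) : Prop :=
  ∀ x ∈ U, f x ∈ Gr.parity s e

/-- The (left) partial derivative `∂_i`. -/
noncomputable def pd {d s : ℕ} (i : Idx d s) (f : SFun d s) : SFun d s :=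
  match i with
  | .inl m => fun x => fderiv ℝ f x (Pi.single m 1)
  | .inr μ => fun x => CliffordAlgebra.contractLeft (LinearMap.proj μ) (f x)

/-! ### Points with values in a Grassmann algebra -/

/-- A family `z^i` (`i = 1, …, d|s`) of elements of a Grassmann algebra, with `z^i` of the parity
of the index `i`. -/
structure GrPoint (d s N : ℕ) where
  coord : Idx d s → Gr N
  mem : ∀ i, coord i ∈ Gr.parity N (par i)

namespace GrPoint

variable {d s N : ℕ} (z : GrPoint d s N)

/-- The underlying real point. -/
noncomputable def body : Fin d → ℝ := fun m => ExteriorAlgebra.algebraMapInv (z.coord (.inl m))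

/-- The nilpotent part of the even coordinates. -/
noncomputable def soul (m : Fin d) : Gr N := z.coord (.inl m) - algebraMap ℝ (Gr N) (z.body m)

/-- The algebra homomorphism substituting `z^μ` for the odd coordinate `θ^μ`. -/
noncomputable def subst : Gr s →ₐ[ℝ] Gr N :=
  ExteriorAlgebra.lift ℝ ⟨Fintype.linearCombination ℝ (fun μ : Fin s => z.coord (.inr μ)),
    fun v => Gr.odd_sq (by
      rw [Fintype.linearCombination_apply]
      exact Submodule.sum_mem _ fun μ _ => Submodule.smul_mem _ _ (z.mem (.inr μ)))⟩

/-- `∑ soul^{m₁} ⋯ soul^{m_k} (∂_{m₁} ⋯ ∂_{m_k} f)(body, θ = z^μ)`. -/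
noncomputable def taylorTerm : ℕ → SFun d s → Gr N
  | 0, f => z.subst (f z.body)
  | k + 1, f => ∑ m : Fin d, z.soul m * taylorTerm k (pd (.inl m) f)

/-- The value `f(z)` of a superfunction at a Grassmann-valued point, by the Taylor expansion
around the body (which terminates, the soul being nilpotent). -/
noncomputable def eval (f : SFun d s) : Gr N :=
  ∑ k ∈ Finset.range (N + 1), ((k.factorial : ℝ)⁻¹) • z.taylorTerm k f

end GrPoint

/-! ### Tensors on `TM ⊕ T^*M` -/

/-- The four blocks `A_{ij}`, `A_i^j`, `A^i_j`, `A^{ij}` of a bilinear form on `TM ⊕ T^*M`. -/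
structure BlockTensor (d s : ℕ) where
  ll : Matrix (Idx d s) (Idx d s) (SFun d s)
  lu : Matrix (Idx d s) (Idx d s) (SFun d s)
  ul : Matrix (Idx d s) (Idx d s) (SFun d s)
  uu : Matrix (Idx d s) (Idx d s) (SFun d s)

/-- Square matrices of size `2d|2s`. -/
abbrev Mat (d s : ℕ) (R : Type) : Type := Matrix (Idx d s ⊕ Idx d s) (Idx d s ⊕ Idx d s) R

namespace BlockTensor

variable {d s : ℕ} (A : BlockTensor d s)

/-- The matrix `(A_{ij}, A_i^j; A^i_j, A^{ij})`. -/
def toMatrix : Mat d s (SFun d s) := Matrix.fromBlocks A.ll A.lu A.ul A.uu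

/-- The matrix `U_A = A (0 1; 1 0) = (A_i^j, A_{ij}; A^{ij}, A^i_j)`. -/
def op : Mat d s (SFun d s) := A.toMatrix * (Matrix.fromBlocks 0 1 1 0 : Mat d s (SFun d s))

/-- Generalized metrics on a superdomain with body `U`. -/
structure IsGeneralizedMetric (U : Set (Fin d → ℝ)) : Prop where
  smooth : ∀ a b, (A.toMatrix a b).SmoothOn U
  parity : ∀ a b, (A.toMatrix a b).HasParity U (par₂ a + par₂ b)
  symm_ll : ∀ i j, ∀ x ∈ U, A.ll i j x = sg (par i * par j) • A.ll j i x
  symm_lu : ∀ i j, ∀ x ∈ U, A.lu i j x = sg (par i * par j + par j) • A.ul j i x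
  symm_uu : ∀ i j, ∀ x ∈ U, A.uu i j x = sg (par i * par j + par i + par j) • A.uu j i x
  /-- The `O(d,d)` condition `A (0 1; 1 0) A = (0 1; 1 0)`. -/
  orthogonal : ∀ a b, ∀ x ∈ U,
    (A.toMatrix * (Matrix.fromBlocks 0 1 1 0 : Mat d s (SFun d s)) * A.toMatrix) a b x
      = (Matrix.fromBlocks 0 1 1 0 : Mat d s (SFun d s)) a b x

end BlockTensor

variable {d s : ℕ}

/-- `(V, F)` is a smooth section of `TM ⊕ T^*M` of parity `e`: the components `V^i` and
`F_i = F(∂_i)` are smooth and have parity `i + e`. -/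
structure IsSection (U : Set (Fin d → ℝ)) (e : ZMod 2) (V F : Idx d s → SFun d s) : Prop where
  smooth_V : ∀ i, (V i).SmoothOn U
  smooth_F : ∀ i, (F i).SmoothOn U
  parity_V : ∀ i, (V i).HasParity U (par i + e)
  parity_F : ∀ i, (F i).HasParity U (par i + e)

/-- The row vector `(V^i  F_i)`. -/
def row (V F : Idx d s → SFun d s) : Idx d s ⊕ Idx d s → SFun d s := Sum.elim V F

/-- `(V, F)` lies in the eigenspace of `U_A` (acting on rows from the right) to the
eigenvalue `c`. -/
def InEigenspace (U : Set (Fin d → ℝ)) (A : BlockTensor d s) (c : ℝ)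
    (V F : Idx d s → SFun d s) : Prop :=
  ∀ a, ∀ x ∈ U, (row V F ᵥ* A.op) a x = c • row V F a x

/-- The matrix `(1 + c U_A) / 2`: for `c = 1`, `c = -1` the projectors `𝒫₊`, `𝒫₋`. -/
noncomputable def projector (A : BlockTensor d s) (c : ℝ) : Mat d s (SFun d s) :=
  (1 / 2 : ℝ) • (1 + c • A.op)

/-! ### Worldsheet fields -/

/-- `∂_t` on the worldsheet with coordinates `(t, σ)`. -/
noncomputable def dt {N : ℕ} (g : ℝ × ℝ → Gr N) (p : ℝ × ℝ) : Gr N := fderiv ℝ g p (1, 0)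

/-- `∂_σ`. -/
noncomputable def dσ {N : ℕ} (g : ℝ × ℝ → Gr N) (p : ℝ × ℝ) : Gr N := fderiv ℝ g p (0, 1)

/-- `∂ = ∂_t + ∂_σ`. -/
noncomputable def del {N : ℕ} (g : ℝ × ℝ → Gr N) (p : ℝ × ℝ) : Gr N := dt g p + dσ g p

/-- `∂̄ = ∂_t - ∂_σ`. -/
noncomputable def delbar {N : ℕ} (g : ℝ × ℝ → Gr N) (p : ℝ × ℝ) : Gr N := dt g p - dσ g p

/-- Smooth fields `Z^i`, `P_i` on the worldsheet `W`, valued in the Grassmann algebra with `N`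
generators; `Z` takes its values in the superdomain with body `U`, and `P_i` has the parity
of `Z^i`. -/
structure Fields (d s N : ℕ) (U : Set (Fin d → ℝ)) (W : Set (ℝ × ℝ)) where
  Z : ℝ × ℝ → GrPoint d s N
  P : ℝ × ℝ → GrPoint d s N
  smooth_Z : ∀ i, ContDiffOn ℝ ∞ (fun p => (Z p).coord i) W
  smooth_P : ∀ i, ContDiffOn ℝ ∞ (fun p => (P p).coord i) W
  body_mem : ∀ p ∈ W, (Z p).body ∈ U

namespace Fields

variable {N : ℕ} {U : Set (Fin d → ℝ)} {W : Set (ℝ × ℝ)} (φ : Fields d s N U W)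

noncomputable def dtZ (i : Idx d s) (p : ℝ × ℝ) : Gr N := dt (fun q => (φ.Z q).coord i) p

noncomputable def dσZ (i : Idx d s) (p : ℝ × ℝ) : Gr N := dσ (fun q => (φ.Z q).coord i) p

noncomputable def dtP (i : Idx d s) (p : ℝ × ℝ) : Gr N := dt (fun q => (φ.P q).coord i) p

/-- The row `(∂_σ Z^i  P_i)`. -/
noncomputable def left (p : ℝ × ℝ) : Idx d s ⊕ Idx d s → Gr N :=
  Sum.elim (fun i => φ.dσZ i p) (fun i => (φ.P p).coord i)

/-- The column `(∂_σ Z^j (-)^j ; P_j)`. -/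
noncomputable def right (p : ℝ × ℝ) : Idx d s ⊕ Idx d s → Gr N :=
  Sum.elim (fun j => sg (par j) • φ.dσZ j p) (fun j => (φ.P p).coord j)

/-- The column `(P_j ; ∂_σ Z^j (-)^j)`. -/
noncomputable def right' (p : ℝ × ℝ) : Idx d s ⊕ Idx d s → Gr N :=
  Sum.elim (fun j => (φ.P p).coord j) (fun j => sg (par j) • φ.dσZ j p)

/-- A matrix of superfunctions along the field `Z`. -/
noncomputable def along (M : Mat d s (SFun d s)) (p : ℝ × ℝ) : Mat d s (Gr N) :=
  fun a b => (φ.Z p).eval (M a b)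

/-- The equations of motion of the action
`S = ∫ ∂_t Z^i P_i - ½ (∂_σ Z^i  P_i) (A_{ij}, A_i^j; A^i_j, A^{ij}) (∂_σ Z^j (-)^j ; P_j)`. -/
structure IsSolution (A : BlockTensor d s) : Prop where
  eom_Z : ∀ p ∈ W, ∀ i, φ.dtZ i p =
    (1 / 2 : ℝ) • (sg (par i) • (φ.along A.toMatrix p *ᵥ φ.right p) (.inr i)
      + (φ.left p ᵥ* φ.along A.toMatrix p) (.inr i))
  eom_P : ∀ p ∈ W, ∀ i, φ.dtP i p =
    -((1 / 2 : ℝ) • (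
      (∑ a, ∑ b, sg (par₂ a * par i) •
          (φ.left p a * (φ.Z p).eval (pd i (A.toMatrix a b)) * φ.right p b))
      - dσ (fun q => (φ.along A.toMatrix q *ᵥ φ.right q) (.inl i)) p
      - dσ (fun q => (φ.left q ᵥ* φ.along A.toMatrix q) (.inl i)) p))

/-- The component `(V^i  F_i) (1 + c U_A)/2 (P_j ; ∂_σ Z^j (-)^j)` of the current. -/
noncomputable def current (A : BlockTensor d s) (c : ℝ) (V F : Idx d s → SFun d s)
    (p : ℝ × ℝ) : Gr N :=
  ((fun a => (φ.Z p).eval (row V F a)) ᵥ* φ.along (projector A c) p) ⬝ᵥ φ.right' p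

noncomputable def jz (A : BlockTensor d s) (V F : Idx d s → SFun d s) : ℝ × ℝ → Gr N :=
  φ.current A 1 V F

noncomputable def jzbar (A : BlockTensor d s) (V F : Idx d s → SFun d s) : ℝ × ℝ → Gr N :=
  φ.current A (-1) V F

/-- `V^i P_i + F_i ∂_σ Z^i (-)^i`. -/
noncomputable def jVF (V F : Idx d s → SFun d s) (p : ℝ × ℝ) : Gr N :=
  ∑ i, ((φ.Z p).eval (V i) * (φ.P p).coord i
    + (φ.Z p).eval (F i) * (sg (par i) • φ.dσZ i p))

end Fields

/-- `∂̄ j_z + ∂ j_z̄ = 0` on every solution of the equations of motion (with values in any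
Grassmann algebra). -/
def CurrentConserved (U : Set (Fin d → ℝ)) (W : Set (ℝ × ℝ)) (A : BlockTensor d s)
    (V F : Idx d s → SFun d s) : Prop :=
  ∀ (N : ℕ) (φ : Fields d s N U W), φ.IsSolution A →
    ∀ p ∈ W, delbar (φ.jz A V F) p + del (φ.jzbar A V F) p = 0

/-- `∂̄ j_z = 0` on every solution. -/
def CurrentHolomorphic (U : Set (Fin d → ℝ)) (W : Set (ℝ × ℝ)) (A : BlockTensor d s)
    (V F : Idx d s → SFun d s) : Prop :=
  ∀ (N : ℕ) (φ : Fields d s N U W), φ.IsSolution A → ∀ p ∈ W, delbar (φ.jz A V F) p = 0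

/-- `∂ j_z̄ = 0` on every solution. -/
def CurrentAntiholomorphic (U : Set (Fin d → ℝ)) (W : Set (ℝ × ℝ)) (A : BlockTensor d s)
    (V F : Idx d s → SFun d s) : Prop :=
  ∀ (N : ℕ) (φ : Fields d s N U W), φ.IsSolution A → ∀ p ∈ W, del (φ.jzbar A V F) p = 0

/-! ### Lie derivatives and the exterior derivative

`e` is the common parity of `V` and `F`. -/

/-- `V(f) = V^k ∂_k f`. -/
noncomputable def vec (V : Idx d s → SFun d s) (f : SFun d s) : SFun d s :=
  ∑ k, V k * pd k f

/-- `(L_V A)_{ij}`. -/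
noncomputable def lieLL (e : ZMod 2) (V : Idx d s → SFun d s) (A : BlockTensor d s)
    (i j : Idx d s) : SFun d s :=
  vec V (A.ll i j) + ∑ k, sg (e * par i) • (pd i (V k) * A.ll k j)
    + ∑ k, sg (par i * par j + e * par j) • (pd j (V k) * A.ll k i)

/-- `(L_V A)^{ij}`. -/
noncomputable def lieUU (e : ZMod 2) (V : Idx d s → SFun d s) (A : BlockTensor d s)
    (i j : Idx d s) : SFun d s :=
  vec V (A.uu i j) - ∑ k, sg (e * par i) • (A.uu i k * pd k (V j))
    - ∑ k, sg (par i + par j + par i * par j + e * par j) • (A.uu j k * pd k (V i))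

/-- `(L_V A)_i^j`. -/
noncomputable def lieLU (e : ZMod 2) (V : Idx d s → SFun d s) (A : BlockTensor d s)
    (i j : Idx d s) : SFun d s :=
  vec V (A.lu i j) - ∑ k, sg (e * par i) • (A.lu i k * pd k (V j))
    + ∑ k, sg (e * par i) • (pd i (V k) * A.lu k j)

/-- The components `(dF)_{ij} = (-)^{i|F|} ∂_i F_j - (-)^{ij + j|F|} ∂_j F_i`
of the exterior derivative of the one-form with `F(∂_i) = F_i`. -/
noncomputable def dF (e : ZMod 2) (F : Idx d s → SFun d s) (i j : Idx d s) : SFun d s :=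
  sg (par i * e) • pd i (F j) - sg (par i * par j + par j * e) • pd j (F i)

/-- The conditions
`(L_V A)_{ij} = -[(dF)_{ik} A^k_j + (-)^{ij} (dF)_{jk} A^k_i]`,
`(L_V A)_i^j = -(dF)_{ik} A^{kj}`, `(L_V A)^{ij} = 0`. -/
def SymmetryConditions (U : Set (Fin d → ℝ)) (e : ZMod 2) (A : BlockTensor d s)
    (V F : Idx d s → SFun d s) : Prop :=
  (∀ i j, ∀ x ∈ U, lieLL e V A i j x =
    -((∑ k, dF e F i k * A.ul k j) + sg (par i * par j) • ∑ k, dF e F j k * A.ul k i) x) ∧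
  (∀ i j, ∀ x ∈ U, lieLU e V A i j x = -(∑ k, dF e F i k * A.uu k j) x) ∧
  (∀ i j, ∀ x ∈ U, lieUU e V A i j x = 0)

/-- The matrix `K` with `(L_V S)^b = V(S^b) - (-)^{|V||S|} S^c K_c^b` for the row
`S = (X^i  G_i)` of components of a section: this is
`[V, X]^i = V(X^i) - (-)^{|V||S|} X^k ∂_k V^i` and
`(L_V G)_i = V(G_i) + (-)^{|V|i + (i+k)|S|} ∂_i V^k G_k`. -/
noncomputable def lieMat (e : ZMod 2) (V : Idx d s → SFun d s) : Mat d s (SFun d s) :=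
  Matrix.fromBlocks (Matrix.of fun k i => pd k (V i)) 0 0
    (Matrix.of fun k i => -(sg (e * (par i + par k) + par i * par k + par k) • pd i (V k)))

/-- The Lie derivative of an even endomorphism with matrix `U`, acting on rows from the right:
`(L_V U)_{ab} = V(U_{ab}) - (-)^{|V|a} (U K - K U)_{ab}`. Equivalently, it is determined by the
Leibniz rule `L_V (S U) = (L_V S) U + (-)^{|V||S|} S^a (-)^{|V|a} (L_V U)_{ab}`. -/
noncomputable def lieOp (e : ZMod 2) (V : Idx d s → SFun d s) (M : Mat d s (SFun d s)) :
    Mat d s (SFun d s) :=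
  Matrix.of fun a b => vec V (M a b) - sg (e * par₂ a) • (M * lieMat e V - lieMat e V * M) a b

/-- The matrix `(0 dF; 0 0)`. -/
noncomputable def dFMat (e : ZMod 2) (F : Idx d s → SFun d s) : Mat d s (SFun d s) :=
  Matrix.fromBlocks 0 (Matrix.of (dF e F)) 0 0

/-- The commutator `[T, U]` of an endomorphism `T` of parity `e`, which acts on rows by
`S ↦ S^a (-)^{e a} T_{ab}`, with an even one. In components
`[T, U]_{ab} = T_{ac} U_{cb} - (-)^{e(a+c)} U_{ac} T_{cb}`;
for `e = 0` it is the commutator of matrices. -/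
noncomputable def opComm (e : ZMod 2) (T M : Mat d s (SFun d s)) : Mat d s (SFun d s) :=
  Matrix.of fun a b => ∑ c, (T a c * M c b - sg (e * (par₂ a + par₂ c)) • (M a c * T c b))

/-- The Lie derivative `L_{(V,F)} U = L_V U + [(0 dF; 0 0), U]`. -/
noncomputable def lieSec (e : ZMod 2) (V F : Idx d s → SFun d s) (M : Mat d s (SFun d s)) :
    Mat d s (SFun d s) :=
  lieOp e V M + opComm e (dFMat e F) M

end SuperSigma

namespace SuperSigma

/-! ### Signs -/

/-! Supersymmetry of `A` and graded commutativity make the two halves of each equation of motion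
coincide. With the row `l = (∂_σ Z P)` and the flux `w = l A`, the equations read `∂_t Z^i = w^i`
and `∂_t P_i = ∂_σ w_i - ½ force_i`, where the force is quadratic in `l` with coefficients `∂_i A`
(`Fields.isSolution_iff`). The two components of the current are half the sum and half the
difference of the pairings of `(V, F)` with `l` and with the index-swapped `w`, so `∂̄ j_z + ∂ j_z̄`
is `∂_t` of the first pairing minus `∂_σ` of the second. On solutions the second derivatives cancel.
What remains is a quadratic form in `l`, and after supersymmetrization its coefficients are, up to a
constant, the Lie derivative of `A` along `(V, F)` (`Fields.delbar_add_del_eq_lieForm`). The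
vanishing of this form is, block by block, the system `(*)` (`symmetryConditions_iff`), so `(*)`
implies conservation. Swapping the column index turns the form into twice the Lie derivative of the
endomorphism (`lieSec_op`), which is the second claim.

The converse needs enough solutions, but no existence theorem for partial differential equations. If
the initial row `l` has entries in an ideal `I` with `I³ = 0`, the power series solution stops at
second order and a polynomial solves the equations exactly on the whole worldsheet
(`NilpotentSolution.fields_isSolution`). Let the base point have arbitrary body `x ∈ U` and free
generators as odd coordinates, and let `l` be supported on two components, carrying independent
nilpotent parameters `ε`, `ε'`. Polarization isolates `ε X_{ab} ε' = 0` for the form `X`, and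
freeness of the generators gives `X_{ab}(x) = 0` (`eq_zero_of_param_mul_eval`). The same
configurations show that a component of the current which vanishes for all fields comes from a
vanishing projection of the row `(V F)`; this yields the eigenspace statements
(`inEigenspace_iff_current`).

The analytic basis is that evaluation at a Grassmann-valued point is multiplicative
(`GrPoint.eval_mul`) and satisfies the chain rule (`GrPoint.fderiv_eval`). -/

theorem eq_zero_or_one : ∀ a : ZMod 2, a = 0 ∨ a = 1 := by decide

theorem sg_zero : sg 0 = 1 := if_pos rfl

theorem sg_one : sg 1 = -1 := if_neg (by decide)

theorem sg_add (a b : ZMod 2) : sg (a + b) = sg a * sg b := by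
  obtain rfl | rfl := eq_zero_or_one a <;> obtain rfl | rfl := eq_zero_or_one b <;>
    simp only [add_zero, zero_add, show (1 : ZMod 2) + 1 = 0 from rfl, sg_zero, sg_one] <;> norm_num

theorem sg_mul_self (a : ZMod 2) : sg a * sg a = 1 := by
  obtain rfl | rfl := eq_zero_or_one a <;> simp [sg_zero, sg_one]

theorem sg_smul_smul {E : Type*} [AddCommGroup E] [Module ℝ E] (a b : ZMod 2) (x : E) :
    sg a • sg b • x = sg (a + b) • x := by
  rw [smul_smul, sg_add]

theorem sg_smul_self {E : Type*} [AddCommGroup E] [Module ℝ E] (a : ZMod 2) (x : E) :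
    sg a • sg a • x = x := by
  rw [smul_smul, sg_mul_self, one_smul]

theorem sg_smul_eq_zero {E : Type*} [AddCommGroup E] [Module ℝ E] {a : ZMod 2} {x : E} :
    sg a • x = 0 ↔ x = 0 :=
  ⟨fun h => by rw [← sg_smul_self a x, h, smul_zero], fun h => by rw [h, smul_zero]⟩

/-! ### The grading of the Grassmann algebra -/

namespace Gr

variable {N : ℕ}

theorem mul_mem {a b : ZMod 2} {x y : Gr N} (hx : x ∈ parity N a) (hy : y ∈ parity N b) :
    x * y ∈ parity N (a + b) :=
  CliffordAlgebra.evenOdd_mul_le _ a b (Submodule.mul_mem_mul hx hy)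

theorem one_mem : (1 : Gr N) ∈ parity N 0 :=
  Submodule.one_le.mp (CliffordAlgebra.one_le_evenOdd_zero _)

theorem algebraMap_mem (r : ℝ) : algebraMap ℝ (Gr N) r ∈ parity N 0 := by
  rw [Algebra.algebraMap_eq_smul_one]
  exact Submodule.smul_mem _ _ one_mem

theorem ι_mem (v : Fin N → ℝ) : (ExteriorAlgebra.ι ℝ v : Gr N) ∈ parity N 1 :=
  CliffordAlgebra.ι_mem_evenOdd_one _ v

theorem exists_add (x : Gr N) : ∃ y ∈ parity N 0, ∃ z ∈ parity N 1, y + z = x := by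
  have h := (CliffordAlgebra.evenOdd_isCompl (0 : QuadraticForm ℝ (Fin N → ℝ))).sup_eq_top
  exact Submodule.mem_sup.mp (h ▸ Submodule.mem_top : x ∈ _ ⊔ _)

theorem even_mul_ι {x : Gr N} (hx : x ∈ parity N 0) (v : Fin N → ℝ) :
    x * ExteriorAlgebra.ι ℝ v = ExteriorAlgebra.ι ℝ v * x := by
  have sw : ∀ a b : Fin N → ℝ, ExteriorAlgebra.ι ℝ a * ExteriorAlgebra.ι ℝ b
      = -(ExteriorAlgebra.ι ℝ b * ExteriorAlgebra.ι ℝ a) := fun a b =>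
    eq_neg_of_add_eq_zero_left (ExteriorAlgebra.ι_add_mul_swap a b)
  induction x, hx using CliffordAlgebra.even_induction with
  | algebraMap r => exact Algebra.commutes r _
  | add a b ha hb iha ihb => rw [add_mul, iha, ihb, mul_add]
  | ι_mul_ι_mul m₁ m₂ a ha ih =>
    change ExteriorAlgebra.ι ℝ m₁ * ExteriorAlgebra.ι ℝ m₂ * a * _
      = _ * (ExteriorAlgebra.ι ℝ m₁ * ExteriorAlgebra.ι ℝ m₂ * a)
    rw [mul_assoc _ a, ih, ← mul_assoc (ExteriorAlgebra.ι ℝ v),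
      ← mul_assoc (ExteriorAlgebra.ι ℝ v), sw v m₁, neg_mul,
      mul_assoc _ (ExteriorAlgebra.ι ℝ v), sw v m₂]
    simp only [mul_neg, neg_neg, mul_assoc]

/-- Even elements are central. -/
theorem even_comm {x : Gr N} (hx : x ∈ parity N 0) (y : Gr N) : x * y = y * x := by
  induction y using CliffordAlgebra.left_induction with
  | algebraMap r => exact (Algebra.commutes r x).symm
  | add a b iha ihb => rw [mul_add, iha, ihb, add_mul]
  | ι_mul a m ih =>
    change x * (ExteriorAlgebra.ι ℝ m * a) = ExteriorAlgebra.ι ℝ m * a * x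
    rw [← mul_assoc, even_mul_ι hx, mul_assoc, ih, mul_assoc]

/-- Graded commutativity. -/
theorem comm {a b : ZMod 2} {x y : Gr N} (hx : x ∈ parity N a) (hy : y ∈ parity N b) :
    x * y = sg (a * b) • (y * x) := by
  obtain rfl | rfl : a = 0 ∨ a = 1 := eq_zero_or_one a
  · rw [zero_mul, sg_zero, one_smul, even_comm hx]
  obtain rfl | rfl : b = 0 ∨ b = 1 := eq_zero_or_one b
  · rw [mul_zero, sg_zero, one_smul, even_comm hy]
  · rw [mul_one, sg_one, neg_one_smul, odd_mul_odd hy hx]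

theorem contractLeft_mem {a : ZMod 2} {x : Gr N} (hx : x ∈ parity N a)
    (f : Module.Dual ℝ (Fin N → ℝ)) :
    (CliffordAlgebra.contractLeft f x : Gr N) ∈ parity N (1 + a) := by
  have key : ∀ y : Gr N, ∀ g : Module.Dual ℝ (Fin N → ℝ), ∀ m : Fin N → ℝ,
      (CliffordAlgebra.contractLeft g (ExteriorAlgebra.ι ℝ m * y) : Gr N)
        = g m • y - ExteriorAlgebra.ι ℝ m * CliffordAlgebra.contractLeft g y :=
    fun y g m => CliffordAlgebra.contractLeft_ι_mul g m y
  -- The inductions on even and on odd elements both adjoin two generators at a time, so they share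
  -- this step.
  have step : ∀ b : ZMod 2, ∀ y ∈ parity N b, CliffordAlgebra.contractLeft f y ∈ parity N (1 + b) →
      ∀ m₁ m₂, CliffordAlgebra.contractLeft f
        ((ExteriorAlgebra.ι ℝ m₁ * ExteriorAlgebra.ι ℝ m₂ : Gr N) * y) ∈ parity N (1 + b) := by
    intro b y hy ih m₁ m₂
    have hb : ∀ b : ZMod 2, 1 + (1 + b) = b := by decide
    rw [mul_assoc, key, key]
    refine Submodule.sub_mem _ (Submodule.smul_mem _ _ (mul_mem (ι_mem m₂) hy)) ?_
    refine mul_mem (ι_mem m₁) (Submodule.sub_mem _ (Submodule.smul_mem _ _ hy) ?_)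
    exact hb b ▸ mul_mem (ι_mem m₂) ih
  obtain rfl | rfl : a = 0 ∨ a = 1 := eq_zero_or_one a
  · induction x, hx using CliffordAlgebra.even_induction with
    | algebraMap r =>
      rw [CliffordAlgebra.contractLeft_algebraMap]
      exact Submodule.zero_mem _
    | add a b ha hb iha ihb => rw [map_add]; exact Submodule.add_mem _ iha ihb
    | ι_mul_ι_mul m₁ m₂ a ha ih => exact step 0 a ha ih m₁ m₂
  · induction x, hx using CliffordAlgebra.odd_induction with
    | ι w =>
      rw [CliffordAlgebra.contractLeft_ι]
      exact algebraMap_mem _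
    | add a b ha hb iha ihb => rw [map_add]; exact Submodule.add_mem _ iha ihb
    | ι_mul_ι_mul m₁ m₂ a ha ih => exact step 1 a ha ih m₁ m₂

/-! ### Nilpotency -/

/-- The span of the generators. -/
noncomputable def gens (N : ℕ) : Submodule ℝ (Gr N) :=
  LinearMap.range (ExteriorAlgebra.ι ℝ : (Fin N → ℝ) →ₗ[ℝ] Gr N)

/-- The `k`-th power of the ideal of nilpotent elements. -/
noncomputable def nil (N k : ℕ) : Submodule ℝ (Gr N) := gens N ^ k * ⊤

/-- A generator moves to the left past the even and the odd part of any element at the cost of a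
sign. Hence the right ideals `nil N k` are two-sided and multiply as powers of one ideal. -/
theorem top_mul_gens_le : (⊤ : Submodule ℝ (Gr N)) * gens N ≤ gens N * ⊤ := by
  rw [Submodule.mul_le]
  rintro x - _ ⟨v, rfl⟩
  obtain ⟨y, hy, z, hz, rfl⟩ := exists_add x
  rw [add_mul, even_mul_ι hy, odd_mul_ι hz, ← mul_neg]
  exact Submodule.add_mem _ (Submodule.mul_mem_mul ⟨v, rfl⟩ trivial)
    (Submodule.mul_mem_mul ⟨v, rfl⟩ trivial)

theorem top_mul_gens_pow_le (k : ℕ) :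
    (⊤ : Submodule ℝ (Gr N)) * gens N ^ k ≤ gens N ^ k * ⊤ := by
  induction k with
  | zero => rw [pow_zero, mul_one, one_mul]
  | succ k ih =>
    calc (⊤ : Submodule ℝ (Gr N)) * gens N ^ (k + 1) = ⊤ * gens N ^ k * gens N := by
          rw [pow_succ, mul_assoc]
      _ ≤ gens N ^ k * ⊤ * gens N := mul_le_mul_left ih _
      _ = gens N ^ k * (⊤ * gens N) := mul_assoc _ _ _
      _ ≤ gens N ^ k * (gens N * ⊤) := mul_le_mul_right top_mul_gens_le _
      _ = gens N ^ (k + 1) * ⊤ := by rw [pow_succ, mul_assoc]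

theorem nil_mul_le (j k : ℕ) : nil N j * nil N k ≤ nil N (j + k) :=
  calc nil N j * nil N k = gens N ^ j * (⊤ * gens N ^ k) * ⊤ := by
        simp only [nil, mul_assoc]
    _ ≤ gens N ^ j * (gens N ^ k * ⊤) * ⊤ :=
        mul_le_mul_left (mul_le_mul_right (top_mul_gens_pow_le k) _) _
    _ = gens N ^ (j + k) * (⊤ * ⊤) := by rw [pow_add]; simp only [mul_assoc]
    _ ≤ nil N (j + k) := mul_le_mul_right le_top _

theorem mul_mem_nil {j k : ℕ} {x y : Gr N} (hx : x ∈ nil N j) (hy : y ∈ nil N k) :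
    x * y ∈ nil N (j + k) :=
  nil_mul_le j k (Submodule.mul_mem_mul hx hy)

theorem mem_nil_zero (x : Gr N) : x ∈ nil N 0 := by
  rw [nil, pow_zero, one_mul]
  trivial

/-- The `k`-th exterior power is spanned by alternating products of `k` vectors, and more than `N`
vectors of `ℝ^N` are linearly dependent. -/
theorem nil_eq_zero {k : ℕ} (hk : N < k) {x : Gr N} (hx : x ∈ nil N k) : x = 0 := by
  suffices h : gens N ^ k = ⊥ by
    rw [nil, h, Submodule.bot_mul] at hx
    exact (Submodule.mem_bot ℝ).mp hx
  change ⋀[ℝ]^k (Fin N → ℝ) = ⊥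
  rw [← ExteriorAlgebra.ιMulti_span_fixedDegree, Submodule.span_eq_bot]
  rintro _ ⟨v, rfl⟩
  refine AlternatingMap.map_linearDependent _ v fun h => ?_
  have := h.fintype_card_le_finrank
  simp at this
  omega

theorem sub_algebraMap_mem_nil (x : Gr N) :
    x - algebraMap ℝ (Gr N) (ExteriorAlgebra.algebraMapInv x) ∈ nil N 1 := by
  induction x using CliffordAlgebra.left_induction with
  | algebraMap r =>
    have := ExteriorAlgebra.algebraMap_leftInverse (R := ℝ) (Fin N → ℝ) r
    rw [show ExteriorAlgebra.algebraMapInv ((algebraMap ℝ (CliffordAlgebra 0)) r) = r from this]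
    exact (sub_self (algebraMap ℝ (Gr N) r)).symm ▸ Submodule.zero_mem _
  | add a b iha ihb =>
    rw [map_add, map_add, add_sub_add_comm]
    exact Submodule.add_mem _ iha ihb
  | ι_mul a m ih =>
    have h : ExteriorAlgebra.algebraMapInv (ExteriorAlgebra.ι ℝ m : Gr N) = 0 := by
      simp [ExteriorAlgebra.algebraMapInv]
    change ExteriorAlgebra.ι ℝ m * a
      - algebraMap ℝ (Gr N) (ExteriorAlgebra.algebraMapInv (ExteriorAlgebra.ι ℝ m * a)) ∈ _
    rw [map_mul, h, zero_mul, map_zero, sub_zero, nil, pow_one]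
    exact Submodule.mul_mem_mul ⟨m, rfl⟩ trivial

/-! ### Calculus -/

instance : Module.Finite ℝ (Gr N) :=
  Module.Finite.of_basis (Pi.basisFun ℝ (Fin N)).ExteriorAlgebra

/-- The multiplication of the Grassmann algebra as a continuous bilinear map. -/
noncomputable def mulB (N : ℕ) : Gr N →L[ℝ] Gr N →L[ℝ] Gr N :=
  (LinearMap.mul ℝ (Gr N)).toContinuousBilinearMap

theorem mulB_apply (x y : Gr N) : mulB N x y = x * y := rfl

variable {E : Type*} [NormedAddCommGroup E] [NormedSpace ℝ E]

theorem hasFDerivAt_mul {f g : E → Gr N} {f' g' : E →L[ℝ] Gr N} {p : E}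
    (hf : HasFDerivAt f f' p) (hg : HasFDerivAt g g' p) :
    HasFDerivAt (fun q => f q * g q)
      ((mulB N (f p)).comp g' + ((mulB N).flip (g p)).comp f') p := by
  have := (mulB N).hasFDerivAt_of_bilinear hf hg
  refine this.congr_fderiv ?_
  ext v
  simp [mulB_apply]

theorem _root_.DifferentiableAt.gr_mul {f g : E → Gr N} {p : E}
    (hf : DifferentiableAt ℝ f p) (hg : DifferentiableAt ℝ g p) :
    DifferentiableAt ℝ (fun q => f q * g q) p :=
  (hasFDerivAt_mul hf.hasFDerivAt hg.hasFDerivAt).differentiableAt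

theorem fderiv_mul {f g : E → Gr N} {p : E}
    (hf : DifferentiableAt ℝ f p) (hg : DifferentiableAt ℝ g p) (v : E) :
    fderiv ℝ (fun q => f q * g q) p v = fderiv ℝ f p v * g p + f p * fderiv ℝ g p v := by
  rw [(hasFDerivAt_mul hf.hasFDerivAt hg.hasFDerivAt).fderiv, add_comm]
  rfl

theorem _root_.ContDiffOn.gr_mul {f g : E → Gr N} {s : Set E} {n : WithTop ℕ∞}
    (hf : ContDiffOn ℝ n f s) (hg : ContDiffOn ℝ n g s) :
    ContDiffOn ℝ n (fun q => f q * g q) s :=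
  (mulB N).isBoundedBilinearMap.contDiff.comp_contDiffOn (hf.prodMk hg)

/-- A directional derivative is a limit of difference quotients, and a subspace of a
finite-dimensional space is closed. Applied to the parity subspaces, this says that differentiation
in even directions preserves parity. -/
theorem fderiv_mem {S : Submodule ℝ (Gr N)} {f : E → Gr N} {f' : E →L[ℝ] Gr N} {p : E}
    (hf : HasFDerivAt f f' p) (h : ∀ᶠ q in nhds p, f q ∈ S) (v : E) : f' v ∈ S := by
  obtain ⟨S', hS'⟩ : ∃ S' : Submodule ℝ (Gr N), S' = S := ⟨S, rfl⟩
  have hc : IsClosed (S : Set (Gr N)) := S.closed_of_finiteDimensional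
  have hd : HasDerivAt (fun t : ℝ => f (p + t • v)) (f' v) 0 := by
    have h1 : HasDerivAt (fun t : ℝ => p + t • v) v 0 := by
      simpa using ((hasDerivAt_id (0 : ℝ)).smul_const v).const_add p
    have h2 : HasFDerivAt f f' (p + (0 : ℝ) • v) := by simpa using hf
    exact h2.comp_hasDerivAt _ h1
  rw [hasDerivAt_iff_tendsto_slope] at hd
  have h0 : f p ∈ S := h.self_of_nhds
  refine hc.mem_of_tendsto hd ?_
  have hcont : Filter.Tendsto (fun t : ℝ => p + t • v) (nhds 0) (nhds p) := by
    have : Continuous fun t : ℝ => p + t • v := by fun_prop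
    simpa using this.tendsto 0
  filter_upwards [(hcont.eventually h).filter_mono nhdsWithin_le_nhds] with t ht
  rw [slope_def_module]
  refine S.smul_mem _ (S.sub_mem ht ?_)
  simpa using h0

end Gr

end SuperSigma

namespace SuperSigma

/-! ### Superfunctions -/

namespace SFun

variable {d s : ℕ} {U : Set (Fin d → ℝ)} {f g : SFun d s}

theorem SmoothOn.add (hf : f.SmoothOn U) (hg : g.SmoothOn U) : (f + g).SmoothOn U :=
  ContDiffOn.add hf hg

theorem SmoothOn.sub (hf : f.SmoothOn U) (hg : g.SmoothOn U) : (f - g).SmoothOn U :=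
  ContDiffOn.sub hf hg

theorem SmoothOn.mul (hf : f.SmoothOn U) (hg : g.SmoothOn U) : (f * g).SmoothOn U :=
  ContDiffOn.gr_mul hf hg

theorem SmoothOn.smul (r : ℝ) (hf : f.SmoothOn U) : (r • f).SmoothOn U :=
  ContDiffOn.const_smul r hf

theorem SmoothOn.zero : (0 : SFun d s).SmoothOn U := contDiffOn_const

theorem SmoothOn.sum {ι : Type*} {t : Finset ι} {f : ι → SFun d s}
    (hf : ∀ i ∈ t, (f i).SmoothOn U) : (∑ i ∈ t, f i).SmoothOn U := by
  classical
  induction t using Finset.induction_on with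
  | empty => exact .zero
  | insert a t ha ih =>
    rw [Finset.sum_insert ha]
    exact (hf a (Finset.mem_insert_self a t)).add
      (ih fun i hi => hf i (Finset.mem_insert_of_mem hi))

theorem SmoothOn.differentiableAt (hf : f.SmoothOn U) (hU : IsOpen U) {x : Fin d → ℝ}
    (hx : x ∈ U) : DifferentiableAt ℝ f x :=
  (ContDiffOn.contDiffAt hf (hU.mem_nhds hx)).differentiableAt (by simp)

/-- Contraction as a continuous linear map. -/
noncomputable def contractL (μ : Fin s) : Gr s →L[ℝ] Gr s :=
  (CliffordAlgebra.contractLeft (Q := 0) (LinearMap.proj μ : (Fin s → ℝ) →ₗ[ℝ] ℝ)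
    : Gr s →ₗ[ℝ] Gr s).toContinuousLinearMap

theorem pd_inr (μ : Fin s) (f : SFun d s) : pd (.inr μ) f = fun x => contractL μ (f x) := rfl

theorem SmoothOn.pd (hU : IsOpen U) (hf : f.SmoothOn U) (i : Idx d s) :
    (pd i f).SmoothOn U := by
  cases i with
  | inl m =>
    have h : ContDiffOn ℝ ∞ (fderiv ℝ f) U := hf.fderiv_of_isOpen hU (by simp)
    exact h.clm_apply contDiffOn_const
  | inr μ => exact (contractL μ).contDiff.comp_contDiffOn hf

theorem pd_congr (hU : IsOpen U) (h : Set.EqOn f g U) (i : Idx d s) :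
    Set.EqOn (SuperSigma.pd i f) (SuperSigma.pd i g) U := by
  intro x hx
  cases i with
  | inl m =>
    have : f =ᶠ[nhds x] g := Filter.eventuallyEq_of_mem (hU.mem_nhds hx) h
    change fderiv ℝ f x _ = fderiv ℝ g x _
    rw [this.fderiv_eq]
  | inr μ => exact congrArg (contractL μ) (h hx)

theorem pd_add (hU : IsOpen U) (hf : f.SmoothOn U) (hg : g.SmoothOn U) (i : Idx d s)
    {x : Fin d → ℝ} (hx : x ∈ U) :
    SuperSigma.pd i (f + g) x = SuperSigma.pd i f x + SuperSigma.pd i g x := by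
  cases i with
  | inl m =>
    change fderiv ℝ (f + g) x _ = fderiv ℝ f x _ + fderiv ℝ g x _
    rw [fderiv_add (hf.differentiableAt hU hx) (hg.differentiableAt hU hx)]
    rfl
  | inr μ => exact map_add (contractL μ) _ _

theorem pd_smul (hU : IsOpen U) (r : ℝ) (hf : f.SmoothOn U) (i : Idx d s)
    {x : Fin d → ℝ} (hx : x ∈ U) :
    SuperSigma.pd i (r • f) x = r • SuperSigma.pd i f x := by
  cases i with
  | inl m =>
    change fderiv ℝ (r • f) x _ = r • fderiv ℝ f x _
    rw [fderiv_const_smul (hf.differentiableAt hU hx)]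
    rfl
  | inr μ => exact map_smul (contractL μ) _ _

theorem pd_inl_mul (hU : IsOpen U) (hf : f.SmoothOn U) (hg : g.SmoothOn U) (m : Fin d)
    {x : Fin d → ℝ} (hx : x ∈ U) :
    SuperSigma.pd (.inl m) (f * g) x
      = (SuperSigma.pd (.inl m) f * g + f * SuperSigma.pd (.inl m) g) x :=
  Gr.fderiv_mul (hf.differentiableAt hU hx) (hg.differentiableAt hU hx) _

/-- For two even directions this is the symmetry of second derivatives. An odd derivative is a
constant linear map applied to the values, so it commutes with differentiation in `x`. -/
theorem pd_comm (hU : IsOpen U) (hf : f.SmoothOn U) (m : Fin d) (i : Idx d s)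
    {x : Fin d → ℝ} (hx : x ∈ U) :
    SuperSigma.pd (.inl m) (SuperSigma.pd i f) x = SuperSigma.pd i (SuperSigma.pd (.inl m) f) x := by
  cases i with
  | inl n =>
    have hc : ContDiffAt ℝ ∞ f x := ContDiffOn.contDiffAt hf (hU.mem_nhds hx)
    have hd : DifferentiableAt ℝ (fderiv ℝ f) x :=
      (hc.fderiv_right (m := 1) (by norm_cast)).differentiableAt (by simp)
    have key : ∀ v w : Fin d → ℝ, fderiv ℝ (fun y => fderiv ℝ f y v) x w
        = fderiv ℝ (fderiv ℝ f) x w v := by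
      intro v w
      rw [fderiv_clm_apply hd (differentiableAt_const _)]
      simp
    change fderiv ℝ (fun y => fderiv ℝ f y (Pi.single n 1)) x (Pi.single m 1)
      = fderiv ℝ (fun y => fderiv ℝ f y (Pi.single m 1)) x (Pi.single n 1)
    rw [key, key]
    exact (hc.isSymmSndFDerivAt (by simp; norm_cast)).eq _ _
  | inr μ =>
    change fderiv ℝ (contractL μ ∘ f) x _ = contractL μ (fderiv ℝ f x _)
    rw [fderiv_comp x (contractL μ).differentiableAt (hf.differentiableAt hU hx),
      ContinuousLinearMap.fderiv]
    rfl

theorem HasParity.pd (hU : IsOpen U) (hf : f.SmoothOn U) {a : ZMod 2} (h : f.HasParity U a)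
    (i : Idx d s) : (pd i f).HasParity U (par i + a) := by
  intro x hx
  cases i with
  | inl m =>
    rw [show par (Sum.inl m : Idx d s) = 0 from rfl, zero_add]
    refine Gr.fderiv_mem (hf.differentiableAt hU hx).hasFDerivAt ?_ _
    filter_upwards [hU.mem_nhds hx] with y hy using h y hy
  | inr μ => exact Gr.contractLeft_mem (h x hx) _

end SFun

/-! ### Evaluation of superfunctions at Grassmann-valued points -/

namespace GrPoint

variable {d s N : ℕ} {U : Set (Fin d → ℝ)} {f g : SFun d s}

theorem soul_mem (z : GrPoint d s N) (m : Fin d) : z.soul m ∈ Gr.parity N 0 :=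
  Submodule.sub_mem _ (z.mem (.inl m)) (Gr.algebraMap_mem _)

theorem soul_mem_nil (z : GrPoint d s N) (m : Fin d) : z.soul m ∈ Gr.nil N 1 :=
  Gr.sub_algebraMap_mem_nil _

theorem subst_ι (z : GrPoint d s N) (v : Fin s → ℝ) :
    z.subst (ExteriorAlgebra.ι ℝ v) = ∑ μ, v μ • z.coord (.inr μ) := by
  rw [subst, ExteriorAlgebra.lift_ι_apply, Fintype.linearCombination_apply]

theorem subst_mem (z : GrPoint d s N) {a : ZMod 2} {x : Gr s} (hx : x ∈ Gr.parity s a) :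
    z.subst x ∈ Gr.parity N a := by
  have hι : ∀ v, z.subst (ExteriorAlgebra.ι ℝ v) ∈ Gr.parity N 1 := fun v => by
    rw [subst_ι]
    exact Submodule.sum_mem _ fun μ _ => Submodule.smul_mem _ _ (z.mem (.inr μ))
  have step : ∀ b : ZMod 2, ∀ y, z.subst y ∈ Gr.parity N b → ∀ m₁ m₂,
      z.subst (ExteriorAlgebra.ι ℝ m₁ * ExteriorAlgebra.ι ℝ m₂ * y) ∈ Gr.parity N b := by
    intro b y hy m₁ m₂
    have hb : ∀ b : ZMod 2, 1 + 1 + b = b := by decide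
    rw [map_mul, map_mul]
    exact hb b ▸ Gr.mul_mem (Gr.mul_mem (hι m₁) (hι m₂)) hy
  obtain rfl | rfl := eq_zero_or_one a
  · induction x, hx using CliffordAlgebra.even_induction with
    | algebraMap r =>
      have : z.subst (algebraMap ℝ (Gr s) r) = algebraMap ℝ (Gr N) r := z.subst.commutes r
      exact this ▸ Gr.algebraMap_mem r
    | add a b ha hb iha ihb => rw [map_add]; exact Submodule.add_mem _ iha ihb
    | ι_mul_ι_mul m₁ m₂ a ha ih => exact step 0 a ih m₁ m₂
  · induction x, hx using CliffordAlgebra.odd_induction with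
    | ι w => exact hι w
    | add a b ha hb iha ihb => rw [map_add]; exact Submodule.add_mem _ iha ihb
    | ι_mul_ι_mul m₁ m₂ a ha ih => exact step 1 a ih m₁ m₂

section Algebra

variable (z : GrPoint d s N)

theorem taylorTerm_zero (f : SFun d s) : z.taylorTerm 0 f = z.subst (f z.body) := rfl

theorem taylorTerm_succ (k : ℕ) (f : SFun d s) :
    z.taylorTerm (k + 1) f = ∑ m : Fin d, z.soul m * z.taylorTerm k (pd (.inl m) f) := rfl

variable {z} (hU : IsOpen U) (hz : z.body ∈ U)
include hU hz

/-- Identities between superfunctions are only known on `U`. Since `U` is open, they pass to all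
derivatives at a body in `U`, and so to values at Grassmann-valued points. -/
theorem taylorTerm_congr (k : ℕ) (h : Set.EqOn f g U) : z.taylorTerm k f = z.taylorTerm k g := by
  induction k generalizing f g with
  | zero => rw [taylorTerm_zero, taylorTerm_zero, h hz]
  | succ k ih =>
    rw [taylorTerm_succ, taylorTerm_succ]
    exact Finset.sum_congr rfl fun m _ => by rw [ih (SFun.pd_congr hU h (.inl m))]

theorem eval_congr (h : Set.EqOn f g U) : z.eval f = z.eval g :=
  Finset.sum_congr rfl fun k _ => by rw [taylorTerm_congr hU hz k h]

theorem taylorTerm_add (k : ℕ) (hf : f.SmoothOn U) (hg : g.SmoothOn U) :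
    z.taylorTerm k (f + g) = z.taylorTerm k f + z.taylorTerm k g := by
  induction k generalizing f g with
  | zero => exact map_add z.subst _ _
  | succ k ih =>
    simp only [taylorTerm_succ, ← Finset.sum_add_distrib, ← mul_add]
    refine Finset.sum_congr rfl fun m _ => ?_
    rw [← ih (hf.pd hU _) (hg.pd hU _)]
    exact congrArg _ (taylorTerm_congr hU hz k fun x hx => SFun.pd_add hU hf hg _ hx)

theorem taylorTerm_smul (k : ℕ) (r : ℝ) (hf : f.SmoothOn U) :
    z.taylorTerm k (r • f) = r • z.taylorTerm k f := by
  induction k generalizing f with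
  | zero => exact map_smul z.subst _ _
  | succ k ih =>
    simp only [taylorTerm_succ, Finset.smul_sum, ← mul_smul_comm]
    refine Finset.sum_congr rfl fun m _ => ?_
    rw [← ih (hf.pd hU _)]
    exact congrArg _ (taylorTerm_congr hU hz k fun x hx => SFun.pd_smul hU r hf _ hx)

theorem eval_add (hf : f.SmoothOn U) (hg : g.SmoothOn U) :
    z.eval (f + g) = z.eval f + z.eval g := by
  simp only [eval, taylorTerm_add hU hz _ hf hg, smul_add, Finset.sum_add_distrib]

theorem eval_smul (r : ℝ) (hf : f.SmoothOn U) : z.eval (r • f) = r • z.eval f := by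
  simp only [eval, taylorTerm_smul hU hz _ r hf, Finset.smul_sum]
  exact Finset.sum_congr rfl fun k _ => smul_comm _ _ _

theorem eval_zero : z.eval (0 : SFun d s) = 0 := by
  have := eval_smul (z := z) hU hz 0 (SFun.SmoothOn.zero (d := d) (s := s))
  simpa using this

theorem eval_sub (hf : f.SmoothOn U) (hg : g.SmoothOn U) :
    z.eval (f - g) = z.eval f - z.eval g := by
  have : f - g = f + (-1 : ℝ) • g := by rw [neg_one_smul, sub_eq_add_neg]
  rw [this, eval_add hU hz hf (hg.smul _), eval_smul hU hz _ hg, neg_one_smul, sub_eq_add_neg]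

theorem eval_sum {ι : Type*} {t : Finset ι} {f : ι → SFun d s}
    (hf : ∀ i ∈ t, (f i).SmoothOn U) : z.eval (∑ i ∈ t, f i) = ∑ i ∈ t, z.eval (f i) := by
  classical
  induction t using Finset.induction_on with
  | empty => exact eval_zero hU hz
  | insert a t ha ih =>
    have h' : ∀ i ∈ t, (f i).SmoothOn U := fun i hi => hf i (Finset.mem_insert_of_mem hi)
    rw [Finset.sum_insert ha, Finset.sum_insert ha,
      eval_add hU hz (hf a (Finset.mem_insert_self a t)) (.sum h'), ih h']

omit hU hz in
theorem taylorTerm_mem_nil (k : ℕ) (f : SFun d s) : z.taylorTerm k f ∈ Gr.nil N k := by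
  induction k generalizing f with
  | zero => exact Gr.mem_nil_zero _
  | succ k ih =>
    rw [taylorTerm_succ, add_comm]
    exact Submodule.sum_mem _ fun m _ => Gr.mul_mem_nil (z.soul_mem_nil m) (ih _)

theorem taylorTerm_mem (k : ℕ) (hf : f.SmoothOn U) {a : ZMod 2} (h : f.HasParity U a) :
    z.taylorTerm k f ∈ Gr.parity N a := by
  induction k generalizing f with
  | zero => exact z.subst_mem (h _ hz)
  | succ k ih =>
    rw [taylorTerm_succ]
    refine Submodule.sum_mem _ fun m _ => ?_
    have h1 := h.pd hU hf (.inl m)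
    rw [show par (Sum.inl m : Idx d s) = 0 from rfl, zero_add] at h1
    have := Gr.mul_mem (z.soul_mem m) (ih (hf.pd hU (.inl m)) h1)
    rwa [zero_add] at this

theorem eval_mem (hf : f.SmoothOn U) {a : ZMod 2} (h : f.HasParity U a) :
    z.eval f ∈ Gr.parity N a :=
  Submodule.sum_mem _ fun k _ => Submodule.smul_mem _ _ (taylorTerm_mem hU hz k hf h)

/-- The Leibniz rule for iterated derivatives: souls are even, hence central, so they can be
distributed over the two factors. The induction step is Pascal's rule. -/
theorem taylorTerm_mul (k : ℕ) (hf : f.SmoothOn U) (hg : g.SmoothOn U) :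
    z.taylorTerm k (f * g) = ∑ ij ∈ Finset.HasAntidiagonal.antidiagonal k,
      (k.choose ij.1 : ℝ) • (z.taylorTerm ij.1 f * z.taylorTerm ij.2 g) := by
  induction k generalizing f g with
  | zero => simp [taylorTerm_zero]
  | succ k ih =>
    have h1 : ∀ m : Fin d, z.taylorTerm k (pd (.inl m) (f * g))
        = (∑ ij ∈ Finset.HasAntidiagonal.antidiagonal k, (k.choose ij.1 : ℝ) •
            (z.taylorTerm ij.1 (pd (.inl m) f) * z.taylorTerm ij.2 g))
          + ∑ ij ∈ Finset.HasAntidiagonal.antidiagonal k, (k.choose ij.1 : ℝ) •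
            (z.taylorTerm ij.1 f * z.taylorTerm ij.2 (pd (.inl m) g)) := by
      intro m
      rw [taylorTerm_congr hU hz k fun x hx => SFun.pd_inl_mul hU hf hg m hx,
        taylorTerm_add hU hz k ((hf.pd hU _).mul hg) (hf.mul (hg.pd hU _)),
        ih (hf.pd hU _) hg, ih hf (hg.pd hU _)]
    have h2 : ∀ x y : Gr N, ∀ m, z.soul m * (x * y) = x * (z.soul m * y) := by
      intro x y m
      rw [← mul_assoc, Gr.even_comm (z.soul_mem m), mul_assoc]
    rw [taylorTerm_succ]
    simp only [h1, mul_add, Finset.sum_add_distrib, Finset.mul_sum, mul_smul_comm]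
    rw [Finset.sum_comm, Finset.sum_comm (s := Finset.univ) (t := Finset.HasAntidiagonal.antidiagonal k)]
    have h3 : ∀ ij : ℕ × ℕ, ∑ m, (k.choose ij.1 : ℝ) • (z.soul m *
        (z.taylorTerm ij.1 (pd (.inl m) f) * z.taylorTerm ij.2 g))
        = (k.choose ij.1 : ℝ) • (z.taylorTerm (ij.1 + 1) f * z.taylorTerm ij.2 g) := by
      intro ij
      rw [← Finset.smul_sum, taylorTerm_succ, Finset.sum_mul]
      simp only [mul_assoc]
    have h4 : ∀ ij : ℕ × ℕ, ∑ m, (k.choose ij.1 : ℝ) • (z.soul m *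
        (z.taylorTerm ij.1 f * z.taylorTerm ij.2 (pd (.inl m) g)))
        = (k.choose ij.1 : ℝ) • (z.taylorTerm ij.1 f * z.taylorTerm (ij.2 + 1) g) := by
      intro ij
      rw [← Finset.smul_sum, taylorTerm_succ, Finset.mul_sum]
      simp only [h2]
    simp only [h3, h4]
    have := Finset.sum_antidiagonal_choose_succ_nsmul
      (fun i j => z.taylorTerm i f * z.taylorTerm j g) k
    simp only [← Nat.cast_smul_eq_nsmul ℝ] at this
    rw [this, add_comm]
    congr 1
    refine Finset.sum_congr rfl fun ij hij => ?_
    rw [Nat.choose_symm_of_eq_add (Finset.HasAntidiagonal.mem_antidiagonal.mp hij).symm]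

theorem eval_mul (hf : f.SmoothOn U) (hg : g.SmoothOn U) :
    z.eval (f * g) = z.eval f * z.eval g := by
  have hF : ∀ k : ℕ, (k.factorial : ℝ) ≠ 0 := fun k => by positivity
  rw [eval, eval, eval, Finset.sum_mul_sum, ← Finset.sum_product']
  have h1 : ∀ k, (k.factorial : ℝ)⁻¹ • z.taylorTerm k (f * g)
      = ∑ ij ∈ Finset.HasAntidiagonal.antidiagonal k, (ij.1.factorial : ℝ)⁻¹ • z.taylorTerm ij.1 f
        * (ij.2.factorial : ℝ)⁻¹ • z.taylorTerm ij.2 g := by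
    intro k
    rw [taylorTerm_mul hU hz k hf hg, Finset.smul_sum]
    refine Finset.sum_congr rfl fun ij hij => ?_
    rw [smul_mul_smul_comm, smul_smul]
    congr 1
    have : k = ij.1 + ij.2 := (Finset.HasAntidiagonal.mem_antidiagonal.mp hij).symm
    subst this
    have h : (((ij.1 + ij.2).choose ij.1 : ℕ) : ℝ) * ij.1.factorial * ij.2.factorial
        = (ij.1 + ij.2).factorial := by
      have h0 := Nat.add_choose_mul_factorial_mul_factorial ij.2 ij.1
      rw [add_comm ij.2, mul_right_comm] at h0
      exact_mod_cast h0
    have := hF ij.1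
    have := hF ij.2
    have := hF (ij.1 + ij.2)
    field_simp
    linarith
  simp only [h1]
  rw [Finset.sum_sigma']
  -- The Taylor terms of the product cover exactly the pairs `(i, j)` with `i + j ≤ N`. The other
  -- pairs in the product of the two truncated series contain more than `N` soul factors and vanish.
  refine Finset.sum_of_injOn (fun x => x.2) ?_ ?_ ?_ ?_
  · rintro ⟨a, b⟩ ha ⟨a', b'⟩ ha' h
    simp only [Finset.coe_sigma, Set.mem_sigma_iff, Finset.mem_coe, Finset.HasAntidiagonal.mem_antidiagonal]
      at ha ha' h
    subst h
    obtain rfl : a = a' := ha.2.symm.trans ha'.2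
    rfl
  · rintro ⟨a, b⟩ ha
    simp only [Finset.coe_sigma, Set.mem_sigma_iff, Finset.mem_coe, Finset.HasAntidiagonal.mem_antidiagonal,
      Finset.mem_range] at ha
    simp only [Finset.coe_product, Set.mem_prod, Finset.mem_coe, Finset.mem_range]
    omega
  · rintro ⟨i, j⟩ - hn
    have hij : N < i + j := by
      by_contra h
      refine hn ⟨⟨i + j, (i, j)⟩, ?_, rfl⟩
      simp
      omega
    rw [smul_mul_smul_comm, Gr.nil_eq_zero hij
      (Gr.mul_mem_nil (taylorTerm_mem_nil i f) (taylorTerm_mem_nil j g)), smul_zero]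
  · intro x _
    rfl

end Algebra

end GrPoint

end SuperSigma

namespace SuperSigma

namespace GrPoint

/-! ### The chain rule -/

variable {d s N : ℕ} {U : Set (Fin d → ℝ)} {f g : SFun d s}
  {E : Type*} [NormedAddCommGroup E] [NormedSpace ℝ E] {Z : E → GrPoint d s N} {p : E}

/-- The body of an element, as a continuous linear map. -/
noncomputable def bodyL (N : ℕ) : Gr N →L[ℝ] ℝ :=
  (ExteriorAlgebra.algebraMapInv : Gr N →ₐ[ℝ] ℝ).toLinearMap.toContinuousLinearMap

theorem coord_deriv_mem (hZ : ∀ i, DifferentiableAt ℝ (fun q => (Z q).coord i) p)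
    (i : Idx d s) (v : E) : fderiv ℝ (fun q => (Z q).coord i) p v ∈ Gr.parity N (par i) :=
  Gr.fderiv_mem (hZ i).hasFDerivAt (Filter.Eventually.of_forall fun q => (Z q).mem i) v

section

variable (hZ : ∀ i, DifferentiableAt ℝ (fun q => (Z q).coord i) p)
include hZ

theorem differentiableAt_body (m : Fin d) : DifferentiableAt ℝ (fun q => (Z q).body m) p :=
  (bodyL N).differentiableAt.comp p (hZ (.inl m))

theorem fderiv_body (m : Fin d) (v : E) : fderiv ℝ (fun q => (Z q).body m) p v
    = bodyL N (fderiv ℝ (fun q => (Z q).coord (.inl m)) p v) := by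
  change fderiv ℝ (bodyL N ∘ fun q => (Z q).coord (.inl m)) p v = _
  rw [fderiv_comp p (bodyL N).differentiableAt (hZ (.inl m)), ContinuousLinearMap.fderiv]
  rfl

theorem differentiableAt_soul (m : Fin d) : DifferentiableAt ℝ (fun q => (Z q).soul m) p := by
  have h := ((Algebra.linearMap ℝ (Gr N)).toContinuousLinearMap).differentiableAt.comp p
    (differentiableAt_body hZ m)
  exact (hZ (.inl m)).sub h

theorem fderiv_soul (m : Fin d) (v : E) : fderiv ℝ (fun q => (Z q).soul m) p v
    = fderiv ℝ (fun q => (Z q).coord (.inl m)) p v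
      - algebraMap ℝ (Gr N) (fderiv ℝ (fun q => (Z q).body m) p v) := by
  have h := ((Algebra.linearMap ℝ (Gr N)).toContinuousLinearMap).hasFDerivAt.comp p
    (differentiableAt_body hZ m).hasFDerivAt
  have h2 := (hZ (.inl m)).hasFDerivAt.sub h
  have h3 : HasFDerivAt (fun q => (Z q).soul m) _ p := h2
  rw [h3.fderiv]
  rfl

/-- Needed for the chain rule: the derivative of a soul supplies one nilpotent factor, which kills
the Taylor term of top order `N`. -/
theorem fderiv_soul_mem_nil (m : Fin d) (v : E) :
    fderiv ℝ (fun q => (Z q).soul m) p v ∈ Gr.nil N 1 := by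
  rw [fderiv_soul hZ, fderiv_body hZ]
  exact Gr.sub_algebraMap_mem_nil _

/-- The chain rule in the odd directions for constant coefficients, proved by adjoining one
generator at a time on the left. -/
theorem subst_fderiv (g : Gr s) : DifferentiableAt ℝ (fun q => (Z q).subst g) p ∧
    ∀ v, fderiv ℝ (fun q => (Z q).subst g) p v
      = ∑ μ, fderiv ℝ (fun q => (Z q).coord (.inr μ)) p v
        * (Z p).subst (SFun.contractL μ g) := by
  induction g using CliffordAlgebra.left_induction with
  | algebraMap r =>
    have h : (fun q => (Z q).subst (algebraMap ℝ (Gr s) r)) = fun _ => algebraMap ℝ (Gr N) r :=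
      funext fun q => (Z q).subst.commutes r
    refine ⟨h ▸ differentiableAt_const _, fun v => ?_⟩
    have h0 : ∀ μ, SFun.contractL μ (algebraMap ℝ (Gr s) r) = 0 := fun μ =>
      CliffordAlgebra.contractLeft_algebraMap (Q := 0) _ r
    change fderiv ℝ (fun q => (Z q).subst (algebraMap ℝ (Gr s) r)) p v
      = ∑ μ, _ * (Z p).subst (SFun.contractL μ (algebraMap ℝ (Gr s) r))
    simp [h0]
  | add a b iha ihb =>
    have h : (fun q => (Z q).subst (a + b)) = (fun q => (Z q).subst a) + fun q => (Z q).subst b :=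
      funext fun q => map_add _ _ _
    refine ⟨h ▸ iha.1.add ihb.1, fun v => ?_⟩
    rw [h, fderiv_add iha.1 ihb.1, add_apply, iha.2, ihb.2,
      ← Finset.sum_add_distrib]
    simp only [map_add, mul_add]
  | ι_mul a m ih =>
    have h : (fun q => (Z q).subst (ExteriorAlgebra.ι ℝ m * a))
        = fun q => (∑ μ, m μ • (Z q).coord (.inr μ)) * (Z q).subst a :=
      funext fun q => by rw [map_mul, subst_ι]
    have hd : DifferentiableAt ℝ (fun q => ∑ μ, m μ • (Z q).coord (.inr μ)) p :=
      DifferentiableAt.fun_sum fun μ _ => (hZ (.inr μ)).const_smul (m μ)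
    refine ⟨h ▸ hd.gr_mul ih.1, fun v => ?_⟩
    have hc : ∀ μ, SFun.contractL μ (ExteriorAlgebra.ι ℝ m * a)
        = m μ • a - ExteriorAlgebra.ι ℝ m * SFun.contractL μ a := fun μ =>
      CliffordAlgebra.contractLeft_ι_mul (Q := 0) _ m a
    change fderiv ℝ (fun q => (Z q).subst (ExteriorAlgebra.ι ℝ m * a)) p v
      = ∑ μ, _ * (Z p).subst (SFun.contractL μ (ExteriorAlgebra.ι ℝ m * a))
    rw [h, Gr.fderiv_mul hd ih.1, ih.2,
      fderiv_fun_sum fun μ _ => (hZ (.inr μ)).fun_const_smul (m μ)]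
    simp only [hc, map_sub, map_smul, map_mul, mul_sub, Finset.sum_sub_distrib, subst_ι]
    rw [sub_eq_add_neg, sum_apply, Finset.sum_mul]
    congr 1
    · refine Finset.sum_congr rfl fun μ _ => ?_
      rw [fderiv_fun_const_smul (hZ (.inr μ))]
      simp
    -- The minus sign in the Leibniz rule of the contraction is the one produced when the derivative
    -- of an odd coordinate passes an odd coordinate.
    · rw [Finset.mul_sum, ← Finset.sum_neg_distrib]
      refine Finset.sum_congr rfl fun μ _ => ?_
      rw [← mul_assoc, ← mul_assoc, ← neg_mul]
      congr 1
      rw [Finset.sum_mul, Finset.mul_sum, ← Finset.sum_neg_distrib]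
      refine Finset.sum_congr rfl fun ν _ => ?_
      rw [smul_mul_assoc, mul_smul_comm, ← smul_neg,
        Gr.odd_mul_odd (coord_deriv_mem hZ (.inr μ) v) ((Z p).mem (.inr ν))]

variable (hU : IsOpen U) (hz : (Z p).body ∈ U)
include hU hz

/-- Both the substitution and its argument depend on the worldsheet point. Expanding the argument in
the monomial basis separates them into real coefficients, which depend on the body, times
substituted monomials, which depend on the odd coordinates. -/
theorem taylorTerm_fderiv_zero (hf : f.SmoothOn U) :
    DifferentiableAt ℝ (fun q => (Z q).taylorTerm 0 f) p ∧
    ∀ v, fderiv ℝ (fun q => (Z q).taylorTerm 0 f) p v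
      = (∑ m, fderiv ℝ (fun q => (Z q).body m) p v • (Z p).taylorTerm 0 (pd (.inl m) f))
        + ∑ μ, fderiv ℝ (fun q => (Z q).coord (.inr μ)) p v
          * (Z p).taylorTerm 0 (pd (.inr μ) f) := by
  let b := (Pi.basisFun ℝ (Fin s)).ExteriorAlgebra
  let c : Finset (Fin s) → Gr s →L[ℝ] ℝ := fun I => (b.coord I).toContinuousLinearMap
  have hrep : ∀ g : Gr s, ∀ z : GrPoint d s N, z.subst g = ∑ I, c I g • z.subst (b I) := by
    intro g z
    conv_lhs => rw [← b.sum_repr g]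
    rw [map_sum]
    exact Finset.sum_congr rfl fun I _ => map_smul _ _ _
  have hbody : DifferentiableAt ℝ (fun q => (Z q).body) p :=
    differentiableAt_pi.mpr fun m => differentiableAt_body hZ m
  have hfd := hf.differentiableAt hU hz
  have hcomp : HasFDerivAt (fun q => f (Z q).body)
      ((fderiv ℝ f (Z p).body).comp (fderiv ℝ (fun q => (Z q).body) p)) p :=
    hfd.hasFDerivAt.comp p hbody.hasFDerivAt
  have hcI : ∀ I, HasFDerivAt (fun q => c I (f (Z q).body))
      ((c I).comp ((fderiv ℝ f (Z p).body).comp (fderiv ℝ (fun q => (Z q).body) p))) p :=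
    fun I => (c I).hasFDerivAt.comp p hcomp
  have hs := fun I => subst_fderiv hZ (b I)
  have h : (fun q => (Z q).taylorTerm 0 f)
      = fun q => ∑ I, c I (f (Z q).body) • (Z q).subst (b I) :=
    funext fun q => hrep _ _
  have hD : HasFDerivAt (fun q => (Z q).taylorTerm 0 f) _ p :=
    h ▸ HasFDerivAt.fun_sum fun I (_ : I ∈ Finset.univ) => (hcI I).fun_smul (hs I).1.hasFDerivAt
  refine ⟨hD.differentiableAt, fun v => ?_⟩
  rw [hD.fderiv]
  simp only [sum_apply, add_apply,
    smul_apply, ContinuousLinearMap.smulRight_apply,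
    ContinuousLinearMap.comp_apply, Finset.sum_add_distrib, (hs _).2]
  rw [add_comm]
  congr 1
  · rw [← hrep]
    have hv : fderiv ℝ (fun q => (Z q).body) p v
        = ∑ m, fderiv ℝ (fun q => (Z q).body m) p v • (Pi.single m 1 : Fin d → ℝ) := by
      rw [fderiv_pi fun m => differentiableAt_body hZ m]
      ext m
      simp [Finset.sum_apply, Pi.single_apply]
    rw [hv, map_sum, map_sum]
    refine Finset.sum_congr rfl fun m _ => ?_
    rw [map_smul, map_smul]
    rfl
  · simp only [Finset.smul_sum]
    rw [Finset.sum_comm]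
    refine Finset.sum_congr rfl fun μ _ => ?_
    simp only [← mul_smul_comm, ← Finset.mul_sum]
    congr 1
    rw [taylorTerm_zero, SFun.pd_inr]
    dsimp only
    conv_rhs => rw [← b.sum_repr (f (Z p).body)]
    rw [map_sum, map_sum]
    refine Finset.sum_congr rfl fun I _ => ?_
    rw [map_smul, map_smul]
    rfl

/-- The three sums come from differentiating one of the `k` soul factors, the body at which
derivatives of `f` are taken, and the odd coordinates. For `k = 0` the truncated `k - 1` is harmless
because its coefficient is zero. -/
theorem taylorTerm_fderiv (k : ℕ) (hf : f.SmoothOn U) :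
    DifferentiableAt ℝ (fun q => (Z q).taylorTerm k f) p ∧
    ∀ v, fderiv ℝ (fun q => (Z q).taylorTerm k f) p v
      = (k : ℝ) • (∑ m, fderiv ℝ (fun q => (Z q).soul m) p v
            * (Z p).taylorTerm (k - 1) (pd (.inl m) f))
        + (∑ m, fderiv ℝ (fun q => (Z q).body m) p v • (Z p).taylorTerm k (pd (.inl m) f))
        + ∑ μ, fderiv ℝ (fun q => (Z q).coord (.inr μ)) p v
          * (Z p).taylorTerm k (pd (.inr μ) f) := by
  induction k generalizing f with
  | zero =>
    obtain ⟨h1, h2⟩ := taylorTerm_fderiv_zero hZ hU hz hf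
    exact ⟨h1, fun v => by rw [h2 v, Nat.cast_zero, zero_smul, zero_add]⟩
  | succ k ih =>
    have hT := fun m => ih (hf.pd hU (.inl m))
    have hS := fun m => differentiableAt_soul hZ m
    have h : (fun q => (Z q).taylorTerm (k + 1) f)
        = fun q => ∑ m, (Z q).soul m * (Z q).taylorTerm k (pd (.inl m) f) := rfl
    refine ⟨h ▸ DifferentiableAt.fun_sum fun m _ => (hS m).gr_mul (hT m).1, fun v => ?_⟩
    rw [h, fderiv_fun_sum fun m _ => (hS m).gr_mul (hT m).1, sum_apply]
    have hmul : ∀ m, fderiv ℝ (fun q => (Z q).soul m * (Z q).taylorTerm k (pd (.inl m) f)) p v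
        = fderiv ℝ (fun q => (Z q).soul m) p v * (Z p).taylorTerm k (pd (.inl m) f)
          + (Z p).soul m * fderiv ℝ (fun q => (Z q).taylorTerm k (pd (.inl m) f)) p v := fun m =>
      Gr.fderiv_mul (hS m) (hT m).1 v
    simp only [hmul, (hT _).2, Finset.sum_add_distrib, mul_add]
    have e0 : ∀ j i, ∑ m, (Z p).soul m * (Z p).taylorTerm j (pd i (pd (.inl m) f))
        = (Z p).taylorTerm (j + 1) (pd i f) := fun j i =>
      Finset.sum_congr rfl fun m _ => congrArg _
        (taylorTerm_congr hU hz j fun x hx => (SFun.pd_comm hU hf m i hx).symm)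
    have hcomm : ∀ m, ∀ x y : Gr N, (Z p).soul m * (x * y) = x * ((Z p).soul m * y) := by
      intro m x y
      rw [← mul_assoc, Gr.even_comm ((Z p).soul_mem m), mul_assoc]
    have e1 : ∑ m, (Z p).soul m * (k : ℝ) • ∑ n, fderiv ℝ (fun q => (Z q).soul n) p v
          * (Z p).taylorTerm (k - 1) (pd (.inl n) (pd (.inl m) f))
        = (k : ℝ) • ∑ n, fderiv ℝ (fun q => (Z q).soul n) p v
          * (Z p).taylorTerm k (pd (.inl n) f) := by
      cases k with
      | zero => simp
      | succ k =>
        simp only [mul_smul_comm, ← Finset.smul_sum, Finset.mul_sum, hcomm]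
        rw [Finset.sum_comm]
        simp only [← Finset.mul_sum, Nat.add_sub_cancel, e0]
    have e2 : ∑ m, (Z p).soul m * ∑ n, fderiv ℝ (fun q => (Z q).body n) p v
          • (Z p).taylorTerm k (pd (.inl n) (pd (.inl m) f))
        = ∑ n, fderiv ℝ (fun q => (Z q).body n) p v
          • (Z p).taylorTerm (k + 1) (pd (.inl n) f) := by
      simp only [Finset.mul_sum, mul_smul_comm]
      rw [Finset.sum_comm]
      simp only [← Finset.smul_sum, e0]
    have e3 : ∑ m, (Z p).soul m * ∑ μ, fderiv ℝ (fun q => (Z q).coord (.inr μ)) p v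
          * (Z p).taylorTerm k (pd (.inr μ) (pd (.inl m) f))
        = ∑ μ, fderiv ℝ (fun q => (Z q).coord (.inr μ)) p v
          * (Z p).taylorTerm (k + 1) (pd (.inr μ) f) := by
      simp only [Finset.mul_sum, hcomm]
      rw [Finset.sum_comm]
      simp only [← Finset.mul_sum, e0]
    rw [e1, e2, e3, Nat.add_sub_cancel, ← add_assoc, ← add_assoc]
    congr 2
    push_cast
    rw [add_smul, one_smul, add_comm]

theorem differentiableAt_eval (hf : f.SmoothOn U) :
    DifferentiableAt ℝ (fun q => (Z q).eval f) p :=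
  DifferentiableAt.fun_sum fun k _ => (taylorTerm_fderiv hZ hU hz k hf).1.fun_const_smul _

/-- The chain rule. -/
theorem fderiv_eval (hf : f.SmoothOn U) (v : E) : fderiv ℝ (fun q => (Z q).eval f) p v
    = ∑ i, fderiv ℝ (fun q => (Z q).coord i) p v * (Z p).eval (pd i f) := by
  have hT := fun k => taylorTerm_fderiv hZ hU hz k hf
  have h : (fun q => (Z q).eval f) = fun q => ∑ k ∈ Finset.range (N + 1),
    ((k.factorial : ℝ)⁻¹) • (Z q).taylorTerm k f := rfl
  rw [h, fderiv_fun_sum fun k _ => (hT k).1.fun_const_smul _, sum_apply]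
  have hk : ∀ k : ℕ, fderiv ℝ (fun q => ((k.factorial : ℝ)⁻¹) • (Z q).taylorTerm k f) p v
      = ((k.factorial : ℝ)⁻¹) • fderiv ℝ (fun q => (Z q).taylorTerm k f) p v := fun k => by
    rw [fderiv_fun_const_smul (hT k).1]
    rfl
  simp only [hk, (hT _).2, smul_add, Finset.sum_add_distrib]
  rw [Fintype.sum_sum_type]
  congr 1
  · have e1 : ∀ m, fderiv ℝ (fun q => (Z q).coord (.inl m)) p v
        = fderiv ℝ (fun q => (Z q).soul m) p v
          + algebraMap ℝ (Gr N) (fderiv ℝ (fun q => (Z q).body m) p v) := fun m => by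
      rw [fderiv_soul hZ, sub_add_cancel]
    simp only [e1, add_mul, Finset.sum_add_distrib, ← Algebra.smul_def]
    congr 1
    -- The factor `k / k! = 1 / (k - 1)!` shifts the sum by one, so its terms have orders `0` to `N
    -- - 1`. The missing term of order `N` vanishes by nilpotency.
    · rw [Finset.sum_range_succ', Nat.cast_zero, zero_smul, smul_zero, add_zero]
      have e2 : ∀ k : ℕ, (((k + 1).factorial : ℝ)⁻¹) • ((k + 1 : ℕ) : ℝ)
          • (∑ m, fderiv ℝ (fun q => (Z q).soul m) p v
            * (Z p).taylorTerm (k + 1 - 1) (pd (.inl m) f))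
          = ∑ m, fderiv ℝ (fun q => (Z q).soul m) p v
            * ((k.factorial : ℝ)⁻¹ • (Z p).taylorTerm k (pd (.inl m) f)) := by
        intro k
        rw [smul_smul, Finset.smul_sum, Nat.add_sub_cancel]
        refine Finset.sum_congr rfl fun m _ => ?_
        rw [mul_smul_comm]
        congr 1
        have h1 : (k.factorial : ℝ) ≠ 0 := by positivity
        have h2 : ((k : ℝ) + 1) ≠ 0 := by positivity
        rw [Nat.factorial_succ]
        push_cast
        field_simp
      simp only [e2]
      rw [Finset.sum_comm]
      refine Finset.sum_congr rfl fun m _ => ?_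
      rw [← Finset.mul_sum, eval, Finset.sum_range_succ, mul_add]
      have : fderiv ℝ (fun q => (Z q).soul m) p v
          * ((N.factorial : ℝ)⁻¹ • (Z p).taylorTerm N (pd (.inl m) f)) = 0 := by
        rw [mul_smul_comm, Gr.nil_eq_zero (k := 1 + N) (by omega)
          (Gr.mul_mem_nil (fderiv_soul_mem_nil hZ m v) (taylorTerm_mem_nil N _)), smul_zero]
      rw [this, add_zero]
    · simp only [Finset.smul_sum]
      rw [Finset.sum_comm]
      refine Finset.sum_congr rfl fun m _ => ?_
      rw [eval, Finset.smul_sum]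
      exact Finset.sum_congr rfl fun k _ => smul_comm _ _ _
  · simp only [Finset.smul_sum]
    rw [Finset.sum_comm]
    refine Finset.sum_congr rfl fun μ _ => ?_
    rw [eval, Finset.mul_sum]
    exact Finset.sum_congr rfl fun k _ => (mul_smul_comm _ _ _).symm

end

end GrPoint

end SuperSigma

namespace SuperSigma

variable {d s N : ℕ} {U : Set (Fin d → ℝ)} {W : Set (ℝ × ℝ)}

/-! ### Evaluation of matrices, and the supersymmetry of the generalized metric -/

theorem GrPoint.eval_one (hU : IsOpen U) {z : GrPoint d s N} (hz : z.body ∈ U) :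
    z.eval (1 : SFun d s) = 1 := by
  have h0 : ∀ k, z.taylorTerm k (0 : SFun d s) = 0 := fun k => by
    have := taylorTerm_smul hU hz k 0 (SFun.SmoothOn.zero (d := d) (s := s))
    simpa using this
  have h1 : ∀ m : Fin d, pd (.inl m) (1 : SFun d s) = 0 := fun m => by
    funext x
    change fderiv ℝ (fun _ => (1 : Gr s)) x _ = 0
    simp
  rw [eval, Finset.sum_range_succ']
  simp [taylorTerm_succ, h0, h1, taylorTerm_zero]

/-- `Z ↦ f(Z)` is compatible with matrix multiplication. -/
theorem GrPoint.eval_matrix_mul (hU : IsOpen U) {z : GrPoint d s N} (hz : z.body ∈ U)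
    {X Y : Mat d s (SFun d s)} (hX : ∀ a b, (X a b).SmoothOn U) (hY : ∀ a b, (Y a b).SmoothOn U)
    (a b : Idx d s ⊕ Idx d s) : z.eval ((X * Y) a b) = ∑ c, z.eval (X a c) * z.eval (Y c b) := by
  rw [Matrix.mul_apply, eval_sum hU hz fun c _ => (hX a c).mul (hY c b)]
  exact Finset.sum_congr rfl fun c _ => eval_mul hU hz (hX a c) (hY c b)

theorem SFun.SmoothOn.matrix_mul {X Y : Mat d s (SFun d s)} (hX : ∀ a b, (X a b).SmoothOn U)
    (hY : ∀ a b, (Y a b).SmoothOn U) (a b : Idx d s ⊕ Idx d s) : ((X * Y) a b).SmoothOn U := by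
  rw [Matrix.mul_apply]
  exact .sum fun c _ => (hX a c).mul (hY c b)

theorem SFun.SmoothOn.matrix_one (a b : Idx d s ⊕ Idx d s) :
    ((1 : Mat d s (SFun d s)) a b).SmoothOn U := by
  rw [Matrix.one_apply]
  split_ifs
  · exact contDiffOn_const
  · exact .zero

/-- The exponent of the sign that relates the components of the column `(X^j (-)^j ; G_j)` to those
of the row `(X^j  G_j)`. -/
def low : Idx d s ⊕ Idx d s → ZMod 2 := Sum.elim par (fun _ => 0)

/-- The exponent of the sign in the supertransposition of bilinear forms on `TM ⊕ T^*M`. -/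
def stExp (a b : Idx d s ⊕ Idx d s) : ZMod 2 :=
  par₂ a + par₂ b + par₂ a * par₂ b + low a + low b

theorem stExp_comm (a b : Idx d s ⊕ Idx d s) : stExp a b = stExp b a := by
  unfold stExp
  ring

namespace BlockTensor

variable {A : BlockTensor d s}

/-- The exponent `stExp` merges the block symmetries into one rule, so that later sign computations
need no case distinction. The lower left block is the inverse of the mixed symmetry. -/
theorem IsGeneralizedMetric.symm (hA : A.IsGeneralizedMetric U) (a b : Idx d s ⊕ Idx d s) :
    ∀ x ∈ U, A.toMatrix a b x = sg (stExp a b) • A.toMatrix b a x := by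
  have h1 : ∀ a b : ZMod 2, a + b + a * b + a + b = a * b := by decide
  have h2 : ∀ a b : ZMod 2, a + b + a * b + a + 0 = a * b + b := by decide
  have h3 : ∀ a b : ZMod 2, a + b + a * b + 0 + b = b * a + a := by decide
  have h4 : ∀ a b : ZMod 2, a + b + a * b + 0 + 0 = a * b + a + b := by decide
  intro x hx
  rcases a with i | i <;> rcases b with j | j
  · exact (hA.symm_ll i j x hx).trans (by rw [← h1]; rfl)
  · exact (hA.symm_lu i j x hx).trans (by rw [← h2]; rfl)
  · have := hA.symm_lu j i x hx
    change A.ul i j x = _ • A.lu j i x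
    rw [this, show stExp (d := d) (s := s) (.inr i) (.inl j) = par j * par i + par i from h3 _ _,
      sg_smul_self]
  · exact (hA.symm_uu i j x hx).trans (by rw [← h4]; rfl)

theorem op_eq : A.op = Matrix.fromBlocks A.lu A.ll A.uu A.ul := by
  simp [op, toMatrix, Matrix.fromBlocks_multiply]

theorem op_apply (a b : Idx d s ⊕ Idx d s) : A.op a b = A.toMatrix a b.swap := by
  rw [op_eq]
  rcases a with i | i <;> rcases b with j | j <;> rfl

end BlockTensor

/-! ### The equations of motion -/

namespace Fields

variable (φ : Fields d s N U W) {A : BlockTensor d s} {p : ℝ × ℝ}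

theorem differentiableAt_Z (hW : IsOpen W) (hp : p ∈ W) (i : Idx d s) :
    DifferentiableAt ℝ (fun q => (φ.Z q).coord i) p :=
  ((φ.smooth_Z i).contDiffAt (hW.mem_nhds hp)).differentiableAt (by simp)

theorem differentiableAt_P (hW : IsOpen W) (hp : p ∈ W) (i : Idx d s) :
    DifferentiableAt ℝ (fun q => (φ.P q).coord i) p :=
  ((φ.smooth_P i).contDiffAt (hW.mem_nhds hp)).differentiableAt (by simp)

theorem differentiableAt_dσZ (hW : IsOpen W) (hp : p ∈ W) (i : Idx d s) :
    DifferentiableAt ℝ (φ.dσZ i) p := by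
  have hc := (φ.smooth_Z i).contDiffAt (hW.mem_nhds hp)
  have hd := (hc.fderiv_right (m := 1) (by norm_cast)).differentiableAt (by simp)
  exact hd.clm_apply (differentiableAt_const _)

theorem dt_dσZ (hW : IsOpen W) (hp : p ∈ W) (i : Idx d s) :
    dt (φ.dσZ i) p = dσ (φ.dtZ i) p := by
  have hc := (φ.smooth_Z i).contDiffAt (hW.mem_nhds hp)
  have hd := (hc.fderiv_right (m := 1) (by norm_cast)).differentiableAt (by simp)
  have key : ∀ v w : ℝ × ℝ, fderiv ℝ (fun q => fderiv ℝ (fun q => (φ.Z q).coord i) q v) p w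
      = fderiv ℝ (fderiv ℝ fun q => (φ.Z q).coord i) p w v := by
    intro v w
    rw [fderiv_clm_apply hd (differentiableAt_const _)]
    simp
  change fderiv ℝ (fun q => fderiv ℝ (fun q => (φ.Z q).coord i) q _) p _
    = fderiv ℝ (fun q => fderiv ℝ (fun q => (φ.Z q).coord i) q _) p _
  rw [key, key]
  exact (hc.isSymmSndFDerivAt (by simp; norm_cast)).eq _ _

theorem differentiableAt_left (hW : IsOpen W) (hp : p ∈ W) (a : Idx d s ⊕ Idx d s) :
    DifferentiableAt ℝ (fun q => φ.left q a) p := by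
  rcases a with i | i
  · exact φ.differentiableAt_dσZ hW hp i
  · exact φ.differentiableAt_P hW hp i

theorem left_mem (hW : IsOpen W) (hp : p ∈ W) (a : Idx d s ⊕ Idx d s) :
    φ.left p a ∈ Gr.parity N (par₂ a) := by
  rcases a with i | i
  · exact GrPoint.coord_deriv_mem (φ.differentiableAt_Z hW hp) i _
  · exact (φ.P p).mem i

theorem right_eq (a : Idx d s ⊕ Idx d s) : φ.right p a = sg (low a) • φ.left p a := by
  rcases a with i | i
  · rfl
  · change φ.right p (.inr i) = sg 0 • φ.left p (.inr i)
    rw [sg_zero, one_smul]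
    rfl

theorem right'_eq (a : Idx d s ⊕ Idx d s) : φ.right' p a = φ.right p a.swap := by
  rcases a with i | i <;> rfl

/-- The row `(∂_σ Z^i  P_i) A`. -/
noncomputable def flux (A : BlockTensor d s) (p : ℝ × ℝ) : Idx d s ⊕ Idx d s → Gr N :=
  φ.left p ᵥ* φ.along A.toMatrix p

variable (hU : IsOpen U) (hW : IsOpen W) (hA : A.IsGeneralizedMetric U) (hp : p ∈ W)
include hU hW hA hp

omit hW in
theorem along_mem (a b : Idx d s ⊕ Idx d s) :
    φ.along A.toMatrix p a b ∈ Gr.parity N (par₂ a + par₂ b) :=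
  GrPoint.eval_mem hU (φ.body_mem p hp) (hA.smooth a b) (hA.parity a b)

omit hW in
theorem along_symm (a b : Idx d s ⊕ Idx d s) :
    φ.along A.toMatrix p a b = sg (stExp a b) • φ.along A.toMatrix p b a := by
  change (φ.Z p).eval _ = sg _ • (φ.Z p).eval _
  rw [← GrPoint.eval_smul hU (φ.body_mem p hp) _ (hA.smooth b a)]
  exact GrPoint.eval_congr hU (φ.body_mem p hp) (hA.symm a b)

/-- Reordering each summand by graded commutativity and transposing `A` by supersymmetry gives a
sign in which the summation index cancels. This is why the two halves of the equations of motion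
agree. -/
theorem mulVec_right (a : Idx d s ⊕ Idx d s) :
    (φ.along A.toMatrix p *ᵥ φ.right p) a = sg (par₂ a + low a) • φ.flux A p a := by
  rw [flux, Matrix.mulVec, Matrix.vecMul, dotProduct, dotProduct, Finset.smul_sum]
  refine Finset.sum_congr rfl fun b _ => ?_
  have h : ∀ a b r t : ZMod 2, t + (a + b) * b + (a + b + a * b + r + t) = a + r := by decide
  rw [right_eq, mul_smul_comm,
    Gr.comm (φ.along_mem hU hA hp a b) (φ.left_mem hW hp b),
    φ.along_symm hU hA hp a b, mul_smul_comm, sg_smul_smul, sg_smul_smul]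
  exact congrArg (fun c => sg c • _) (h _ _ _ _)

theorem differentiableAt_flux (a : Idx d s ⊕ Idx d s) :
    DifferentiableAt ℝ (fun q => φ.flux A q a) p :=
  DifferentiableAt.fun_sum (u := Finset.univ) (A := fun b q => φ.left q b * (φ.Z q).eval (A.toMatrix b a)) fun b _ => (φ.differentiableAt_left hW hp b).gr_mul
    (GrPoint.differentiableAt_eval (φ.differentiableAt_Z hW hp) hU (φ.body_mem p hp)
      (hA.smooth b a))

/-- The derivative `(∂_σ Z^k  P_k) (-)^{ki} ∂_i A (∂_σ Z^j (-)^j ; P_j)` of the Hamiltonian. -/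
noncomputable def force (φ : Fields d s N U W) (A : BlockTensor d s) (i : Idx d s) (p : ℝ × ℝ) :
    Gr N :=
  ∑ a, ∑ b, sg (par₂ a * par i) •
    (φ.left p a * (φ.Z p).eval (pd i (A.toMatrix a b)) * φ.right p b)

theorem eom_Z_rhs (i : Idx d s) :
    (1 / 2 : ℝ) • (sg (par i) • (φ.along A.toMatrix p *ᵥ φ.right p) (.inr i)
      + (φ.left p ᵥ* φ.along A.toMatrix p) (.inr i)) = φ.flux A p (.inr i) := by
  rw [φ.mulVec_right hU hW hA hp]
  change (1 / 2 : ℝ) • (sg (par i) • sg (par i + 0) • φ.flux A p (.inr i) + φ.flux A p (.inr i)) = _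
  rw [add_zero, sg_smul_self, ← two_smul ℝ, smul_smul]
  norm_num

theorem eom_P_rhs (i : Idx d s) :
    -((1 / 2 : ℝ) • ((∑ a, ∑ b, sg (par₂ a * par i) •
          (φ.left p a * (φ.Z p).eval (pd i (A.toMatrix a b)) * φ.right p b))
      - dσ (fun q => (φ.along A.toMatrix q *ᵥ φ.right q) (.inl i)) p
      - dσ (fun q => (φ.left q ᵥ* φ.along A.toMatrix q) (.inl i)) p))
    = dσ (fun q => φ.flux A q (.inl i)) p - (1 / 2 : ℝ) • φ.force A i p := by
  have h : dσ (fun q => (φ.along A.toMatrix q *ᵥ φ.right q) (.inl i)) p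
      = dσ (fun q => φ.flux A q (.inl i)) p := by
    have h2 : ∀ a : ZMod 2, a + a = 0 := by decide
    -- The column and row expressions agree on all of the open set `W`, hence near `p`, so they have
    -- the same derivative.
    refine congrArg (fun L : ℝ × ℝ →L[ℝ] Gr N => L (0, 1)) (Filter.EventuallyEq.fderiv_eq ?_)
    filter_upwards [hW.mem_nhds hp] with q hq
    rw [φ.mulVec_right hU hW hA hq]
    change sg (par i + par i) • _ = _
    rw [h2, sg_zero, one_smul]
  rw [h]
  change -((1 / 2 : ℝ) • (φ.force A i p - _ - dσ (fun q => φ.flux A q (.inl i)) p)) = _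
  module

omit hp in
-- Hamilton's equations in terms of the flux alone; this is the form in which solutions are used and
-- constructed.
theorem isSolution_iff : φ.IsSolution A ↔
    (∀ p ∈ W, ∀ i, φ.dtZ i p = φ.flux A p (.inr i)) ∧
    ∀ p ∈ W, ∀ i, φ.dtP i p = dσ (fun q => φ.flux A q (.inl i)) p
      - (1 / 2 : ℝ) • φ.force A i p := by
  constructor
  · intro h
    refine ⟨fun p hp i => ?_, fun p hp i => ?_⟩
    · rw [h.eom_Z p hp i, φ.eom_Z_rhs hU hW hA hp]
    · rw [h.eom_P p hp i, φ.eom_P_rhs hU hW hA hp]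
  · intro h
    refine ⟨fun p hp i => ?_, fun p hp i => ?_⟩
    · rw [h.1 p hp i, φ.eom_Z_rhs hU hW hA hp]
    · rw [h.2 p hp i, φ.eom_P_rhs hU hW hA hp]

end Fields

/-! ### The current -/

section Sections

variable {e : ZMod 2} {V F : Idx d s → SFun d s}

theorem IsSection.smooth (h : IsSection U e V F) (a : Idx d s ⊕ Idx d s) :
    (row V F a).SmoothOn U := by
  rcases a with i | i
  · exact h.smooth_V i
  · exact h.smooth_F i

end Sections

namespace Fields

variable (φ : Fields d s N U W) {A : BlockTensor d s} {p : ℝ × ℝ} {e : ZMod 2}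
  {V F : Idx d s → SFun d s}

theorem jVF_eq (p : ℝ × ℝ) : φ.jVF V F p = ∑ a, (φ.Z p).eval (row V F a) * φ.right' p a := by
  rw [jVF, Finset.sum_add_distrib]
  exact (Fintype.sum_sum_type fun a => (φ.Z p).eval (row V F a) * φ.right' p a).symm

/-- The difference `j_z - j_z̄`. -/
noncomputable def jDiff (φ : Fields d s N U W) (A : BlockTensor d s) (V F : Idx d s → SFun d s)
    (p : ℝ × ℝ) : Gr N :=
  ∑ a, (φ.Z p).eval (row V F a) * (φ.along A.toMatrix p *ᵥ φ.right p) a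

theorem op_smooth (hA : A.IsGeneralizedMetric U) (a b : Idx d s ⊕ Idx d s) :
    (A.op a b).SmoothOn U :=
  A.op_apply a b ▸ hA.smooth a b.swap

variable (hU : IsOpen U) (hA : A.IsGeneralizedMetric U) (hp : p ∈ W)
include hU hA hp

theorem current_eq (c : ℝ) :
    φ.current A c V F p = (1 / 2 : ℝ) • (φ.jVF V F p + c • φ.jDiff A V F p) := by
  have hz := φ.body_mem p hp
  have h1 : ∀ a b, φ.along (projector A c) p a b
      = (1 / 2 : ℝ) • ((1 : Mat d s (Gr N)) a b + c • (φ.Z p).eval (A.op a b)) := by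
    intro a b
    have h2 : ((1 : Mat d s (SFun d s)) a b).SmoothOn U := .matrix_one a b
    change (φ.Z p).eval ((1 / 2 : ℝ) • ((1 : Mat d s (SFun d s)) a b + c • A.op a b)) = _
    rw [GrPoint.eval_smul hU hz _ (h2.add ((op_smooth hA a b).smul c)),
      GrPoint.eval_add hU hz h2 ((op_smooth hA a b).smul c),
      GrPoint.eval_smul hU hz _ (op_smooth hA a b), Matrix.one_apply, Matrix.one_apply]
    split_ifs
    · rw [GrPoint.eval_one hU hz]
    · rw [GrPoint.eval_zero hU hz]
  have h3 : φ.along (projector A c) p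
      = (1 / 2 : ℝ) • (1 + c • φ.along A.op p) := by
    ext a b
    exact h1 a b
  -- The off-diagonal matrix inside `A.op` undoes the exchange of the two halves of the column.
  have h4 : φ.along A.op p *ᵥ φ.right' p = φ.along A.toMatrix p *ᵥ φ.right p := by
    funext a
    rw [Matrix.mulVec, Matrix.mulVec, dotProduct, dotProduct]
    refine Fintype.sum_equiv (Equiv.sumComm _ _) _ _ fun b => ?_
    rw [right'_eq]
    change (φ.Z p).eval (A.op a b) * _ = (φ.Z p).eval (A.toMatrix a b.swap) * _
    rw [A.op_apply]
    rfl
  rw [current, h3, ← Matrix.dotProduct_mulVec, Matrix.smul_mulVec, Matrix.add_mulVec,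
    Matrix.one_mulVec, Matrix.smul_mulVec, h4, dotProduct_smul, dotProduct_add, dotProduct_smul,
    jVF_eq]
  rfl

/-- Since evaluation is multiplicative, the projector can act on the section before anything is
evaluated. This relates the vanishing of the current to an identity on the superdomain. -/
theorem current_eq_row_projector (hVF : ∀ a, (row V F a).SmoothOn U) (c : ℝ) :
    φ.current A c V F p
      = ∑ b, (φ.Z p).eval ((row V F ᵥ* projector A c) b) * φ.right' p b := by
  have hz := φ.body_mem p hp
  have hP : ∀ a b, (projector A c a b).SmoothOn U := by
    intro a b
    have h2 : ((1 : Mat d s (SFun d s)) a b).SmoothOn U := .matrix_one a b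
    exact (h2.add ((op_smooth hA a b).smul c)).smul _
  rw [current, dotProduct]
  refine Finset.sum_congr rfl fun b _ => congrArg (fun t => t * φ.right' p b) ?_
  change ∑ a, (φ.Z p).eval (row V F a) * (φ.Z p).eval (projector A c a b)
    = (φ.Z p).eval (∑ a, row V F a * projector A c a b)
  rw [GrPoint.eval_sum hU hz fun a _ => (hVF a).mul (hP a b)]
  exact Finset.sum_congr rfl fun a _ => (GrPoint.eval_mul hU hz (hVF a) (hP a b)).symm

end Fields

end SuperSigma

namespace SuperSigma

variable {d s N : ℕ} {U : Set (Fin d → ℝ)} {W : Set (ℝ × ℝ)}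

/-! ### The deformation of the generalized metric -/

/-- The matrix `(∂_i V^k, 0; 0, 0)`. -/
noncomputable def jacL (V : Idx d s → SFun d s) : Mat d s (SFun d s) :=
  Matrix.fromBlocks (Matrix.of fun i k => pd i (V k)) 0 0 0

/-- The matrix `(0, 0; 0, ∂_k V^j)`. -/
noncomputable def jacR (V : Idx d s → SFun d s) : Mat d s (SFun d s) :=
  Matrix.fromBlocks 0 0 0 (Matrix.of fun k j => pd k (V j))

/-- The bilinear form whose supersymmetrization is the Lie derivative of `A` along `(V, F)`. -/
noncomputable def preLie (e : ZMod 2) (A : BlockTensor d s) (V F : Idx d s → SFun d s) :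
    Mat d s (SFun d s) :=
  Matrix.of fun a b => vec V (A.toMatrix a b) + (2 : ℝ) • (sg (e * par₂ a) •
    ((jacL V * A.toMatrix) a b - (A.toMatrix * jacR V) a b) + (dFMat e F * A.toMatrix) a b)

/-- Twice the Lie derivative of the bilinear form `A` along `(V, F)`. -/
noncomputable def lieForm (e : ZMod 2) (A : BlockTensor d s) (V F : Idx d s → SFun d s) :
    Mat d s (SFun d s) :=
  Matrix.of fun a b => preLie e A V F a b + sg (stExp a b) • preLie e A V F b a

section Parity

variable {A : BlockTensor d s} {e : ZMod 2} {V F : Idx d s → SFun d s}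

theorem SFun.HasParity.mul {a b : ZMod 2} {f g : SFun d s} (hf : f.HasParity U a)
    (hg : g.HasParity U b) : (f * g).HasParity U (a + b) :=
  fun x hx => Gr.mul_mem (hf x hx) (hg x hx)

theorem SFun.HasParity.add {a : ZMod 2} {f g : SFun d s} (hf : f.HasParity U a)
    (hg : g.HasParity U a) : (f + g).HasParity U a :=
  fun x hx => Submodule.add_mem _ (hf x hx) (hg x hx)

theorem SFun.HasParity.sub {a : ZMod 2} {f g : SFun d s} (hf : f.HasParity U a)
    (hg : g.HasParity U a) : (f - g).HasParity U a :=
  fun x hx => Submodule.sub_mem _ (hf x hx) (hg x hx)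

theorem SFun.HasParity.smul (r : ℝ) {a : ZMod 2} {f : SFun d s} (hf : f.HasParity U a) :
    (r • f).HasParity U a :=
  fun x hx => Submodule.smul_mem _ _ (hf x hx)

theorem SFun.HasParity.zero {a : ZMod 2} : (0 : SFun d s).HasParity U a :=
  fun _ _ => Submodule.zero_mem _

theorem SFun.HasParity.congr {a b : ZMod 2} {f : SFun d s} (hf : f.HasParity U a) (h : a = b) :
    f.HasParity U b := h ▸ hf

theorem SFun.HasParity.sum {ι : Type*} {t : Finset ι} {f : ι → SFun d s} {a : ZMod 2}
    (hf : ∀ i ∈ t, (f i).HasParity U a) : (∑ i ∈ t, f i).HasParity U a := by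
  intro x hx
  rw [Finset.sum_apply]
  exact Submodule.sum_mem _ fun i hi => hf i hi x hx

variable (hU : IsOpen U) (hA : A.IsGeneralizedMetric U) (h : IsSection U e V F)
include hU h

theorem dF_smooth (i j : Idx d s) : (dF e F i j).SmoothOn U :=
  (((h.smooth_F j).pd hU i).smul _).sub (((h.smooth_F i).pd hU j).smul _)

theorem dF_parity (i j : Idx d s) : (dF e F i j).HasParity U (par i + par j + e) :=
  ((((h.parity_F j).pd hU (h.smooth_F j) i).smul _).sub
    ((((h.parity_F i).pd hU (h.smooth_F i) j).congr (by ring)).smul _)).congr (by ring)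

theorem jacL_smooth (a b : Idx d s ⊕ Idx d s) : (jacL V a b).SmoothOn U := by
  rcases a with i | i <;> rcases b with j | j
  · exact (h.smooth_V j).pd hU i
  all_goals exact .zero

theorem jacR_smooth (a b : Idx d s ⊕ Idx d s) : (jacR V a b).SmoothOn U := by
  rcases a with i | i <;> rcases b with j | j
  on_goal 4 => exact (h.smooth_V j).pd hU i
  all_goals exact .zero

theorem dFMat_smooth (a b : Idx d s ⊕ Idx d s) : (dFMat e F a b).SmoothOn U := by
  rcases a with i | i <;> rcases b with j | j
  on_goal 2 => exact dF_smooth hU h i j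
  all_goals exact .zero

theorem jacL_parity (a b : Idx d s ⊕ Idx d s) :
    (jacL V a b).HasParity U (par₂ a + par₂ b + e) := by
  rcases a with i | i <;> rcases b with j | j
  · exact ((h.parity_V j).pd hU (h.smooth_V j) i).congr (by simp only [par₂, Sum.elim_inl]; ring)
  all_goals exact .zero

theorem jacR_parity (a b : Idx d s ⊕ Idx d s) :
    (jacR V a b).HasParity U (par₂ a + par₂ b + e) := by
  rcases a with i | i <;> rcases b with j | j
  on_goal 4 =>
    exact ((h.parity_V j).pd hU (h.smooth_V j) i).congr (by simp only [par₂, Sum.elim_inr]; ring)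
  all_goals exact .zero

theorem dFMat_parity (a b : Idx d s ⊕ Idx d s) :
    (dFMat e F a b).HasParity U (par₂ a + par₂ b + e) := by
  rcases a with i | i <;> rcases b with j | j
  on_goal 2 => exact dF_parity hU h i j
  all_goals exact .zero

theorem vec_smooth {f : SFun d s} (hf : f.SmoothOn U) : (vec V f).SmoothOn U :=
  .sum fun k _ => (h.smooth_V k).mul (hf.pd hU k)

theorem vec_parity {f : SFun d s} (hf : f.SmoothOn U) {a : ZMod 2} (hp : f.HasParity U a) :
    (vec V f).HasParity U (a + e) := by
  refine .sum fun k _ => ((h.parity_V k).mul (hp.pd hU hf k)).congr ?_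
  have h2 : ∀ a : ZMod 2, a + a = 0 := by decide
  linear_combination h2 (par k)

include hA

theorem preLie_smooth (a b : Idx d s ⊕ Idx d s) : (preLie e A V F a b).SmoothOn U :=
  (vec_smooth hU h (hA.smooth a b)).add ((((SFun.SmoothOn.matrix_mul (jacL_smooth hU h) hA.smooth a b).sub
    (.matrix_mul hA.smooth (jacR_smooth hU h) a b)).smul _ |>.add
    (.matrix_mul (dFMat_smooth hU h) hA.smooth a b)).smul _)

theorem preLie_parity (a b : Idx d s ⊕ Idx d s) :
    (preLie e A V F a b).HasParity U (par₂ a + par₂ b + e) := by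
  have key : ∀ {X Y : Mat d s (SFun d s)} {f g : ZMod 2},
      (∀ a b, (X a b).HasParity U (par₂ a + par₂ b + f)) →
      (∀ a b, (Y a b).HasParity U (par₂ a + par₂ b + g)) → f + g = e →
      ((X * Y) a b).HasParity U (par₂ a + par₂ b + e) := by
    intro X Y f g hX hY hfg
    rw [Matrix.mul_apply]
    refine .sum fun c _ => ((hX a c).mul (hY c b)).congr ?_
    have h2 : ∀ a : ZMod 2, a + a = 0 := by decide
    rw [← hfg]
    linear_combination h2 (par₂ c)
  have hA0 : ∀ a b, (A.toMatrix a b).HasParity U (par₂ a + par₂ b + 0) := fun a b =>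
    (hA.parity a b).congr (add_zero _).symm
  exact (vec_parity hU h (hA.smooth a b) (hA.parity a b)).add
    ((((key (jacL_parity hU h) hA0 (add_zero e)).sub (key hA0 (jacR_parity hU h) (zero_add e))).smul
      _ |>.add (key (dFMat_parity hU h) hA0 (add_zero e))).smul _)

theorem lieForm_smooth (a b : Idx d s ⊕ Idx d s) : (lieForm e A V F a b).SmoothOn U :=
  (preLie_smooth hU hA h a b).add ((preLie_smooth hU hA h b a).smul _)

theorem lieForm_parity (a b : Idx d s ⊕ Idx d s) :
    (lieForm e A V F a b).HasParity U (par₂ a + par₂ b + e) :=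
  (preLie_parity hU hA h a b).add (((preLie_parity hU hA h b a).congr (by ring)).smul _)

omit hU hA h in
theorem lieForm_symm (a b : Idx d s ⊕ Idx d s) :
    lieForm e A V F a b = sg (stExp a b) • lieForm e A V F b a := by
  change preLie e A V F a b + sg (stExp a b) • preLie e A V F b a
    = sg (stExp a b) • (preLie e A V F b a + sg (stExp b a) • preLie e A V F a b)
  rw [smul_add, stExp_comm b a, sg_smul_self, add_comm]

end Parity

/-- The value `l^a (-)^{ea} X_{ab} r^b` of a bilinear form of parity `e` on the rows `l`, `r`, the
second of which is turned into a column. -/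
noncomputable def formVal (e : ZMod 2) (X : Mat d s (Gr N)) (l r : Idx d s ⊕ Idx d s → Gr N) :
    Gr N :=
  ∑ a, ∑ b, sg (e * par₂ a) • (l a * X a b * (sg (low b) • r b))

/-- Reversing three homogeneous factors produces a sign that depends on `e`; the prefactors
`(-)^{ea}` and `(-)^{eb}` absorb this dependence. The supertransposition sign is therefore the same
for even and odd forms. -/
theorem formVal_swap {e : ZMod 2} {X : Mat d s (Gr N)} {l r : Idx d s ⊕ Idx d s → Gr N}
    (hX : ∀ a b, X a b ∈ Gr.parity N (par₂ a + par₂ b + e)) (hl : ∀ a, l a ∈ Gr.parity N (par₂ a))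
    (hr : ∀ a, r a ∈ Gr.parity N (par₂ a)) :
    formVal e X l r = formVal e (Matrix.of fun a b => sg (stExp a b) • X b a) r l := by
  rw [formVal, Finset.sum_comm]
  refine Finset.sum_congr rfl fun b _ => Finset.sum_congr rfl fun a _ => ?_
  have h : ∀ a b e r t : ZMod 2, e * a + (t + (a * (a + b + e) + (a + b + e + a) * b))
      = e * b + (r + (b + a + b * a + t + r)) := by decide
  rw [Gr.comm (hl a) (hX a b), smul_mul_assoc, mul_smul_comm,
    Gr.comm (Gr.mul_mem (hX a b) (hl a)) (hr b), Matrix.of_apply]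
  simp only [sg_smul_smul, mul_smul_comm, smul_mul_assoc, mul_assoc]
  have h' := h (par₂ a) (par₂ b) e (low a) (low b)
  rw [stExp, ← h']
  congr 2
  ring

end SuperSigma

namespace SuperSigma

variable {d s N : ℕ} {U : Set (Fin d → ℝ)} {W : Set (ℝ × ℝ)}

namespace Fields

/-! ### The divergence of the current on solutions -/

variable (φ : Fields d s N U W) {A : BlockTensor d s} {p : ℝ × ℝ} {e : ZMod 2}
  {V F : Idx d s → SFun d s}

/-- `V^i G_i + F_i (-)^i X^i` for a row `(X^i  G_i)` of functions on the worldsheet. -/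
noncomputable def pairing (φ : Fields d s N U W) (V F : Idx d s → SFun d s)
    (u : ℝ × ℝ → Idx d s ⊕ Idx d s → Gr N) (p : ℝ × ℝ) : Gr N :=
  ∑ i, ((φ.Z p).eval (V i) * u p (.inr i) + (φ.Z p).eval (F i) * (sg (par i) • u p (.inl i)))

theorem differentiableAt_pairing (hU : IsOpen U) (hW : IsOpen W) (hp : p ∈ W)
    (hVF : IsSection U e V F) {u : ℝ × ℝ → Idx d s ⊕ Idx d s → Gr N}
    (hu : ∀ a, DifferentiableAt ℝ (fun q => u q a) p) :
    DifferentiableAt ℝ (φ.pairing V F u) p := by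
  have hE := fun (f : SFun d s) (hf : f.SmoothOn U) =>
    GrPoint.differentiableAt_eval (φ.differentiableAt_Z hW hp) hU (φ.body_mem p hp) hf
  exact DifferentiableAt.fun_sum (u := Finset.univ) (A := fun i q =>
    (φ.Z q).eval (V i) * u q (.inr i) + (φ.Z q).eval (F i) * (sg (par i) • u q (.inl i)))
    fun i _ => ((hE _ (hVF.smooth_V i)).gr_mul (hu _)).fun_add
      ((hE _ (hVF.smooth_F i)).gr_mul ((hu _).fun_const_smul _))

theorem fderiv_pairing (hU : IsOpen U) (hW : IsOpen W) (hp : p ∈ W)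
    (hVF : IsSection U e V F) {u : ℝ × ℝ → Idx d s ⊕ Idx d s → Gr N}
    (hu : ∀ a, DifferentiableAt ℝ (fun q => u q a) p) (v : ℝ × ℝ) :
    fderiv ℝ (φ.pairing V F u) p v
      = ∑ i, ∑ k, (fderiv ℝ (fun q => (φ.Z q).coord k) p v * (φ.Z p).eval (pd k (V i))
            * u p (.inr i)
          + fderiv ℝ (fun q => (φ.Z q).coord k) p v * (φ.Z p).eval (pd k (F i))
            * (sg (par i) • u p (.inl i)))
        + ∑ i, ((φ.Z p).eval (V i) * fderiv ℝ (fun q => u q (.inr i)) p v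
          + (φ.Z p).eval (F i) * (sg (par i) • fderiv ℝ (fun q => u q (.inl i)) p v)) := by
  have hE := fun (f : SFun d s) (hf : f.SmoothOn U) =>
    GrPoint.differentiableAt_eval (φ.differentiableAt_Z hW hp) hU (φ.body_mem p hp) hf
  have hV := fun i => (hE _ (hVF.smooth_V i)).gr_mul (hu (.inr i))
  have hF := fun i => (hE _ (hVF.smooth_F i)).gr_mul ((hu (.inl i)).fun_const_smul (sg (par i)))
  have h0 : φ.pairing V F u = fun q => ∑ i, ((φ.Z q).eval (V i) * u q (.inr i)
    + (φ.Z q).eval (F i) * (sg (par i) • u q (.inl i))) := rfl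
  rw [h0, fderiv_fun_sum fun i _ => (hV i).fun_add (hF i), sum_apply, ← Finset.sum_add_distrib]
  refine Finset.sum_congr rfl fun i _ => ?_
  rw [fderiv_fun_add (hV i) (hF i), add_apply, Gr.fderiv_mul (hE _ (hVF.smooth_V i)) (hu (.inr i)),
    Gr.fderiv_mul (hE _ (hVF.smooth_F i)) ((hu (.inl i)).fun_const_smul (sg (par i))),
    GrPoint.fderiv_eval (φ.differentiableAt_Z hW hp) hU (φ.body_mem p hp) (hVF.smooth_V i),
    GrPoint.fderiv_eval (φ.differentiableAt_Z hW hp) hU (φ.body_mem p hp) (hVF.smooth_F i),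
    fderiv_fun_const_smul (hu (.inl i)), Finset.sum_add_distrib, Finset.sum_mul, Finset.sum_mul]
  simp only [smul_apply]
  abel

variable (hU : IsOpen U) (hW : IsOpen W) (hA : A.IsGeneralizedMetric U) (hp : p ∈ W)
include hU hW hA hp

theorem jDiff_eq_pairing :
    φ.jDiff A V F p = φ.pairing V F (fun q a => φ.flux A q a.swap) p := by
  have h2 : ∀ a : ZMod 2, a + a = 0 := by decide
  have h3 := φ.mulVec_right hU hW hA hp
  rw [jDiff, pairing, Finset.sum_add_distrib]
  refine (Fintype.sum_sum_type fun a => (φ.Z p).eval (row V F a) *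
    (φ.along A.toMatrix p *ᵥ φ.right p) a).trans (congrArg₂ (· + ·)
    (Finset.sum_congr rfl fun i _ => ?_) (Finset.sum_congr rfl fun i _ => ?_))
  · rw [h3]
    change _ * sg (par i + par i) • _ = _
    rw [h2, sg_zero, one_smul]
    rfl
  · rw [h3]
    change _ * sg (par i + 0) • _ = _
    rw [add_zero]
    rfl

theorem flux_mem (a : Idx d s ⊕ Idx d s) : φ.flux A p a ∈ Gr.parity N (par₂ a) := by
  rw [flux, Matrix.vecMul, dotProduct]
  refine Submodule.sum_mem _ fun b _ => ?_
  have h : ∀ a b : ZMod 2, a + (a + b) = b := by decide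
  exact h (par₂ b) (par₂ a) ▸ Gr.mul_mem (φ.left_mem hW hp b) (φ.along_mem hU hA hp b a)

/-- The components are `½ (x ± y)` for the two pairings `x`, `y`, and `(∂_t - ∂_σ) ½ (x + y) + (∂_t
+ ∂_σ) ½ (x - y) = ∂_t x - ∂_σ y`. -/
theorem delbar_add_del (hVF : IsSection U e V F) :
    delbar (φ.jz A V F) p + del (φ.jzbar A V F) p
      = dt (φ.pairing V F φ.left) p - dσ (φ.pairing V F fun q a => φ.flux A q a.swap) p := by
  have h1 := φ.differentiableAt_pairing hU hW hp hVF (φ.differentiableAt_left hW hp)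
  have h2 := φ.differentiableAt_pairing hU hW hp hVF (u := fun q a => φ.flux A q a.swap)
    fun a => φ.differentiableAt_flux hU hW hA hp a.swap
  have h3 : ∀ c v, fderiv ℝ (φ.current A c V F) p v
      = (1 / 2 : ℝ) • (fderiv ℝ (φ.pairing V F φ.left) p v
        + c • fderiv ℝ (φ.pairing V F fun q a => φ.flux A q a.swap) p v) := by
    intro c v
    have h4 : φ.current A c V F =ᶠ[nhds p] fun q => (1 / 2 : ℝ) • (φ.pairing V F φ.left q
        + c • φ.pairing V F (fun q a => φ.flux A q a.swap) q) := by
      filter_upwards [hW.mem_nhds hp] with q hq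
      rw [φ.current_eq hU hA hq, φ.jDiff_eq_pairing hU hW hA hq]
      rfl
    rw [h4.fderiv_eq, fderiv_fun_const_smul (h1.fun_add (h2.fun_const_smul c)),
      fderiv_fun_add h1 (h2.fun_const_smul c), fderiv_fun_const_smul h2]
    rfl
  simp only [delbar, del, dt, dσ, jz, jzbar, h3]
  module

/-- Moving `V^i` to the left past `l^a` changes the sign `(-)^{ea}` of a form of parity `e` into the
sign `(-)^{ai}` of the force. -/
theorem sum_force (hVF : IsSection U e V F) :
    ∑ a, ∑ b, sg (e * par₂ a) •
        (φ.left p a * (φ.Z p).eval (vec V (A.toMatrix a b)) * φ.right p b)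
      = ∑ i, (φ.Z p).eval (V i) * φ.force A i p := by
  have hz := φ.body_mem p hp
  have h2 : ∀ e a i : ZMod 2, e * a + a * (i + e) = a * i := by decide
  have h1 : ∀ a b, sg (e * par₂ a) •
      (φ.left p a * (φ.Z p).eval (vec V (A.toMatrix a b)) * φ.right p b)
      = ∑ i, (φ.Z p).eval (V i) * sg (par₂ a * par i) •
        (φ.left p a * (φ.Z p).eval (pd i (A.toMatrix a b)) * φ.right p b) := by
    intro a b
    have h3 : (φ.Z p).eval (vec V (A.toMatrix a b))
        = ∑ i, (φ.Z p).eval (V i) * (φ.Z p).eval (pd i (A.toMatrix a b)) :=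
      (GrPoint.eval_sum hU hz fun i _ =>
        (hVF.smooth_V i).mul ((hA.smooth a b).pd hU i)).trans
        (Finset.sum_congr rfl fun i _ =>
          GrPoint.eval_mul hU hz (hVF.smooth_V i) ((hA.smooth a b).pd hU i))
    rw [h3, Finset.mul_sum, Finset.sum_mul, Finset.smul_sum]
    refine Finset.sum_congr rfl fun i _ => ?_
    rw [← mul_assoc (φ.left p a), Gr.comm (φ.left_mem hW hp a)
      (GrPoint.eval_mem hU hz (hVF.smooth_V i) (hVF.parity_V i)), smul_mul_assoc, smul_mul_assoc,
      sg_smul_smul, h2, mul_smul_comm]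
    simp only [mul_assoc]
  simp only [h1, force, Finset.mul_sum]
  rw [Finset.sum_comm]
  refine (Finset.sum_congr rfl fun b _ => Finset.sum_comm).trans ?_
  rw [Finset.sum_comm]
  refine Finset.sum_congr rfl fun i _ => Finset.sum_comm

omit hU hW hA hp in
theorem sum_mul_mul (l r : Idx d s ⊕ Idx d s → Gr N) (X : Mat d s (Gr N)) :
    ∑ a, ∑ b, l a * X a b * r b = l ⬝ᵥ (X *ᵥ r) := by
  simp only [dotProduct, Matrix.mulVec, Finset.mul_sum, mul_assoc]

omit hW in
-- The signs that `preLie` puts on the Jacobian terms cancel those of `formVal`, leaving plain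
-- matrix products. The `dF` term carries no such sign and keeps the one of `formVal`.
theorem formVal_preLie (hVF : IsSection U e V F) :
    formVal e (Matrix.of fun a b => (φ.Z p).eval (preLie e A V F a b)) (φ.left p) (φ.left p)
      = (∑ a, ∑ b, sg (e * par₂ a) •
        (φ.left p a * (φ.Z p).eval (vec V (A.toMatrix a b)) * φ.right p b))
        + (2 : ℝ) • (φ.left p ⬝ᵥ (φ.along (jacL V) p *ᵥ (φ.along A.toMatrix p *ᵥ φ.right p))
          - φ.flux A p ⬝ᵥ (φ.along (jacR V) p *ᵥ φ.right p)
          + (fun a => sg (e * par₂ a) • φ.left p a) ⬝ᵥ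
            (φ.along (dFMat e F) p *ᵥ (φ.along A.toMatrix p *ᵥ φ.right p))) := by
  have hz := φ.body_mem p hp
  have hL := jacL_smooth hU hVF
  have hR := jacR_smooth hU hVF
  have hD := dFMat_smooth hU hVF
  have h1 : ∀ a b, (φ.Z p).eval (preLie e A V F a b) = (φ.Z p).eval (vec V (A.toMatrix a b))
      + (2 : ℝ) • (sg (e * par₂ a) • ((φ.along (jacL V) p * φ.along A.toMatrix p) a b
        - (φ.along A.toMatrix p * φ.along (jacR V) p) a b)
        + (φ.along (dFMat e F) p * φ.along A.toMatrix p) a b) := by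
    intro a b
    have s1 := SFun.SmoothOn.matrix_mul hL hA.smooth a b
    have s2 := SFun.SmoothOn.matrix_mul hA.smooth hR a b
    have s3 := SFun.SmoothOn.matrix_mul hD hA.smooth a b
    refine (GrPoint.eval_add hU hz (vec_smooth hU hVF (hA.smooth a b))
      ((((s1.sub s2).smul _).add s3).smul _)).trans (congrArg _ ?_)
    rw [GrPoint.eval_smul hU hz _ (((s1.sub s2).smul _).add s3),
      GrPoint.eval_add hU hz ((s1.sub s2).smul _) s3, GrPoint.eval_smul hU hz _ (s1.sub s2),
      GrPoint.eval_sub hU hz s1 s2, GrPoint.eval_matrix_mul hU hz hL hA.smooth,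
      GrPoint.eval_matrix_mul hU hz hA.smooth hR, GrPoint.eval_matrix_mul hU hz hD hA.smooth]
    rfl
  rw [Matrix.mulVec_mulVec, Matrix.mulVec_mulVec, flux, ← Matrix.dotProduct_mulVec,
    Matrix.mulVec_mulVec, ← sum_mul_mul, ← sum_mul_mul, ← sum_mul_mul, formVal]
  simp only [← Finset.sum_sub_distrib, ← Finset.sum_add_distrib, Finset.smul_sum, ← φ.right_eq]
  refine Finset.sum_congr rfl fun a _ => Finset.sum_congr rfl fun b _ => ?_
  rw [Matrix.of_apply, h1]
  simp only [mul_add, add_mul, mul_sub, sub_mul, smul_add, smul_sub, mul_smul_comm,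
    smul_mul_assoc]
  rw [smul_comm (sg (e * par₂ a)) (2 : ℝ), sg_smul_self, smul_comm (sg (e * par₂ a)) (2 : ℝ),
    sg_smul_self, smul_comm (sg (e * par₂ a)) (2 : ℝ)]

/-- The conservation law on solutions, before supersymmetrization. -/
theorem delbar_add_del_of_isSolution (hVF : IsSection U e V F) (h : φ.IsSolution A) :
    delbar (φ.jz A V F) p + del (φ.jzbar A V F) p
      = -((1 / 2 : ℝ) • formVal e (Matrix.of fun a b => (φ.Z p).eval (preLie e A V F a b))
        (φ.left p) (φ.left p)) := by
  obtain ⟨hZ, hP⟩ := (φ.isSolution_iff hU hW hA).mp h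
  have hz := φ.body_mem p hp
  set E : SFun d s → Gr N := (φ.Z p).eval with hEdef
  set l := φ.left p with hl
  set w := φ.flux A p with hw
  have hlm : ∀ a, l a ∈ Gr.parity N (par₂ a) := φ.left_mem hW hp
  have hwm : ∀ a, w a ∈ Gr.parity N (par₂ a) := φ.flux_mem hU hW hA hp
  have hdZ : ∀ i, fderiv ℝ (fun q => (φ.Z q).coord i) p (1, 0) = w (.inr i) := fun i => hZ p hp i
  have hdP : ∀ i, fderiv ℝ (fun q => φ.left q (.inr i)) p (1, 0)
      = fderiv ℝ (fun q => φ.flux A q (.inl i)) p (0, 1) - (1 / 2 : ℝ) • φ.force A i p :=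
    fun i => hP p hp i
  -- Mixed derivatives commute, and the equation of motion for `Z` may be differentiated in `σ`
  -- because it holds on a neighbourhood of `p`.
  have hdd : ∀ i, fderiv ℝ (fun q => φ.left q (.inl i)) p (1, 0)
      = fderiv ℝ (fun q => φ.flux A q (.inr i)) p (0, 1) := by
    intro i
    refine (φ.dt_dσZ hW hp i).trans ?_
    refine congrArg (fun L : ℝ × ℝ →L[ℝ] Gr N => L (0, 1)) (Filter.EventuallyEq.fderiv_eq ?_)
    filter_upwards [hW.mem_nhds hp] with q hq using hZ q hq i
  have hdσ : ∀ i, fderiv ℝ (fun q => (φ.Z q).coord i) p (0, 1) = l (.inl i) := fun i => rfl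
  -- The terms `V^i ∂_σ w_i` and `F_i (-)^i ∂_σ w^i` occur in both pairings and cancel. No second
  -- derivative of the fields survives.
  have hlhs : delbar (φ.jz A V F) p + del (φ.jzbar A V F) p
      = ((∑ i, ∑ k, w (.inr k) * E (pd k (V i)) * l (.inr i))
        - ∑ i, ∑ k, l (.inl k) * E (pd k (V i)) * w (.inl i))
        + ((∑ i, ∑ k, w (.inr k) * E (pd k (F i)) * (sg (par i) • l (.inl i)))
        - ∑ i, ∑ k, l (.inl k) * E (pd k (F i)) * (sg (par i) • w (.inr i)))
        - (1 / 2 : ℝ) • ∑ i, E (V i) * φ.force A i p := by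
    rw [φ.delbar_add_del hU hW hA hp hVF, dt, dσ,
      φ.fderiv_pairing hU hW hp hVF (φ.differentiableAt_left hW hp),
      φ.fderiv_pairing hU hW hp hVF fun a => φ.differentiableAt_flux hU hW hA hp a.swap]
    simp only [hdZ, hdP, hdd, hdσ, Sum.swap_inl, Sum.swap_inr, mul_sub, Finset.sum_add_distrib,
      Finset.sum_sub_distrib, Finset.smul_sum, mul_smul_comm]
    abel
  have hAr : φ.along A.toMatrix p *ᵥ φ.right p
      = Sum.elim (fun i => w (.inl i)) (fun i => sg (par i) • w (.inr i)) := by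
    have h2 : ∀ a : ZMod 2, a + a = 0 := by decide
    funext a
    rw [φ.mulVec_right hU hW hA hp]
    rcases a with i | i
    · change sg (par i + par i) • _ = w (.inl i)
      rw [h2, sg_zero, one_smul]
    · change sg (par i + 0) • _ = sg (par i) • w (.inr i)
      rw [add_zero]
  have hE0 : E 0 = 0 := GrPoint.eval_zero hU hz
  have hjL : φ.along (jacL V) p
      = Matrix.fromBlocks (Matrix.of fun i k => E (pd i (V k))) 0 0 0 := by
    ext (i | i) (j | j) <;> first | rfl | exact hE0
  have hjR : φ.along (jacR V) p
      = Matrix.fromBlocks 0 0 0 (Matrix.of fun k j => E (pd k (V j))) := by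
    ext (i | i) (j | j) <;> first | rfl | exact hE0
  have hdF : φ.along (dFMat e F) p
      = Matrix.fromBlocks 0 (Matrix.of fun i k => E (dF e F i k)) 0 0 := by
    ext (i | i) (j | j) <;> first | rfl | exact hE0
  have t1 : l ⬝ᵥ (φ.along (jacL V) p *ᵥ (φ.along A.toMatrix p *ᵥ φ.right p))
      = ∑ i, ∑ k, l (.inl k) * E (pd k (V i)) * w (.inl i) := by
    rw [hAr, hjL, Matrix.fromBlocks_mulVec, dotProduct,
      Fintype.sum_sum_type (f := fun a => l a * _), Finset.sum_comm]
    simp [-Fintype.sum_sum_type, Matrix.mulVec, dotProduct, Finset.mul_sum, mul_assoc]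
  have t2 : w ⬝ᵥ (φ.along (jacR V) p *ᵥ φ.right p)
      = ∑ i, ∑ k, w (.inr k) * E (pd k (V i)) * l (.inr i) := by
    have hr : φ.right p = Sum.elim (fun i => sg (par i) • l (.inl i)) (fun i => l (.inr i)) := rfl
    rw [hjR, hr, Matrix.fromBlocks_mulVec, dotProduct,
      Fintype.sum_sum_type (f := fun a => w a * _), Finset.sum_comm]
    simp [-Fintype.sum_sum_type, Matrix.mulVec, dotProduct, Finset.mul_sum, mul_assoc]
  have t3 : (fun a => sg (e * par₂ a) • l a) ⬝ᵥ
        (φ.along (dFMat e F) p *ᵥ (φ.along A.toMatrix p *ᵥ φ.right p))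
      = ∑ i, ∑ k, sg (e * par i) • (l (.inl i) * E (dF e F i k) * sg (par k) • w (.inr k)) := by
    rw [hAr, hdF, Matrix.fromBlocks_mulVec, dotProduct,
      Fintype.sum_sum_type (f := fun a => (fun a => sg (e * par₂ a) • l a) a * _)]
    simp [-Fintype.sum_sum_type, Matrix.mulVec, dotProduct, Finset.mul_sum, mul_assoc, par₂]
    exact Finset.sum_congr rfl fun i _ => Finset.sum_congr rfl fun k _ => smul_comm _ _ _
  have hpF : ∀ i k, E (pd k (F i)) ∈ Gr.parity N (par k + (par i + e)) := fun i k =>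
    GrPoint.eval_mem hU hz ((hVF.smooth_F i).pd hU k) ((hVF.parity_F i).pd hU (hVF.smooth_F i) k)
  -- The two terms with derivatives of `F` combine into `dF`: once the outer factors of one are
  -- exchanged, the signs are those of the exterior derivative.
  have t4 : ∀ i k, sg (e * par i) • (l (.inl i) * E (dF e F i k) * sg (par k) • w (.inr k))
      = l (.inl i) * E (pd i (F k)) * (sg (par k) • w (.inr k))
        - w (.inr k) * E (pd k (F i)) * (sg (par i) • l (.inl i)) := by
    intro i k
    have h1 : E (dF e F i k) = sg (par i * e) • E (pd i (F k))
        - sg (par i * par k + par k * e) • E (pd k (F i)) :=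
      (GrPoint.eval_sub hU hz (((hVF.smooth_F k).pd hU i).smul _)
        (((hVF.smooth_F i).pd hU k).smul _)).trans
        (congrArg₂ _ (GrPoint.eval_smul hU hz _ ((hVF.smooth_F k).pd hU i))
          (GrPoint.eval_smul hU hz _ ((hVF.smooth_F i).pd hU k)))
    have h2 : l (.inl i) * E (pd k (F i)) * w (.inr k)
        = sg (par i * (par k + (par i + e)) + (par k + (par i + e) + par i) * par k) •
          (w (.inr k) * E (pd k (F i)) * l (.inl i)) := by
      rw [Gr.comm (hlm (.inl i)) (hpF i k), smul_mul_assoc,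
        Gr.comm (Gr.mul_mem (hpF i k) (hlm (.inl i))) (hwm (.inr k)), sg_smul_smul, mul_assoc]
      rfl
    have h3 : ∀ e i k : ZMod 2, e * i + (i * k + k * e + (k +
        (i * (k + (i + e)) + (k + (i + e) + i) * k))) = i := by decide
    rw [h1]
    simp only [mul_sub, sub_mul, smul_sub, mul_smul_comm, smul_mul_assoc]
    rw [mul_comm e, smul_comm (sg (par k)) (sg (par i * e)), sg_smul_self, h2]
    simp only [sg_smul_smul]
    congr 3
    linear_combination h3 e (par i) (par k)
  have hsum := φ.sum_force hU hW hA hp hVF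
  rw [hlhs, φ.formVal_preLie hU hA hp hVF, hsum, t1, t2, t3]
  simp only [t4, Finset.sum_sub_distrib]
  rw [Finset.sum_comm (f := fun i k => l (.inl i) * E (pd i (F k)) * (sg (par k) • w (.inr k)))]
  module

/-- The conservation law on solutions. -/
theorem delbar_add_del_eq_lieForm (hVF : IsSection U e V F) (h : φ.IsSolution A) :
    delbar (φ.jz A V F) p + del (φ.jzbar A V F) p
      = -((1 / 4 : ℝ) • formVal e (φ.along (lieForm e A V F) p) (φ.left p) (φ.left p)) := by
  have hz := φ.body_mem p hp
  have hM : φ.along (lieForm e A V F) p = Matrix.of (fun a b => (φ.Z p).eval (preLie e A V F a b))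
      + Matrix.of fun a b => sg (stExp a b) •
        (Matrix.of fun a b => (φ.Z p).eval (preLie e A V F a b)) b a := by
    ext a b
    refine (GrPoint.eval_add hU hz (preLie_smooth hU hA hVF a b)
      ((preLie_smooth hU hA hVF b a).smul _)).trans (congrArg _ ?_)
    exact GrPoint.eval_smul hU hz _ (preLie_smooth hU hA hVF b a)
  have hadd : ∀ X Y : Mat d s (Gr N), formVal e (X + Y) (φ.left p) (φ.left p)
      = formVal e X (φ.left p) (φ.left p) + formVal e Y (φ.left p) (φ.left p) := by
    intro X Y
    simp only [formVal, Matrix.add_apply, mul_add, add_mul, smul_add, Finset.sum_add_distrib]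
  have hX : ∀ a b, (Matrix.of fun a b => (φ.Z p).eval (preLie e A V F a b)) a b
      ∈ Gr.parity N (par₂ a + par₂ b + e) := fun a b =>
    GrPoint.eval_mem hU hz (preLie_smooth hU hA hVF a b) (preLie_parity hU hA hVF a b)
  -- With the same row in both slots a form and its supertranspose have equal values. So `lieForm`
  -- takes twice the value of `preLie`, and `½` becomes `¼`.
  rw [φ.delbar_add_del_of_isSolution hU hW hA hp hVF h, hM, hadd,
    ← formVal_swap hX (φ.left_mem hW hp) (φ.left_mem hW hp)]
  module

end Fields

end SuperSigma

namespace SuperSigma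

variable {d s : ℕ} {U : Set (Fin d → ℝ)} {A : BlockTensor d s} {e : ZMod 2}
  {V F : Idx d s → SFun d s}

/-! ### The symmetry conditions -/

section Blocks

theorem preLie_inl_inl (i j : Idx d s) : preLie e A V F (.inl i) (.inl j)
    = vec V (A.ll i j) + (2 : ℝ) • (sg (e * par i) • ∑ k, pd i (V k) * A.ll k j
      + ∑ k, dF e F i k * A.ul k j) := by
  simp only [preLie, jacL, jacR, dFMat, BlockTensor.toMatrix, Matrix.fromBlocks_multiply,
    Matrix.of_apply]
  simp [-Fintype.sum_sum_type, Matrix.mul_apply, par₂]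

theorem preLie_inl_inr (i j : Idx d s) : preLie e A V F (.inl i) (.inr j)
    = vec V (A.lu i j) + (2 : ℝ) • (sg (e * par i) • ((∑ k, pd i (V k) * A.lu k j)
      - ∑ k, A.lu i k * pd k (V j)) + ∑ k, dF e F i k * A.uu k j) := by
  simp only [preLie, jacL, jacR, dFMat, BlockTensor.toMatrix, Matrix.fromBlocks_multiply,
    Matrix.of_apply]
  simp [-Fintype.sum_sum_type, Matrix.mul_apply, par₂]

theorem preLie_inr_inl (i j : Idx d s) : preLie e A V F (.inr i) (.inl j) = vec V (A.ul i j) := by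
  simp [-Fintype.sum_sum_type, preLie, jacL, jacR, dFMat, BlockTensor.toMatrix,
    Matrix.fromBlocks_multiply]

theorem preLie_inr_inr (i j : Idx d s) : preLie e A V F (.inr i) (.inr j)
    = vec V (A.uu i j) - (2 : ℝ) • (sg (e * par i) • ∑ k, A.uu i k * pd k (V j)) := by
  simp only [preLie, jacL, jacR, dFMat, BlockTensor.toMatrix, Matrix.fromBlocks_multiply,
    Matrix.of_apply]
  simp [-Fintype.sum_sum_type, Matrix.mul_apply, par₂, sub_eq_add_neg]

end Blocks

/-- The sign relating `A_{ab}` and `A_{ba}` is constant, so differentiation along `V` preserves the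
relation. -/
theorem vec_symm (hU : IsOpen U) (hA : A.IsGeneralizedMetric U) (a b : Idx d s ⊕ Idx d s)
    {x : Fin d → ℝ} (hx : x ∈ U) :
    vec V (A.toMatrix a b) x = sg (stExp a b) • vec V (A.toMatrix b a) x := by
  have h1 : ∀ f, vec V f x = ∑ k, V k x * pd k f x := fun f => by
    rw [vec, Finset.sum_apply]
    rfl
  rw [h1, h1, Finset.smul_sum]
  refine Finset.sum_congr rfl fun k _ => ?_
  rw [← mul_smul_comm, ← SFun.pd_smul hU _ (hA.smooth b a) k hx]
  exact congrArg _ (SFun.pd_congr hU (hA.symm a b) k hx)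

theorem stExp_inl_inl (i j : Idx d s) : stExp (.inl i) (.inl j) = par i * par j := by
  have h : ∀ a b : ZMod 2, a + b + a * b + a + b = a * b := by decide
  exact h _ _

theorem stExp_inl_inr (i j : Idx d s) : stExp (.inl i) (.inr j) = par i * par j + par j := by
  have h : ∀ a b : ZMod 2, a + b + a * b + a + 0 = a * b + b := by decide
  exact h _ _

theorem stExp_inr_inr (i j : Idx d s) :
    stExp (.inr i) (.inr j) = par i * par j + par i + par j := by
  have h : ∀ a b : ZMod 2, a + b + a * b + 0 + 0 = a * b + a + b := by decide
  exact h _ _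

section

variable (hU : IsOpen U) (hA : A.IsGeneralizedMetric U) {x : Fin d → ℝ} (hx : x ∈ U)
include hU hA hx

theorem lieForm_inl_inl (i j : Idx d s) : lieForm e A V F (.inl i) (.inl j) x
    = (2 : ℝ) • (lieLL e V A i j + ((∑ k, dF e F i k * A.ul k j)
      + sg (par i * par j) • ∑ k, dF e F j k * A.ul k i)) x := by
  have h := vec_symm (V := V) hU hA (.inl i) (.inl j) hx
  rw [stExp_inl_inl] at h
  change (preLie e A V F (.inl i) (.inl j) x
    + sg (stExp (.inl i) (.inl j)) • preLie e A V F (.inl j) (.inl i) x) = _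
  change vec V (A.ll i j) x = sg (par i * par j) • vec V (A.ll j i) x at h
  rw [preLie_inl_inl, preLie_inl_inl, stExp_inl_inl, lieLL, sg_add, ← Finset.smul_sum,
    ← Finset.smul_sum]
  simp only [Pi.add_apply, Pi.smul_apply, smul_add, ← h]
  module

/-- The transport term `V(A)` sits in both mixed blocks of `preLie` and doubles by supersymmetry.
All other terms sit in the upper right block only, where they already carry the factor 2. -/
theorem lieForm_inl_inr (i j : Idx d s) : lieForm e A V F (.inl i) (.inr j) x
    = (2 : ℝ) • (lieLU e V A i j + ∑ k, dF e F i k * A.uu k j) x := by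
  have h := vec_symm (V := V) hU hA (.inl i) (.inr j) hx
  change (preLie e A V F (.inl i) (.inr j) x
    + sg (stExp (.inl i) (.inr j)) • preLie e A V F (.inr j) (.inl i) x) = _
  change vec V (A.lu i j) x = _ • vec V (A.ul j i) x at h
  rw [preLie_inl_inr, preLie_inr_inl, ← h, lieLU, ← Finset.smul_sum, ← Finset.smul_sum]
  simp only [Pi.add_apply, Pi.sub_apply, Pi.smul_apply]
  module

theorem lieForm_inr_inr (i j : Idx d s) : lieForm e A V F (.inr i) (.inr j) x
    = (2 : ℝ) • lieUU e V A i j x := by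
  have h := vec_symm (V := V) hU hA (.inr i) (.inr j) hx
  change (preLie e A V F (.inr i) (.inr j) x
    + sg (stExp (.inr i) (.inr j)) • preLie e A V F (.inr j) (.inr i) x) = _
  change vec V (A.uu i j) x = _ • vec V (A.uu j i) x at h
  have h2 : par i + par j + par i * par j + e * par j
    = par i * par j + par i + par j + e * par j := by ring
  rw [preLie_inr_inr, preLie_inr_inr, lieUU, ← Finset.smul_sum, ← Finset.smul_sum, h2, sg_add _ (e * par j)]
  simp only [Pi.sub_apply, Pi.smul_apply, smul_sub, ← h]
  rw [stExp_inr_inr]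
  module

end

/-- The three conditions are three blocks of one supersymmetric form; the fourth block is the
supertranspose of the mixed one. -/
theorem symmetryConditions_iff (hU : IsOpen U) (hA : A.IsGeneralizedMetric U) :
    SymmetryConditions U e A V F ↔ ∀ a b, ∀ x ∈ U, lieForm e A V F a b x = 0 := by
  have two : ∀ y : Gr s, (2 : ℝ) • y = 0 ↔ y = 0 := fun y =>
    ⟨fun h => (smul_eq_zero.mp h).resolve_left two_ne_zero, fun h => by rw [h, smul_zero]⟩
  constructor
  · rintro ⟨h1, h2, h3⟩
    have hlu : ∀ i j, ∀ x ∈ U, lieForm e A V F (.inl i) (.inr j) x = 0 := fun i j x hx => by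
      rw [lieForm_inl_inr hU hA hx, two, Pi.add_apply, h2 i j x hx, neg_add_cancel]
    intro a b x hx
    rcases a with i | i <;> rcases b with j | j
    · rw [lieForm_inl_inl hU hA hx, two, Pi.add_apply, h1 i j x hx, neg_add_cancel]
    · exact hlu i j x hx
    · rw [lieForm_symm, Pi.smul_apply, hlu j i x hx, smul_zero]
    · rw [lieForm_inr_inr hU hA hx, two, h3 i j x hx]
  · intro h
    refine ⟨fun i j x hx => ?_, fun i j x hx => ?_, fun i j x hx => ?_⟩
    · have := h (.inl i) (.inl j) x hx
      rw [lieForm_inl_inl hU hA hx, two] at this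
      exact eq_neg_of_add_eq_zero_left this
    · have := h (.inl i) (.inr j) x hx
      rw [lieForm_inl_inr hU hA hx, two] at this
      exact eq_neg_of_add_eq_zero_left this
    · have := h (.inr i) (.inr j) x hx
      rwa [lieForm_inr_inr hU hA hx, two] at this

/-! ### The Lie derivative of the endomorphism -/

section Endomorphism

theorem lieSec_inl_inl (i j : Idx d s) : lieSec e V F A.op (.inl i) (.inl j)
    = lieLU e V A i j + ∑ k, dF e F i k * A.uu k j := by
  simp [-Fintype.sum_sum_type, lieSec, lieOp, opComm, lieLU, A.op_eq, lieMat, dFMat,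
    Matrix.fromBlocks_multiply, Matrix.mul_apply, par₂,
    Fintype.sum_sum_type (α₁ := Idx d s) (α₂ := Idx d s), ← Finset.smul_sum]
  module

theorem lieSec_inl_inr (i j : Idx d s) : lieSec e V F A.op (.inl i) (.inr j)
    = vec V (A.ll i j) + sg (e * par i) • (∑ k, pd i (V k) * A.ll k j)
      + (∑ k, sg (e * par i + (e * (par j + par k) + par j * par k + par k)) •
        (A.ll i k * pd j (V k)))
      + ((∑ k, dF e F i k * A.ul k j)
        - ∑ k, sg (e * (par i + par k)) • (A.lu i k * dF e F k j)) := by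
  simp only [sg_add (e * par i), mul_smul, ← Finset.smul_sum]
  simp [-Fintype.sum_sum_type, lieSec, lieOp, opComm, A.op_eq, lieMat, dFMat,
    Matrix.fromBlocks_multiply, Matrix.mul_apply, par₂,
    Fintype.sum_sum_type (α₁ := Idx d s) (α₂ := Idx d s)]
  module

theorem lieSec_inr_inl (i j : Idx d s) : lieSec e V F A.op (.inr i) (.inl j)
    = vec V (A.uu i j) - sg (e * par i) • (∑ k, A.uu i k * pd k (V j))
      - ∑ k, sg (e * par i + (e * (par k + par i) + par k * par i + par i)) •
        (pd k (V i) * A.uu k j) := by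
  simp only [sg_add (e * par i), mul_smul, ← Finset.smul_sum]
  simp [-Fintype.sum_sum_type, lieSec, lieOp, opComm, A.op_eq, lieMat, dFMat,
    Matrix.fromBlocks_multiply, Matrix.mul_apply, par₂,
    Fintype.sum_sum_type (α₁ := Idx d s) (α₂ := Idx d s)]
  module

theorem lieSec_inr_inr (i j : Idx d s) : lieSec e V F A.op (.inr i) (.inr j)
    = vec V (A.ul i j) + (∑ k, sg (e * par i + (e * (par j + par k) + par j * par k + par k)) •
        (A.ul i k * pd j (V k)))
      - (∑ k, sg (e * par i + (e * (par k + par i) + par k * par i + par i)) •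
        (pd k (V i) * A.ul k j))
      - ∑ k, sg (e * (par i + par k)) • (A.uu i k * dF e F k j) := by
  simp only [sg_add (e * par i), mul_smul, ← Finset.smul_sum]
  simp [-Fintype.sum_sum_type, lieSec, lieOp, opComm, A.op_eq, lieMat, dFMat,
    Matrix.fromBlocks_multiply, Matrix.mul_apply, par₂,
    Fintype.sum_sum_type (α₁ := Idx d s) (α₂ := Idx d s)]
  module

theorem dF_antisymm (i j : Idx d s) : dF e F i j = -(sg (par i * par j) • dF e F j i) := by
  have h : ∀ a b e : ZMod 2, a * b + (b * a + a * e) = a * e := by decide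
  rw [dF, dF, smul_sub, sg_smul_smul, sg_smul_smul, h, neg_sub]

variable (hU : IsOpen U) (hA : A.IsGeneralizedMetric U) {x : Fin d → ℝ} (hx : x ∈ U)
include hA hx

/-- The commutator with `U_A` produces products with `A` on the left of `∂V` or `dF`, where the Lie
derivative of the form may have the opposite order. This exchanges the factors and transposes `A` in
one step. -/
theorem metric_mul (a c : Idx d s ⊕ Idx d s) {t : ZMod 2} {y : Gr s} (hy : y ∈ Gr.parity s t) :
    A.toMatrix a c x * y = sg ((par₂ a + par₂ c) * t + stExp a c) • (y * A.toMatrix c a x) := by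
  rw [Gr.comm (hA.parity a c x hx) hy, hA.symm a c x hx, mul_smul_comm, sg_smul_smul]

include hU

/-- The Lie derivative of `U_A` is obtained from that of `A` by raising an index. -/
theorem lieSec_op (hVF : IsSection U e V F) (a b : Idx d s ⊕ Idx d s) :
    (2 : ℝ) • lieSec e V F A.op a b x = lieForm e A V F a b.swap x := by
  have hV : ∀ k i, pd k (V i) x ∈ Gr.parity s (par k + (par i + e)) := fun k i =>
    (hVF.parity_V i).pd hU (hVF.smooth_V i) k x hx
  have hF : ∀ i j, dF e F i j x ∈ Gr.parity s (par i + par j + e) := fun i j =>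
    dF_parity hU hVF i j x hx
  have hll : ∀ i k, ∀ t : ZMod 2, ∀ y ∈ Gr.parity s t, A.ll i k x * y
      = sg ((par i + par k) * t + par i * par k) • (y * A.ll k i x) := fun i k t y hy => by
    rw [← stExp_inl_inl]; exact metric_mul hA hx (.inl i) (.inl k) hy
  have hlu : ∀ i k, ∀ t : ZMod 2, ∀ y ∈ Gr.parity s t, A.lu i k x * y
      = sg ((par i + par k) * t + (par i * par k + par k)) • (y * A.ul k i x) :=
    fun i k t y hy => by
    rw [← stExp_inl_inr]; exact metric_mul hA hx (.inl i) (.inr k) hy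
  have hul : ∀ i k, ∀ t : ZMod 2, ∀ y ∈ Gr.parity s t, A.ul i k x * y
      = sg ((par i + par k) * t + (par k * par i + par i)) • (y * A.lu k i x) :=
    fun i k t y hy => by
    rw [← stExp_inl_inr, stExp_comm]; exact metric_mul hA hx (.inr i) (.inl k) hy
  have huu : ∀ i k, ∀ t : ZMod 2, ∀ y ∈ Gr.parity s t, A.uu i k x * y
      = sg ((par i + par k) * t + (par i * par k + par i + par k)) • (y * A.uu k i x) :=
    fun i k t y hy => by
    rw [← stExp_inr_inr]; exact metric_mul hA hx (.inr i) (.inr k) hy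
  rcases a with i | i <;> rcases b with j | j
  · rw [lieSec_inl_inl]
    exact (lieForm_inl_inr hU hA hx i j).symm
  · refine Eq.trans ?_ (lieForm_inl_inl hU hA hx i j).symm
    congr 1
    have h1 : ∀ k, sg (e * par i + (e * (par j + par k) + par j * par k + par k)) •
        (A.ll i k x * pd j (V k) x) = sg (par i * par j + e * par j) • (pd j (V k) x * A.ll k i x) := by
      have h : ∀ e i j k : ZMod 2, e * i + (e * (j + k) + j * k + k)
        + ((i + k) * (j + (k + e)) + i * k) = i * j + e * j := by decide
      intro k
      rw [hll i k _ _ (hV j k), sg_smul_smul, h]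
    -- The second half of the commutator with `dF` becomes the second `dF` term of `(*)`, by graded
    -- antisymmetry of `dF`.
    have h2 : ∀ k, sg (e * (par i + par k)) • (A.lu i k x * dF e F k j x)
        = -(sg (par i * par j) • (dF e F j k x * A.ul k i x)) := by
      have h : ∀ e i j k : ZMod 2, e * (i + k) + k * j
        + ((i + k) * (j + k + e) + (i * k + k)) = i * j := by decide
      intro k
      rw [dF_antisymm k j, Pi.neg_apply, Pi.smul_apply, mul_neg, mul_smul_comm,
        hlu i k _ _ (hF j k), smul_neg, sg_smul_smul, sg_smul_smul, h]
    rw [lieSec_inl_inr, lieLL]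
    simp only [Pi.add_apply, Pi.sub_apply, Finset.sum_apply, Pi.smul_apply, Pi.mul_apply, h1, h2,
      Finset.sum_neg_distrib, Finset.smul_sum]
    abel
  · refine Eq.trans ?_ (lieForm_inr_inr hU hA hx i j).symm
    congr 1
    have h1 : ∀ k, sg (par i + par j + par i * par j + e * par j) • (A.uu j k x * pd k (V i) x)
        = sg (e * par i + (e * (par k + par i) + par k * par i + par i)) •
          (pd k (V i) x * A.uu k j x) := by
      have h : ∀ e i j k : ZMod 2, i + j + i * j + e * j
        + ((j + k) * (k + (i + e)) + (j * k + j + k)) = e * i + (e * (k + i) + k * i + i) := by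
        decide
      intro k
      rw [huu j k _ _ (hV k i), sg_smul_smul, h]
    rw [lieSec_inr_inl, lieUU]
    simp only [Pi.sub_apply, Finset.sum_apply, Pi.smul_apply, Pi.mul_apply, h1,
      Finset.smul_sum]
  -- The lower right block is reduced to the already expanded upper right block of the form by
  -- supersymmetry.
  · change _ = lieForm e A V F (.inr i) (.inl j) x
    rw [lieForm_symm, Pi.smul_apply, lieForm_inl_inr hU hA hx, smul_comm]
    congr 1
    have h0 := vec_symm (V := V) hU hA (.inr i) (.inl j) hx
    change vec V (A.ul i j) x = _ • vec V (A.lu j i) x at h0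
    have hst : stExp (.inr i) (.inl j) = par j * par i + par i := by
      rw [stExp_comm, stExp_inl_inr]
    rw [hst] at h0 ⊢
    have h1 : ∀ k, sg (e * par i + (e * (par j + par k) + par j * par k + par k)) •
        (A.ul i k x * pd j (V k) x)
        = sg (par j * par i + par i) • sg (e * par j) • (pd j (V k) x * A.lu k i x) := by
      have h : ∀ e i j k : ZMod 2, e * i + (e * (j + k) + j * k + k)
        + ((i + k) * (j + (k + e)) + (k * i + i)) = j * i + i + e * j := by decide
      intro k
      rw [hul i k _ _ (hV j k), sg_smul_smul, sg_smul_smul, h]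
    have h2 : ∀ k, sg (par j * par i + par i) • sg (e * par j) • (A.lu j k x * pd k (V i) x)
        = sg (e * par i + (e * (par k + par i) + par k * par i + par i)) •
          (pd k (V i) x * A.ul k j x) := by
      have h : ∀ e i j k : ZMod 2, j * i + i + e * j + ((j + k) * (k + (i + e)) + (j * k + k))
        = e * i + (e * (k + i) + k * i + i) := by decide
      intro k
      rw [hlu j k _ _ (hV k i), sg_smul_smul, sg_smul_smul, h]
    have h3 : ∀ k, sg (e * (par i + par k)) • (A.uu i k x * dF e F k j x)
        = -(sg (par j * par i + par i) • (dF e F j k x * A.uu k i x)) := by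
      have h : ∀ e i j k : ZMod 2, e * (i + k) + k * j
        + ((i + k) * (j + k + e) + (i * k + i + k)) = j * i + i := by decide
      intro k
      rw [dF_antisymm k j, Pi.neg_apply, Pi.smul_apply, mul_neg, mul_smul_comm,
        huu i k _ _ (hF j k), smul_neg, sg_smul_smul, sg_smul_smul, h]
    rw [lieSec_inr_inr, lieLU]
    simp only [Pi.add_apply, Pi.sub_apply, Finset.sum_apply, Pi.smul_apply, Pi.mul_apply, h0, h1,
      smul_add, smul_sub, Finset.smul_sum, h2, h3, Finset.sum_neg_distrib]
    abel

omit hA hx in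
theorem symmetryConditions_iff_lieSec (hA : A.IsGeneralizedMetric U) (hVF : IsSection U e V F) :
    SymmetryConditions U e A V F ↔ ∀ a b, ∀ x ∈ U, lieSec e V F A.op a b x = 0 := by
  rw [symmetryConditions_iff hU hA]
  constructor
  · intro h a b x hx
    have := lieSec_op hU hA hx hVF a b
    rw [h _ _ x hx] at this
    exact (smul_eq_zero.mp this).resolve_left two_ne_zero
  · intro h a b x hx
    have := lieSec_op hU hA hx hVF a b.swap
    rw [h _ _ x hx, smul_zero, Sum.swap_swap] at this
    exact this.symm

end Endomorphism

end SuperSigma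

namespace SuperSigma

/-! ### Taylor expansion modulo a nilpotent ideal -/

section Ideal

variable {d s N : ℕ} {U : Set (Fin d → ℝ)}

/-- `I` is a right ideal of the Grassmann algebra with `I³ = 0`. -/
structure IsCubeZeroIdeal (I : Submodule ℝ (Gr N)) : Prop where
  mul_right : ∀ x ∈ I, ∀ y : Gr N, x * y ∈ I
  cube : ∀ x ∈ I, ∀ y ∈ I, ∀ z ∈ I, x * y * z = 0

namespace IsCubeZeroIdeal

variable {I : Submodule ℝ (Gr N)} (hI : IsCubeZeroIdeal I)
include hI

theorem sq_le : I * I ≤ I := Submodule.mul_le.mpr fun x hx y _ => hI.mul_right x hx y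

theorem mul_sq {x y : Gr N} (hx : x ∈ I) (hy : y ∈ I * I) : x * y = 0 := by
  induction hy using Submodule.mul_induction_on' with
  | mem_mul_mem a ha b hb => rw [← mul_assoc, hI.cube x hx a ha b hb]
  | add a _ b _ iha ihb => rw [mul_add, iha, ihb, add_zero]

theorem sq_mul {x y : Gr N} (hx : x ∈ I * I) (hy : y ∈ I) : x * y = 0 := by
  induction hx using Submodule.mul_induction_on' with
  | mem_mul_mem a ha b hb => rw [hI.cube a ha b hb y hy]
  | add a _ b _ iha ihb => rw [add_mul, iha, ihb, add_zero]

theorem sq_mul_right {x : Gr N} (hx : x ∈ I * I) (y : Gr N) : x * y ∈ I * I := by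
  induction hx using Submodule.mul_induction_on' with
  | mem_mul_mem a ha b hb =>
    rw [mul_assoc]
    exact Submodule.mul_mem_mul ha (hI.mul_right b hb y)
  | add a _ b _ iha ihb => rw [add_mul]; exact Submodule.add_mem _ iha ihb

/-- The cube of `x` vanishes, and the body is an algebra homomorphism to `ℝ`. Hence displacements in
`I` do not move the body of a point. -/
theorem body_eq_zero {x : Gr N} (hx : x ∈ I) : ExteriorAlgebra.algebraMapInv x = 0 := by
  have h := congrArg ExteriorAlgebra.algebraMapInv (hI.cube x hx x hx x hx)
  rw [map_mul, map_mul, map_zero] at h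
  simpa using h

end IsCubeZeroIdeal

/-- Otherwise some linear functional vanishes on `S` but not on the increment; composed with `h` it
has zero derivative, hence is constant. This turns bounds modulo an ideal on derivatives along a
segment into Taylor estimates. -/
theorem sub_mem_of_fderiv_mem {S : Submodule ℝ (Gr N)} {h : ℝ → Gr N}
    (hd : ∀ t, DifferentiableAt ℝ h t) (hS : ∀ t, fderiv ℝ h t 1 ∈ S) : h 1 - h 0 ∈ S := by
  by_contra hn
  obtain ⟨f, hf, hfS⟩ := Submodule.exists_le_ker_of_notMem hn
  let F : Gr N →L[ℝ] ℝ := f.toContinuousLinearMap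
  have hF : ∀ y ∈ S, F y = 0 := fun y hy => hfS hy
  have hc : ∀ t, HasDerivAt (fun t => F (h t)) 0 t := by
    intro t
    have h1 := F.hasFDerivAt.comp_hasDerivAt t (hd t).hasFDerivAt.hasDerivAt
    rwa [hF _ (hS t)] at h1
  have := is_const_of_deriv_eq_zero (fun t => (hc t).differentiableAt) (fun t => (hc t).deriv) 1 0
  apply hf
  change F (h 1 - h 0) = 0
  rw [map_sub, sub_eq_zero]
  exact this

namespace GrPoint

variable {I : Submodule ℝ (Gr N)}

theorem ext' {z z' : GrPoint d s N} (h : ∀ i, z.coord i = z'.coord i) : z = z' := by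
  obtain ⟨c, hc⟩ := z
  obtain ⟨c', hc'⟩ := z'
  obtain rfl : c = c' := funext h
  rfl

/-- The segment from `z` to `z'`. -/
noncomputable def segment (z z' : GrPoint d s N) (t : ℝ) : GrPoint d s N where
  coord i := z.coord i + t • (z'.coord i - z.coord i)
  mem i := Submodule.add_mem _ (z.mem i)
    (Submodule.smul_mem _ _ (Submodule.sub_mem _ (z'.mem i) (z.mem i)))

theorem segment_zero (z z' : GrPoint d s N) : segment z z' 0 = z :=
  ext' fun i => by simp [segment]

theorem segment_one (z z' : GrPoint d s N) : segment z z' 1 = z' :=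
  ext' fun i => by simp [segment]

theorem segment_hasDerivAt (z z' : GrPoint d s N) (i : Idx d s) (t : ℝ) :
    HasDerivAt (fun t => (segment z z' t).coord i) (z'.coord i - z.coord i) t := by
  have := ((hasDerivAt_id t).smul_const (z'.coord i - z.coord i)).const_add (z.coord i)
  rw [one_smul] at this
  exact this

theorem body_eq (hI : IsCubeZeroIdeal I) {z z' : GrPoint d s N}
    (h : ∀ i, z'.coord i - z.coord i ∈ I) : z'.body = z.body := by
  funext m
  have := hI.body_eq_zero (h (.inl m))
  rwa [map_sub, sub_eq_zero] at this

variable (hU : IsOpen U) (hI : IsCubeZeroIdeal I) {z z' : GrPoint d s N}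
  (hz : z.body ∈ U) (h : ∀ i, z'.coord i - z.coord i ∈ I) {f : SFun d s} (hf : f.SmoothOn U)
include hU hI hz h hf

theorem eval_segment (t : ℝ) : DifferentiableAt ℝ (fun t => (segment z z' t).eval f) t ∧
    fderiv ℝ (fun t => (segment z z' t).eval f) t 1
      = ∑ i, (z'.coord i - z.coord i) * (segment z z' t).eval (pd i f) := by
  have hb : (segment z z' t).body ∈ U := by
    rw [body_eq hI (z' := segment z z' t) (z := z)]
    · exact hz
    · intro i
      rw [segment, add_sub_cancel_left]
      exact I.smul_mem _ (h i)
  have hd := fun i => (segment_hasDerivAt z z' i t)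
  refine ⟨differentiableAt_eval (fun i => (hd i).differentiableAt) hU hb hf, ?_⟩
  rw [fderiv_eval (fun i => (hd i).differentiableAt) hU hb hf]
  refine Finset.sum_congr rfl fun i _ => ?_
  rw [fderiv_apply_one_eq_deriv, (hd i).deriv]

theorem eval_sub_mem : z'.eval f - z.eval f ∈ I := by
  have := sub_mem_of_fderiv_mem (S := I) (h := fun t => (segment z z' t).eval f)
    (fun t => (eval_segment hU hI hz h hf t).1) fun t => by
      rw [(eval_segment hU hI hz h hf t).2]
      exact Submodule.sum_mem _ fun i _ => hI.mul_right _ (h i) _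
  rwa [segment_zero, segment_one] at this

/-- Taylor's formula of first order. -/
theorem eval_sub_sub_mem :
    z'.eval f - z.eval f - ∑ i, (z'.coord i - z.coord i) * z.eval (pd i f) ∈ I * I := by
  set L := ∑ i, (z'.coord i - z.coord i) * z.eval (pd i f) with hL
  have hlin : ∀ t : ℝ, HasDerivAt (fun t : ℝ => t • L) L t := fun t => by
    simpa using (hasDerivAt_id t).smul_const L
  have hseg : ∀ t : ℝ, ∀ i, (segment z z' t).coord i - z.coord i ∈ I := fun t i => by
    rw [segment, add_sub_cancel_left]
    exact I.smul_mem _ (h i)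
  have := sub_mem_of_fderiv_mem (S := I * I) (h := fun t => (segment z z' t).eval f - t • L)
    (fun t => (eval_segment hU hI hz h hf t).1.fun_sub (hlin t).differentiableAt) fun t => by
      rw [fderiv_fun_sub (eval_segment hU hI hz h hf t).1 (hlin t).differentiableAt, sub_apply,
        (eval_segment hU hI hz h hf t).2, fderiv_apply_one_eq_deriv, (hlin t).deriv, hL,
        ← Finset.sum_sub_distrib]
      refine Submodule.sum_mem _ fun i _ => ?_
      -- The remainder has derivative `∑ δ^i ((∂_i f)(segment) - (∂_i f)(z))`, in which both factors
      -- lie in `I`.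
      rw [← mul_sub]
      exact Submodule.mul_mem_mul (h i) (eval_sub_mem hU hI hz (hseg t) (hf.pd hU i))
  simp only [segment_zero, segment_one, zero_smul, one_smul, sub_zero] at this
  rwa [sub_right_comm] at this

end GrPoint

end Ideal

end SuperSigma

namespace SuperSigma

/-! ### Solutions with nilpotent initial data -/

section Polynomial

variable {N : ℕ}

theorem fderiv_quadratic (p₀ p : ℝ × ℝ) (c x y v w : Gr N) :
    HasFDerivAt (fun q : ℝ × ℝ => c + (q.2 - p₀.2) • x + (q.1 - p₀.1) • y
      + ((q.1 - p₀.1) * (q.2 - p₀.2)) • v + ((q.1 - p₀.1) * (q.1 - p₀.1)) • w)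
      ((ContinuousLinearMap.snd ℝ ℝ ℝ).smulRight x + (ContinuousLinearMap.fst ℝ ℝ ℝ).smulRight y
        + ((p.1 - p₀.1) • ContinuousLinearMap.snd ℝ ℝ ℝ
          + (p.2 - p₀.2) • ContinuousLinearMap.fst ℝ ℝ ℝ).smulRight v
        + ((p.1 - p₀.1) • ContinuousLinearMap.fst ℝ ℝ ℝ
          + (p.1 - p₀.1) • ContinuousLinearMap.fst ℝ ℝ ℝ).smulRight w) p := by
  have h1 : HasFDerivAt (fun q : ℝ × ℝ => q.1 - p₀.1) (ContinuousLinearMap.fst ℝ ℝ ℝ) p :=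
    hasFDerivAt_fst.sub_const _
  have h2 : HasFDerivAt (fun q : ℝ × ℝ => q.2 - p₀.2) (ContinuousLinearMap.snd ℝ ℝ ℝ) p :=
    hasFDerivAt_snd.sub_const _
  exact ((((h2.smul_const x).const_add c).fun_add (h1.smul_const y)).fun_add
    ((h1.fun_mul h2).smul_const v)).fun_add ((h1.fun_mul h1).smul_const w)

theorem dt_quadratic (p₀ p : ℝ × ℝ) (c x y v w : Gr N) :
    dt (fun q : ℝ × ℝ => c + (q.2 - p₀.2) • x + (q.1 - p₀.1) • y
      + ((q.1 - p₀.1) * (q.2 - p₀.2)) • v + ((q.1 - p₀.1) * (q.1 - p₀.1)) • w) p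
      = y + (p.2 - p₀.2) • v + (2 * (p.1 - p₀.1)) • w := by
  rw [dt, (fderiv_quadratic p₀ p c x y v w).fderiv]
  simp [two_mul]

theorem dσ_quadratic (p₀ p : ℝ × ℝ) (c x y v w : Gr N) :
    dσ (fun q : ℝ × ℝ => c + (q.2 - p₀.2) • x + (q.1 - p₀.1) • y
      + ((q.1 - p₀.1) * (q.2 - p₀.2)) • v + ((q.1 - p₀.1) * (q.1 - p₀.1)) • w) p
      = x + (p.1 - p₀.1) • v := by
  rw [dσ, (fderiv_quadratic p₀ p c x y v w).fderiv]
  simp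

end Polynomial

namespace NilpotentSolution

variable {d s N : ℕ} {U : Set (Fin d → ℝ)} (A : BlockTensor d s) (z : GrPoint d s N)
  (u : Idx d s ⊕ Idx d s → Gr N)

/-- The row `u A`, for `A` at the point `z`. -/
noncomputable def flux₀ (b : Idx d s ⊕ Idx d s) : Gr N := ∑ a, u a * z.eval (A.toMatrix a b)

/-- The row `u (v^k ∂_k A)`, for `A` at the point `z`. -/
noncomputable def flux₁ (v : Idx d s → Gr N) (b : Idx d s ⊕ Idx d s) : Gr N :=
  ∑ a, ∑ k, u a * (v k * z.eval (pd k (A.toMatrix a b)))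

/-- The quadratic force, for `∂_i A` at the point `z`. -/
noncomputable def force₀ (i : Idx d s) : Gr N :=
  ∑ a, ∑ b, sg (par₂ a * par i) •
    (u a * z.eval (pd i (A.toMatrix a b)) * (sg (low b) • u b))

/-- The first time derivative of `(∂_σ Z^i  P_i)`. -/
noncomputable def rate : Idx d s ⊕ Idx d s → Gr N :=
  Sum.elim (fun i => flux₁ A z u (fun k => u (.inl k)) (.inr i))
    (fun i => flux₁ A z u (fun k => u (.inl k)) (.inl i) - (1 / 2 : ℝ) • force₀ A z u i)

/-- Half the second time derivative of `Z^i`. -/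
noncomputable def accel (i : Idx d s) : Gr N :=
  (1 / 2 : ℝ) • (flux₀ A z (rate A z u) (.inr i)
    + flux₁ A z u (fun k => flux₀ A z u (.inr k)) (.inr i))

section

variable {A z u}

theorem flux₀_mem_parity (hU : IsOpen U) (hA : A.IsGeneralizedMetric U) (hz : z.body ∈ U)
    (hu : ∀ a, u a ∈ Gr.parity N (par₂ a)) (b : Idx d s ⊕ Idx d s) :
    flux₀ A z u b ∈ Gr.parity N (par₂ b) := by
  have h : ∀ a b : ZMod 2, a + (a + b) = b := by decide
  refine Submodule.sum_mem _ fun a _ => ?_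
  exact h (par₂ a) (par₂ b) ▸ Gr.mul_mem (hu a)
    (GrPoint.eval_mem hU hz (hA.smooth a b) (hA.parity a b))

theorem pd_mem_parity (hU : IsOpen U) (hA : A.IsGeneralizedMetric U) (hz : z.body ∈ U)
    (k : Idx d s) (a b : Idx d s ⊕ Idx d s) :
    z.eval (pd k (A.toMatrix a b)) ∈ Gr.parity N (par k + (par₂ a + par₂ b)) :=
  GrPoint.eval_mem hU hz ((hA.smooth a b).pd hU k) ((hA.parity a b).pd hU (hA.smooth a b) k)

theorem flux₁_mem_parity (hU : IsOpen U) (hA : A.IsGeneralizedMetric U) (hz : z.body ∈ U)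
    (hu : ∀ a, u a ∈ Gr.parity N (par₂ a)) {v : Idx d s → Gr N}
    (hv : ∀ k, v k ∈ Gr.parity N (par k)) (b : Idx d s ⊕ Idx d s) :
    flux₁ A z u v b ∈ Gr.parity N (par₂ b) := by
  have h : ∀ a b k : ZMod 2, a + (k + (k + (a + b))) = b := by decide
  refine Submodule.sum_mem _ fun a _ => Submodule.sum_mem _ fun k _ => ?_
  exact h (par₂ a) (par₂ b) (par k) ▸ Gr.mul_mem (hu a)
    (Gr.mul_mem (hv k) (pd_mem_parity hU hA hz k a b))

theorem force₀_mem_parity (hU : IsOpen U) (hA : A.IsGeneralizedMetric U) (hz : z.body ∈ U)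
    (hu : ∀ a, u a ∈ Gr.parity N (par₂ a)) (i : Idx d s) :
    force₀ A z u i ∈ Gr.parity N (par i) := by
  have h : ∀ a b k : ZMod 2, a + (k + (a + b)) + b = k := by decide
  refine Submodule.sum_mem _ fun a _ => Submodule.sum_mem _ fun b _ => Submodule.smul_mem _ _ ?_
  exact h (par₂ a) (par₂ b) (par i) ▸ Gr.mul_mem (Gr.mul_mem (hu a) (pd_mem_parity hU hA hz i a b))
    (Submodule.smul_mem _ _ (hu b))

theorem rate_mem_parity (hU : IsOpen U) (hA : A.IsGeneralizedMetric U) (hz : z.body ∈ U)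
    (hu : ∀ a, u a ∈ Gr.parity N (par₂ a)) (a : Idx d s ⊕ Idx d s) :
    rate A z u a ∈ Gr.parity N (par₂ a) := by
  have hv : ∀ k, u (.inl k) ∈ Gr.parity N (par k) := fun k => hu (.inl k)
  rcases a with i | i
  · exact flux₁_mem_parity hU hA hz hu hv (.inr i)
  · exact Submodule.sub_mem _ (flux₁_mem_parity hU hA hz hu hv (.inl i))
      (Submodule.smul_mem _ _ (force₀_mem_parity hU hA hz hu i))

theorem accel_mem_parity (hU : IsOpen U) (hA : A.IsGeneralizedMetric U) (hz : z.body ∈ U)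
    (hu : ∀ a, u a ∈ Gr.parity N (par₂ a)) (i : Idx d s) :
    accel A z u i ∈ Gr.parity N (par i) :=
  Submodule.smul_mem _ _ (Submodule.add_mem _
    (flux₀_mem_parity hU hA hz (rate_mem_parity hU hA hz hu) (.inr i))
    (flux₁_mem_parity hU hA hz hu (fun k => flux₀_mem_parity hU hA hz hu (.inr k)) (.inr i)))

variable {I : Submodule ℝ (Gr N)} (hI : IsCubeZeroIdeal I)
include hI

theorem flux₀_mem (hu : ∀ a, u a ∈ I) (b : Idx d s ⊕ Idx d s) : flux₀ A z u b ∈ I :=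
  Submodule.sum_mem _ fun a _ => hI.mul_right _ (hu a) _

theorem flux₁_mem (hu : ∀ a, u a ∈ I) {v : Idx d s → Gr N} (hv : ∀ k, v k ∈ I)
    (b : Idx d s ⊕ Idx d s) : flux₁ A z u v b ∈ I * I :=
  Submodule.sum_mem _ fun a _ => Submodule.sum_mem _ fun k _ =>
    Submodule.mul_mem_mul (hu a) (hI.mul_right _ (hv k) _)

/-- The rate is quadratic in `u`. Its product with any further element of `I` therefore vanishes,
which is what makes the expansion terminate. -/
theorem rate_mem (hu : ∀ a, u a ∈ I) (a : Idx d s ⊕ Idx d s) : rate A z u a ∈ I * I := by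
  rcases a with i | i
  · exact flux₁_mem hI hu (fun _ => hu _) _
  · refine Submodule.sub_mem _ (flux₁_mem hI hu (fun _ => hu _) _) (Submodule.smul_mem _ _ ?_)
    exact Submodule.sum_mem _ fun a _ => Submodule.sum_mem _ fun b _ => Submodule.smul_mem _ _
      (Submodule.mul_mem_mul (hI.mul_right _ (hu a) _) (Submodule.smul_mem _ _ (hu b)))

theorem accel_mem (hu : ∀ a, u a ∈ I) (i : Idx d s) : accel A z u i ∈ I * I :=
  Submodule.smul_mem _ _ (Submodule.add_mem _
    (Submodule.sum_mem _ fun a _ => hI.sq_mul_right (rate_mem hI hu a) _)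
    (flux₁_mem hI hu (fun _ => flux₀_mem hI hu _) _))

end

variable {A z u}

/-- The field configuration that is quadratic on the worldsheet, with `Z = z` and
`(∂_σ Z^i  P_i) = u` at the point `p₀`. -/
noncomputable def fields (hU : IsOpen U) (hA : A.IsGeneralizedMetric U) (hz : z.body ∈ U)
    {I : Submodule ℝ (Gr N)} (hI : IsCubeZeroIdeal I) (hu : ∀ a, u a ∈ Gr.parity N (par₂ a))
    (huI : ∀ a, u a ∈ I) (W : Set (ℝ × ℝ)) (p₀ : ℝ × ℝ) : Fields d s N U W where
  Z q :=
    { coord := fun i => z.coord i + (q.2 - p₀.2) • u (.inl i) + (q.1 - p₀.1) • flux₀ A z u (.inr i)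
        + ((q.1 - p₀.1) * (q.2 - p₀.2)) • rate A z u (.inl i)
        + ((q.1 - p₀.1) * (q.1 - p₀.1)) • accel A z u i
      mem := fun i => Submodule.add_mem _ (Submodule.add_mem _ (Submodule.add_mem _
        (Submodule.add_mem _ (z.mem i) (Submodule.smul_mem _ _ (hu (.inl i))))
        (Submodule.smul_mem _ _ (flux₀_mem_parity hU hA hz hu (.inr i))))
        (Submodule.smul_mem _ _ (rate_mem_parity hU hA hz hu (.inl i))))
        (Submodule.smul_mem _ _ (accel_mem_parity hU hA hz hu i)) }
  P q :=
    { coord := fun i => u (.inr i) + (q.1 - p₀.1) • rate A z u (.inr i)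
      mem := fun i => Submodule.add_mem _ (hu (.inr i))
        (Submodule.smul_mem _ _ (rate_mem_parity hU hA hz hu (.inr i))) }
  smooth_Z i := by
    have : ContDiff ℝ ∞ fun q : ℝ × ℝ => z.coord i + (q.2 - p₀.2) • u (.inl i)
        + (q.1 - p₀.1) • flux₀ A z u (.inr i)
        + ((q.1 - p₀.1) * (q.2 - p₀.2)) • rate A z u (.inl i)
        + ((q.1 - p₀.1) * (q.1 - p₀.1)) • accel A z u i := by fun_prop
    exact this.contDiffOn
  smooth_P i := by
    have : ContDiff ℝ ∞ fun q : ℝ × ℝ => u (.inr i) + (q.1 - p₀.1) • rate A z u (.inr i) := by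
      fun_prop
    exact this.contDiffOn
  body_mem q _ := by
    rw [GrPoint.body_eq hI (z := z)]
    · exact hz
    · intro i
      have h2 := hI.sq_le
      simp only [add_assoc, add_sub_cancel_left]
      exact I.add_mem (I.smul_mem _ (huI _)) (I.add_mem (I.smul_mem _ (flux₀_mem hI huI _))
        (I.add_mem (I.smul_mem _ (h2 (rate_mem hI huI _))) (I.smul_mem _ (h2 (accel_mem hI huI _)))))

section

variable (hU : IsOpen U) (hA : A.IsGeneralizedMetric U) (hz : z.body ∈ U)
  {I : Submodule ℝ (Gr N)} (hI : IsCubeZeroIdeal I) (hu : ∀ a, u a ∈ Gr.parity N (par₂ a))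
  (huI : ∀ a, u a ∈ I) (W : Set (ℝ × ℝ)) (p₀ : ℝ × ℝ)

theorem fields_Z_base : (fields hU hA hz hI hu huI W p₀).Z p₀ = z :=
  GrPoint.ext' fun i => by simp [fields]

theorem fields_left (q : ℝ × ℝ) (a : Idx d s ⊕ Idx d s) :
    (fields hU hA hz hI hu huI W p₀).left q a = u a + (q.1 - p₀.1) • rate A z u a := by
  rcases a with i | i
  · exact dσ_quadratic p₀ q _ _ _ _ _
  · rfl

theorem fields_left_base : (fields hU hA hz hI hu huI W p₀).left p₀ = u :=
  funext fun a => by simp [fields_left]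

theorem fields_Z_sub (q : ℝ × ℝ) (k : Idx d s) :
    ∃ r ∈ I * I, ((fields hU hA hz hI hu huI W p₀).Z q).coord k - z.coord k
      = (q.2 - p₀.2) • u (.inl k) + (q.1 - p₀.1) • flux₀ A z u (.inr k) + r := by
  refine ⟨((q.1 - p₀.1) * (q.2 - p₀.2)) • rate A z u (.inl k)
        + ((q.1 - p₀.1) * (q.1 - p₀.1)) • accel A z u k, Submodule.add_mem _
    (Submodule.smul_mem _ _ (rate_mem hI huI _)) (Submodule.smul_mem _ _ (accel_mem hI huI _)), ?_⟩
  simp only [fields]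
  abel

theorem fields_Z_sub_mem (q : ℝ × ℝ) (k : Idx d s) :
    ((fields hU hA hz hI hu huI W p₀).Z q).coord k - z.coord k ∈ I := by
  obtain ⟨r, hr, h⟩ := fields_Z_sub hU hA hz hI hu huI W p₀ q k
  rw [h]
  exact I.add_mem (I.add_mem (I.smul_mem _ (huI _)) (I.smul_mem _ (flux₀_mem hI huI _)))
    (hI.sq_le hr)

/-- The flux is exactly affine in `(t, σ)`: a factor `u ∈ I` sees `A` only to first order around `z`
and the displacement only modulo `I²`, while a factor `rate ∈ I²` sees only the value of `A` at `z`.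
-/
theorem fields_flux (q : ℝ × ℝ) (b : Idx d s ⊕ Idx d s) :
    (fields hU hA hz hI hu huI W p₀).flux A q b
      = flux₀ A z u b + (q.2 - p₀.2) • flux₁ A z u (fun k => u (.inl k)) b
        + (q.1 - p₀.1) • (flux₀ A z (rate A z u) b
          + flux₁ A z u (fun k => flux₀ A z u (.inr k)) b) := by
  set φ := fields hU hA hz hI hu huI W p₀ with hφ
  have key : ∀ a, φ.left q a * (φ.Z q).eval (A.toMatrix a b)
      = u a * z.eval (A.toMatrix a b)
        + (q.2 - p₀.2) • (∑ k, u a * (u (.inl k) * z.eval (pd k (A.toMatrix a b))))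
        + (q.1 - p₀.1) • (rate A z u a * z.eval (A.toMatrix a b)
          + ∑ k, u a * (flux₀ A z u (.inr k) * z.eval (pd k (A.toMatrix a b)))) := by
    intro a
    have hδ := fields_Z_sub_mem hU hA hz hI hu huI W p₀ q
    have hE := GrPoint.eval_sub_mem hU hI hz hδ (hA.smooth a b)
    have hT := GrPoint.eval_sub_sub_mem hU hI hz hδ (hA.smooth a b)
    have e1 : u a * (φ.Z q).eval (A.toMatrix a b) = u a * z.eval (A.toMatrix a b)
        + ∑ k, u a * (((φ.Z q).coord k - z.coord k) * z.eval (pd k (A.toMatrix a b))) := by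
      have h0 := hI.mul_sq (huI a) hT
      rw [mul_sub, mul_sub, Finset.mul_sum, sub_sub, sub_eq_zero] at h0
      exact h0
    have e2 : rate A z u a * (φ.Z q).eval (A.toMatrix a b)
        = rate A z u a * z.eval (A.toMatrix a b) := by
      have h0 := hI.sq_mul (rate_mem (A := A) (z := z) hI huI a) hE
      rwa [mul_sub, sub_eq_zero] at h0
    have e3 : ∀ k, u a * (((φ.Z q).coord k - z.coord k) * z.eval (pd k (A.toMatrix a b)))
        = (q.2 - p₀.2) • (u a * (u (.inl k) * z.eval (pd k (A.toMatrix a b))))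
          + (q.1 - p₀.1) • (u a * (flux₀ A z u (.inr k) * z.eval (pd k (A.toMatrix a b)))) := by
      intro k
      obtain ⟨r, hr, h⟩ := fields_Z_sub hU hA hz hI hu huI W p₀ q k
      rw [h, add_mul, add_mul, mul_add, mul_add, hI.mul_sq (huI a) (hI.sq_mul_right hr _), add_zero,
        smul_mul_assoc, smul_mul_assoc, mul_smul_comm, mul_smul_comm]
    rw [fields_left, add_mul, smul_mul_assoc, e1, e2]
    simp only [e3, Finset.sum_add_distrib, ← Finset.smul_sum]
    module
  rw [Fields.flux, Matrix.vecMul, dotProduct]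
  refine (Finset.sum_congr rfl fun a _ => key a).trans ?_
  simp only [Finset.sum_add_distrib, ← Finset.smul_sum]
  rfl

/-- The force already contains two factors from `I`, so neither the displacement of `Z` nor the
change of the row contributes. -/
theorem fields_force (q : ℝ × ℝ) (i : Idx d s) :
    (fields hU hA hz hI hu huI W p₀).force A i q = force₀ A z u i := by
  set φ := fields hU hA hz hI hu huI W p₀ with hφ
  refine Finset.sum_congr rfl fun a _ => Finset.sum_congr rfl fun b _ => congrArg _ ?_
  have hE := GrPoint.eval_sub_mem hU hI hz (fields_Z_sub_mem hU hA hz hI hu huI W p₀ q)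
    ((hA.smooth a b).pd hU i)
  have hr : ∀ a, rate A z u a ∈ I * I := rate_mem hI huI
  have e1 : ∀ y, rate A z u a * y * u b = 0 := fun y =>
    hI.sq_mul (hI.sq_mul_right (hr a) y) (huI b)
  have e2 : ∀ y x, rate A z u a * y * rate A z u x = 0 := fun y x =>
    hI.sq_mul (hI.sq_mul_right (hr a) y) (hI.sq_le (hr x))
  have e3 : ∀ y, u a * y * rate A z u b = 0 := fun y => hI.mul_sq (hI.mul_right _ (huI a) y) (hr b)
  have e4 : u a * (φ.Z q).eval (pd i (A.toMatrix a b)) * u b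
      = u a * z.eval (pd i (A.toMatrix a b)) * u b := by
    have h0 := hI.cube _ (huI a) _ hE _ (huI b)
    rwa [mul_sub, sub_mul, sub_eq_zero] at h0
  rw [φ.right_eq, fields_left, fields_left]
  simp only [add_mul, mul_add, smul_mul_assoc, mul_smul_comm, e1, e2, e3, e4, smul_zero, add_zero,
    smul_add]

theorem fields_isSolution (hW : IsOpen W) : (fields hU hA hz hI hu huI W p₀).IsSolution A := by
  rw [Fields.isSolution_iff _ hU hW hA]
  refine ⟨fun q _ i => ?_, fun q _ i => ?_⟩
  -- Comparison of coefficients: `rate` matches the coefficient of `σ` in the flux, and twice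
  -- `accel` that of `t`.
  · refine (dt_quadratic p₀ q _ _ _ _ _).trans ?_
    rw [fields_flux]
    simp only [accel, rate, Sum.elim_inl]
    module
  · have h1 : (fields hU hA hz hI hu huI W p₀).dtP i q = rate A z u (.inr i) := by
      -- The momentum is the quadratic polynomial whose `σ`, `tσ` and `t²` coefficients are zero.
      have := dt_quadratic p₀ q (u (.inr i)) 0 (rate A z u (.inr i)) 0 0
      simp only [smul_zero, add_zero] at this
      exact this
    have h2 : dσ (fun q => (fields hU hA hz hI hu huI W p₀).flux A q (.inl i)) q
        = flux₁ A z u (fun k => u (.inl k)) (.inl i) := by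
      have := dσ_quadratic p₀ q (flux₀ A z u (.inl i)) (flux₁ A z u (fun k => u (.inl k)) (.inl i))
        (flux₀ A z (rate A z u) (.inl i)
          + flux₁ A z u (fun k => flux₀ A z u (.inr k)) (.inl i)) 0 0
      simp only [smul_zero, add_zero] at this
      simp only [fields_flux]
      exact this
    rw [h1, h2, fields_force]
    rfl

end

end NilpotentSolution

end SuperSigma

namespace SuperSigma

/-! ### Points with free odd parameters -/

namespace Gr

variable {N : ℕ}

theorem contractLeft_ι_mul (f : Module.Dual ℝ (Fin N → ℝ)) (v : Fin N → ℝ) (y : Gr N) :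
    (CliffordAlgebra.contractLeft f (ExteriorAlgebra.ι ℝ v * y) : Gr N)
      = f v • y - ExteriorAlgebra.ι ℝ v * CliffordAlgebra.contractLeft f y :=
  CliffordAlgebra.contractLeft_ι_mul f v y

theorem exists_mul_comm {a : ZMod 2} {w : Gr N} (hw : w ∈ parity N a) (y : Gr N) :
    ∃ y', y * w = w * y' := by
  obtain ⟨y₀, h₀, y₁, h₁, rfl⟩ := exists_add y
  exact ⟨sg (0 * a) • y₀ + sg (1 * a) • y₁, by
    rw [add_mul, comm h₀ hw, comm h₁ hw, mul_add, mul_smul_comm, mul_smul_comm]⟩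

theorem ι_mul_mul_ι (v : Fin N → ℝ) (y : Gr N) :
    (ExteriorAlgebra.ι ℝ v : Gr N) * y * ExteriorAlgebra.ι ℝ v = 0 := by
  obtain ⟨y', h⟩ := exists_mul_comm (ι_mem v) y
  rw [mul_assoc, h, ← mul_assoc, odd_sq (ι_mem v), zero_mul]

/-- The product of the generators with indices in a list. -/
noncomputable def genProd (l : List (Fin N)) : Gr N :=
  (l.map fun j => (ExteriorAlgebra.ι ℝ (Pi.single j 1) : Gr N)).prod

theorem genProd_cons (j : Fin N) (l : List (Fin N)) :
    genProd (j :: l) = ExteriorAlgebra.ι ℝ (Pi.single j 1) * genProd l := by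
  rw [genProd, List.map_cons, List.prod_cons, genProd]

theorem genProd_append (l l' : List (Fin N)) : genProd (l ++ l') = genProd l * genProd l' := by
  rw [genProd, List.map_append, List.prod_append, genProd, genProd]

theorem genProd_mem (l : List (Fin N)) : genProd l ∈ parity N (l.length : ZMod 2) := by
  induction l with
  | nil => exact_mod_cast one_mem
  | cons j l ih =>
    rw [genProd_cons, List.length_cons, Nat.cast_succ, add_comm]
    exact mul_mem (ι_mem _) ih

theorem genProd_mul_genProd (j : Fin N) (l : List (Fin N)) (y : Gr N) :
    genProd (j :: l) * y * genProd (j :: l) = 0 := by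
  rw [genProd_cons, mul_assoc _ (genProd l) y, ← mul_assoc, ι_mul_mul_ι, zero_mul]

/-- `y` does not involve the generators with indices in `l`. -/
def Free (l : List (Fin N)) (y : Gr N) : Prop :=
  ∀ j ∈ l, CliffordAlgebra.contractLeft (LinearMap.proj j : Module.Dual ℝ (Fin N → ℝ)) y = 0

theorem Free.genProd_mul {l l' : List (Fin N)} {y : Gr N} (hy : Free l y) (h : l'.Disjoint l) :
    Free l (genProd l' * y) := by
  induction l' with
  | nil => rwa [genProd, List.map_nil, List.prod_nil, one_mul]
  | cons k l' ih =>
    intro j hj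
    have hk : j ≠ k := fun e => h (List.mem_cons_self) (e ▸ hj)
    have ih' := ih (fun a ha => h (List.mem_cons_of_mem _ ha)) j hj
    rw [genProd_cons, mul_assoc]
    refine (contractLeft_ι_mul _ _ _).trans ?_
    rw [LinearMap.proj_apply, Pi.single_eq_of_ne hk, zero_smul, zero_sub]
    refine neg_eq_zero.mpr ?_
    exact (congrArg _ ih').trans (mul_zero _)

/-- Contraction with a dual generator undoes multiplication by that generator on elements not
involving it. The generators are stripped off one at a time, which requires them to be distinct. -/
theorem Free.eq_zero {l : List (Fin N)} (hl : l.Nodup) {y : Gr N} (hy : Free l y)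
    (h : genProd l * y = 0) : y = 0 := by
  induction l with
  | nil => rwa [genProd, List.map_nil, List.prod_nil, one_mul] at h
  | cons j l ih =>
    rw [List.nodup_cons] at hl
    refine ih hl.2 (fun k hk => hy k (List.mem_cons_of_mem _ hk)) ?_
    have hf : Free [j] (genProd l * y) :=
      Free.genProd_mul (fun k hk => hy k (by simp_all)) (by simpa using hl.1)
    rw [genProd_cons, mul_assoc] at h
    have h1 := contractLeft_ι_mul (LinearMap.proj j) (Pi.single j 1) (genProd l * y)
    rw [h, map_zero, LinearMap.proj_apply, Pi.single_eq_same, one_smul] at h1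
    have h2 : (CliffordAlgebra.contractLeft (LinearMap.proj j : Module.Dual ℝ (Fin N → ℝ))
      (genProd l * y) : Gr N) = 0 := hf j (List.mem_singleton_self _)
    rw [h2, mul_zero, sub_zero] at h1
    exact h1.symm

end Gr

/-- The right ideal generated by two elements of a Grassmann algebra. -/
noncomputable def pairIdeal {N : ℕ} (ε : Bool → Gr N) : Submodule ℝ (Gr N) :=
  LinearMap.range (LinearMap.coprod (LinearMap.mulLeft ℝ (ε true)) (LinearMap.mulLeft ℝ (ε false)))

section PairIdeal

variable {N : ℕ} {ε : Bool → Gr N}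

theorem mem_pairIdeal {x : Gr N} :
    x ∈ pairIdeal ε ↔ ∃ y y' : Gr N, ε true * y + ε false * y' = x := by
  simp [pairIdeal]

theorem self_mem_pairIdeal (b : Bool) : ε b ∈ pairIdeal ε := by
  rw [mem_pairIdeal]
  cases b
  · exact ⟨0, 1, by rw [mul_zero, mul_one, zero_add]⟩
  · exact ⟨1, 0, by rw [mul_zero, mul_one, add_zero]⟩

/-- Pigeonhole: among three factors taken from two parameters one parameter repeats, and `ε y ε = 0`
for every `y` in between. -/
theorem isCubeZeroIdeal_pairIdeal (h : ∀ b y, ε b * y * ε b = 0) :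
    IsCubeZeroIdeal (pairIdeal ε) where
  mul_right x hx y := by
    obtain ⟨x, x', rfl⟩ := mem_pairIdeal.mp hx
    exact mem_pairIdeal.mpr ⟨x * y, x' * y, by rw [add_mul, mul_assoc, mul_assoc]⟩
  cube x hx y hy z hz := by
    have key : ∀ i j k x y z, ε i * x * (ε j * y) * (ε k * z) = 0 := by
      intro i j k x y z
      by_cases hij : i = j
      · subst hij
        rw [← mul_assoc (ε i * x), h, zero_mul, zero_mul]
      · by_cases hjk : j = k
        · subst hjk
          rw [mul_assoc (ε i * x), ← mul_assoc (ε j * y), h, zero_mul, mul_zero]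
        · obtain rfl : i = k := by cases i <;> cases j <;> cases k <;> simp_all
          rw [mul_assoc (ε i) x, ← mul_assoc _ (ε i) z, h, zero_mul]
    obtain ⟨x, x', rfl⟩ := mem_pairIdeal.mp hx
    obtain ⟨y, y', rfl⟩ := mem_pairIdeal.mp hy
    obtain ⟨z, z', rfl⟩ := mem_pairIdeal.mp hz
    simp only [add_mul, mul_add, key, add_zero]

end PairIdeal

namespace GrPoint

variable {d s : ℕ}

/-- The point with body `x` and odd coordinates `θ^μ`, in a Grassmann algebra with `n` additional
generators. -/
noncomputable def generic (n : ℕ) (x : Fin d → ℝ) : GrPoint d s (s + n) where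
  coord := Sum.elim (fun m => algebraMap ℝ _ (x m))
    (fun μ => ExteriorAlgebra.ι ℝ (Pi.single (Fin.castAdd n μ) 1))
  mem
    | .inl _ => Gr.algebraMap_mem _
    | .inr _ => Gr.ι_mem _

variable (n : ℕ) (x : Fin d → ℝ)

theorem generic_body : (generic (s := s) n x).body = x :=
  funext fun m => ExteriorAlgebra.algebraMap_leftInverse (R := ℝ) (Fin (s + n) → ℝ) (x m)

theorem generic_soul (m : Fin d) : (generic (s := s) n x).soul m = 0 := by
  rw [soul, generic_body]
  exact sub_self _

/-- The even coordinates are real numbers, so the souls vanish and only the term of order zero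
remains. -/
theorem generic_eval (f : SFun d s) :
    (generic n x).eval f = (generic (d := d) n x).subst (f x) := by
  rw [eval, Finset.sum_range_succ', Finset.sum_eq_zero, taylorTerm_zero, generic_body]
  · simp
  · intro k _
    rw [taylorTerm_succ, Finset.sum_eq_zero, smul_zero]
    intro m _
    rw [generic_soul, zero_mul]

/-- A left inverse is the algebra homomorphism that sends the `n` additional generators to zero. -/
theorem generic_subst_injective : Function.Injective (generic (d := d) (s := s) n x).subst := by
  have h : ((ExteriorAlgebra.map (LinearMap.funLeft ℝ ℝ (Fin.castAdd n))).comp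
      (generic (d := d) (s := s) n x).subst) = AlgHom.id ℝ (Gr s) := by
    refine ExteriorAlgebra.hom_ext (LinearMap.ext fun v => ?_)
    change ExteriorAlgebra.map _ ((generic n x).subst (ExteriorAlgebra.ι ℝ v))
      = ExteriorAlgebra.ι ℝ v
    rw [subst_ι, map_sum]
    have hs : ∀ μ : Fin s, LinearMap.funLeft ℝ ℝ (Fin.castAdd n) (Pi.single (Fin.castAdd n μ) 1)
        = Pi.single μ 1 := fun μ => by
      ext ν
      simp [LinearMap.funLeft_apply, Pi.single_apply]
    simp only [generic, Sum.elim_inr, map_smul, ExteriorAlgebra.map_apply_ι, hs]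
    simp only [← map_smul, ← map_sum]
    exact congrArg _ (pi_eq_sum_univ' v).symm
  exact Function.LeftInverse.injective fun y => DFunLike.congr_fun h y

theorem generic_subst_free (l : List (Fin n)) (y : Gr s) :
    Gr.Free (l.map (Fin.natAdd s)) ((generic (d := d) n x).subst y) := by
  intro j hj
  obtain ⟨j, -, rfl⟩ := List.mem_map.mp hj
  induction y using CliffordAlgebra.left_induction with
  | algebraMap r =>
    refine (congrArg _ (AlgHom.commutes (generic (d := d) (s := s) n x).subst r)).trans ?_
    exact CliffordAlgebra.contractLeft_algebraMap _ _ r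
  | add a b iha ihb => rw [map_add, map_add, iha, ihb, add_zero]
  | ι_mul a v ih =>
    have h1 : (generic (d := d) n x).subst (ExteriorAlgebra.ι ℝ v * a)
        = ∑ μ, v μ • (ExteriorAlgebra.ι ℝ (Pi.single (Fin.castAdd n μ) 1)
          * (generic (d := d) n x).subst a) := by
      rw [map_mul, subst_ι, Finset.sum_mul]
      simp only [smul_mul_assoc]
      rfl
    refine (congrArg _ h1).trans ?_
    rw [map_sum]
    refine Finset.sum_eq_zero fun μ _ => ?_
    rw [map_smul]
    refine (congrArg _ (Gr.contractLeft_ι_mul _ _ _)).trans ?_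
    have h2 : (Pi.single (Fin.castAdd n μ) (1 : ℝ) : Fin (s + n) → ℝ) (Fin.natAdd s j) = 0 :=
      Pi.single_eq_of_ne (by simp [Fin.ext_iff]; omega) _
    have h3 : (CliffordAlgebra.contractLeft (LinearMap.proj (Fin.natAdd s j)
      : Module.Dual ℝ (Fin (s + n) → ℝ)) ((generic (d := d) n x).subst a) : Gr (s + n)) = 0 := ih
    rw [LinearMap.proj_apply, h2, h3, zero_smul, mul_zero, sub_zero, smul_zero]

end GrPoint

/-- An auxiliary parameter of parity `a`; the two values of the index give independent ones. -/
noncomputable def param (s : ℕ) (a : ZMod 2) (b : Bool) : Gr (s + 4) :=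
  Gr.genProd ((paramList a b).map (Fin.natAdd s))
where
  -- An odd parameter is a single generator, an even one a product of two. The two values of `b`
  -- draw on the disjoint sets `{0, 1}` and `{2, 3}`, so four additional generators suffice.
  paramList (a : ZMod 2) (b : Bool) : List (Fin 4) :=
    (if b then 0 else 2) :: if a = 1 then [] else [if b then 1 else 3]

theorem param_mem (s : ℕ) (a : ZMod 2) (b : Bool) : param s a b ∈ Gr.parity (s + 4) a := by
  have h : (((param.paramList a b).map (Fin.natAdd s)).length : ZMod 2) = a := by
    rw [List.length_map]
    revert a b
    decide
  have h' := Gr.genProd_mem ((param.paramList a b).map (Fin.natAdd s))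
  rwa [h] at h'

theorem param_mul_mul_param (s : ℕ) (a : ZMod 2) (b : Bool) (y : Gr (s + 4)) :
    param s a b * y * param s a b = 0 :=
  Gr.genProd_mul_genProd _ _ y

/-- The value at the generic point involves only the `θ^μ`. Once both parameters stand on its left,
they form a product of distinct generators foreign to it and can be cancelled. -/
theorem eq_zero_of_param_mul_eval {d s : ℕ} {x : Fin d → ℝ} {f : SFun d s} {c : ZMod 2}
    {U : Set (Fin d → ℝ)} (hx : x ∈ U) (hf : f.HasParity U c) (a a' : ZMod 2)
    (h : param s a true * (GrPoint.generic 4 x).eval f * param s a' false = 0) : f x = 0 := by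
  rw [GrPoint.generic_eval] at h
  have hy := GrPoint.subst_mem (GrPoint.generic (d := d) 4 x) (hf x hx)
  rw [mul_assoc, Gr.comm hy (param_mem s a' false), mul_smul_comm, sg_smul_eq_zero, ← mul_assoc,
    param, param, ← Gr.genProd_append, ← List.map_append] at h
  have hn : ∀ a a', (param.paramList a true ++ param.paramList a' false).Nodup := by decide
  refine GrPoint.generic_subst_injective 4 x ?_
  rw [map_zero]
  exact Gr.Free.eq_zero ((hn a a').map (Fin.natAdd_injective _ _)) (GrPoint.generic_subst_free 4 x _ _) h

end SuperSigma

namespace SuperSigma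

variable {d s : ℕ} {U : Set (Fin d → ℝ)} {W : Set (ℝ × ℝ)} {A : BlockTensor d s} {e : ZMod 2}
  {V F : Idx d s → SFun d s}

/-! ### Conservation of the current -/

section FormVal

variable {N : ℕ}

theorem formVal_add_left (X : Mat d s (Gr N)) (l l' r : Idx d s ⊕ Idx d s → Gr N) :
    formVal e X (l + l') r = formVal e X l r + formVal e X l' r := by
  simp only [formVal, Pi.add_apply, add_mul, smul_add, Finset.sum_add_distrib]

theorem formVal_add_right (X : Mat d s (Gr N)) (l r r' : Idx d s ⊕ Idx d s → Gr N) :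
    formVal e X l (r + r') = formVal e X l r + formVal e X l r' := by
  simp only [formVal, Pi.add_apply, mul_add, smul_add, Finset.sum_add_distrib]

theorem formVal_single (X : Mat d s (Gr N)) (a b : Idx d s ⊕ Idx d s) (x y : Gr N) :
    formVal e X (Pi.single a x) (Pi.single b y)
      = sg (e * par₂ a) • sg (low b) • (x * X a b * y) := by
  rw [formVal, Finset.sum_eq_single_of_mem a (Finset.mem_univ a),
    Finset.sum_eq_single_of_mem b (Finset.mem_univ b), Pi.single_eq_same, Pi.single_eq_same,
    mul_smul_comm]
  · intro b' _ hb
    rw [Pi.single_eq_of_ne hb, smul_zero, mul_zero, smul_zero]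
  · intro a' _ ha
    refine Finset.sum_eq_zero fun b _ => ?_
    rw [Pi.single_eq_of_ne ha, zero_mul, zero_mul, smul_zero]

theorem single_mem_parity {a : Idx d s ⊕ Idx d s} {x : Gr N} (hx : x ∈ Gr.parity N (par₂ a))
    (b : Idx d s ⊕ Idx d s) :
    (Pi.single a x : Idx d s ⊕ Idx d s → Gr N) b ∈ Gr.parity N (par₂ b) := by
  by_cases h : b = a
  · subst h
    rwa [Pi.single_eq_same]
  · rw [Pi.single_eq_of_ne h]
    exact Submodule.zero_mem _

/-- Polarization of a supersymmetric quadratic form. -/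
theorem formVal_polar {X : Mat d s (Gr N)} (hX : ∀ a b, X a b ∈ Gr.parity N (par₂ a + par₂ b + e))
    (hS : ∀ a b, X a b = sg (stExp a b) • X b a) {l r : Idx d s ⊕ Idx d s → Gr N}
    (hl : ∀ a, l a ∈ Gr.parity N (par₂ a)) (hr : ∀ a, r a ∈ Gr.parity N (par₂ a)) :
    formVal e X (l + r) (l + r)
      = formVal e X l l + (2 : ℝ) • formVal e X l r + formVal e X r r := by
  have h : formVal e X r l = formVal e X l r := by
    rw [formVal_swap hX hr hl]
    congr 1
    ext a b
    exact (hS a b).symm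
  rw [formVal_add_left, formVal_add_right, formVal_add_right, h, two_smul]
  abel

end FormVal

/-- Two independent parameters in the components `a` and `b`. -/
noncomputable def probe (a b : Idx d s ⊕ Idx d s) : Idx d s ⊕ Idx d s → Gr (s + 4) :=
  Pi.single a (param s (par₂ a) true) + Pi.single b (param s (par₂ b) false)

/-- There is a solution through every point with `(∂_σ Z^i  P_i)` given by `probe a b`. -/
theorem exists_isSolution_probe (hU : IsOpen U) (hW : IsOpen W) (hA : A.IsGeneralizedMetric U)
    {x : Fin d → ℝ} (hx : x ∈ U) (p : ℝ × ℝ) (a b : Idx d s ⊕ Idx d s) :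
    ∃ φ : Fields d s (s + 4) U W, φ.IsSolution A ∧ φ.Z p = GrPoint.generic 4 x ∧
      φ.left p = probe a b := by
  set ε : Bool → Gr (s + 4) := fun i => param s (par₂ (if i then a else b)) i with hε
  have hI : IsCubeZeroIdeal (pairIdeal ε) :=
    isCubeZeroIdeal_pairIdeal fun _ y => param_mul_mul_param _ _ _ y
  have hsingle : ∀ i c, (Pi.single (if i then a else b) (ε i) : Idx d s ⊕ Idx d s → Gr (s + 4)) c
      ∈ pairIdeal ε := fun i c => by
    by_cases h : c = if i then a else b
    · rw [h, Pi.single_eq_same]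
      exact self_mem_pairIdeal i
    · rw [Pi.single_eq_of_ne h]
      exact Submodule.zero_mem _
  have hu : ∀ c, probe a b c ∈ Gr.parity (s + 4) (par₂ c) := fun c =>
    Submodule.add_mem _ (single_mem_parity (param_mem _ _ _) c)
      (single_mem_parity (param_mem _ _ _) c)
  have huI : ∀ c, probe a b c ∈ pairIdeal ε := fun c =>
    Submodule.add_mem _ (hsingle true c) (hsingle false c)
  have hz : (GrPoint.generic (s := s) 4 x).body ∈ U := by rwa [GrPoint.generic_body]
  exact ⟨NilpotentSolution.fields hU hA hz hI hu huI W p,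
    NilpotentSolution.fields_isSolution hU hA hz hI hu huI W p hW,
    NilpotentSolution.fields_Z_base hU hA hz hI hu huI W p,
    NilpotentSolution.fields_left_base hU hA hz hI hu huI W p⟩

theorem currentConserved_iff_lieForm (hU : IsOpen U) (hW : IsOpen W) (hWne : W.Nonempty)
    (hA : A.IsGeneralizedMetric U) (hVF : IsSection U e V F) :
    CurrentConserved U W A V F ↔ ∀ a b, ∀ x ∈ U, lieForm e A V F a b x = 0 := by
  constructor
  · intro h a b x hx
    obtain ⟨p, hp⟩ := hWne
    obtain ⟨φ, hφ, hz, hl⟩ := exists_isSolution_probe hU hW hA hx p a b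
    have h0 := h _ φ hφ p hp
    rw [φ.delbar_add_del_eq_lieForm hU hW hA hp hVF hφ, neg_eq_zero, smul_eq_zero,
      or_iff_right (by norm_num), hl, probe, formVal_polar] at h0
    -- The diagonal terms vanish because each contains one parameter twice. The cross term survives
    -- even for `a = b`, the two parameters being independent.
    · simp only [formVal_single, param_mul_mul_param, smul_zero, zero_add, add_zero] at h0
      rw [smul_eq_zero, or_iff_right two_ne_zero, sg_smul_eq_zero, sg_smul_eq_zero, Fields.along,
        hz] at h0
      exact eq_zero_of_param_mul_eval hx (lieForm_parity hU hA hVF a b) _ _ h0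
    · exact fun a b => GrPoint.eval_mem hU (φ.body_mem p hp) (lieForm_smooth hU hA hVF a b)
        (lieForm_parity hU hA hVF a b)
    · intro a b
      rw [Fields.along, Fields.along,
        ← GrPoint.eval_smul hU (φ.body_mem p hp) _ (lieForm_smooth hU hA hVF b a), ← lieForm_symm]
    · exact single_mem_parity (param_mem _ _ _)
    · exact single_mem_parity (param_mem _ _ _)
  · intro h N φ hφ p hp
    have hz := φ.body_mem p hp
    rw [φ.delbar_add_del_eq_lieForm hU hW hA hp hVF hφ, neg_eq_zero, formVal, Finset.sum_eq_zero,
      smul_zero]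
    refine fun a _ => Finset.sum_eq_zero fun b _ => ?_
    rw [Fields.along, GrPoint.eval_congr hU hz (g := 0) fun x hx => h a b x hx,
      GrPoint.eval_zero hU hz, mul_zero, zero_mul, smul_zero]

theorem currentConserved_iff (hU : IsOpen U) (hW : IsOpen W) (hWne : W.Nonempty)
    (hA : A.IsGeneralizedMetric U) (hVF : IsSection U e V F) :
    CurrentConserved U W A V F ↔ SymmetryConditions U e A V F := by
  rw [currentConserved_iff_lieForm hU hW hWne hA hVF, symmetryConditions_iff hU hA]

/-! ### Eigenspaces -/

theorem row_vecMul_projector (c : ℝ) (a : Idx d s ⊕ Idx d s) :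
    (row V F ᵥ* projector A c) a
      = (1 / 2 : ℝ) • (row V F a + c • (row V F ᵥ* A.op) a) := by
  rw [projector, Matrix.vecMul_smul, Matrix.vecMul_add, Matrix.vecMul_one, Matrix.vecMul_smul]
  rfl

theorem row_parity (hVF : IsSection U e V F) (a : Idx d s ⊕ Idx d s) :
    (row V F a).HasParity U (par₂ a + e) := by
  rcases a with i | i
  exacts [hVF.parity_V i, hVF.parity_F i]

theorem row_projector_parity (hA : A.IsGeneralizedMetric U) (hVF : IsSection U e V F) (c : ℝ)
    (a : Idx d s ⊕ Idx d s) : ((row V F ᵥ* projector A c) a).HasParity U (par₂ a + e) := by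
  intro x hx
  rw [row_vecMul_projector]
  refine Submodule.smul_mem _ _ (Submodule.add_mem _ (row_parity hVF a x hx)
    (Submodule.smul_mem _ _ ?_))
  rw [Matrix.vecMul, dotProduct, Finset.sum_apply]
  refine Submodule.sum_mem _ fun b _ => ?_
  have h : ∀ a b e : ZMod 2, b + e + (b + a) = a + e := by decide
  have hs : ∀ a : Idx d s ⊕ Idx d s, par₂ a.swap = par₂ a := by rintro (i | i) <;> rfl
  rw [BlockTensor.op_apply, ← h (par₂ a) (par₂ b) e, ← hs a]
  exact Gr.mul_mem (row_parity hVF b x hx) (hA.parity b a.swap x hx)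

/-- The kernel of `(1 - c U_A) / 2` is the eigenspace to `1 / c`, which is `c` for a sign `c`. -/
theorem inEigenspace_iff {c : ℝ} (hc : c * c = 1) :
    InEigenspace U A c V F ↔ ∀ a, ∀ x ∈ U, (row V F ᵥ* projector A (-c)) a x = 0 := by
  refine forall_congr' fun a => forall_congr' fun x => forall_congr' fun _ => ?_
  rw [row_vecMul_projector]
  simp only [Pi.smul_apply, Pi.add_apply]
  rw [smul_eq_zero, or_iff_right (by norm_num), neg_smul, ← sub_eq_add_neg, sub_eq_zero]
  constructor
  · intro h
    rw [h, smul_smul, hc, one_smul]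
  · intro h
    rw [h, smul_smul, hc, one_smul]

namespace Fields

variable {N : ℕ} (φ : Fields d s N U W) {p : ℝ × ℝ}

theorem current_add_current (hU : IsOpen U) (hA : A.IsGeneralizedMetric U)
    (hp : p ∈ W) (c : ℝ) : φ.current A c V F p + φ.current A (-c) V F p = φ.jVF V F p := by
  rw [φ.current_eq hU hA hp, φ.current_eq hU hA hp]
  module

theorem current_eq_zero (hU : IsOpen U) (hA : A.IsGeneralizedMetric U) (hVF : IsSection U e V F)
    (hp : p ∈ W) {c : ℝ} (h : ∀ a, ∀ x ∈ U, (row V F ᵥ* projector A c) a x = 0) :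
    φ.current A c V F p = 0 := by
  rw [φ.current_eq_row_projector hU hA hp hVF.smooth]
  refine Finset.sum_eq_zero fun a _ => ?_
  rw [GrPoint.eval_congr hU (φ.body_mem p hp) (g := 0) (h a), GrPoint.eval_zero hU (φ.body_mem p hp),
    zero_mul]

end Fields

theorem row_projector_eq_zero (hU : IsOpen U) (hW : IsOpen W) (hWne : W.Nonempty)
    (hA : A.IsGeneralizedMetric U) (hVF : IsSection U e V F) {c : ℝ}
    (h : ∀ (N : ℕ) (φ : Fields d s N U W), ∀ p ∈ W, φ.current A c V F p = 0)
    (a : Idx d s ⊕ Idx d s) {x : Fin d → ℝ} (hx : x ∈ U) :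
    (row V F ᵥ* projector A c) a x = 0 := by
  obtain ⟨p, hp⟩ := hWne
  -- The column of the current has its halves exchanged, so its entry `a` is probed through
  -- `a.swap`. Both parameters go into this entry, which becomes, up to a sign, `ε + ε'`.
  obtain ⟨φ, -, hz, hl⟩ := exists_isSolution_probe hU hW hA hx p a.swap a.swap
  have h0 := h _ φ p hp
  rw [φ.current_eq_row_projector hU hA hp hVF.smooth,
    Finset.sum_eq_single_of_mem a (Finset.mem_univ a)] at h0
  · rw [φ.right'_eq, φ.right_eq, hl, probe, Pi.add_apply, Pi.single_eq_same, Pi.single_eq_same,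
      mul_smul_comm, sg_smul_eq_zero, hz] at h0
    refine eq_zero_of_param_mul_eval hx (row_projector_parity hA hVF c a) (par₂ a.swap)
      (par₂ a.swap) ?_
    -- Multiplying `y (ε + ε') = 0` by `ε` on the left kills `ε y ε` and leaves `ε y ε' = 0`.
    have h1 := congrArg (param s (par₂ a.swap) true * ·) h0
    simp only [mul_zero, mul_add, ← mul_assoc, param_mul_mul_param, zero_add] at h1
    exact h1
  · intro b _ hb
    have hb' : b.swap ≠ a.swap := fun h => hb (Sum.swap_leftInverse.injective h)
    rw [φ.right'_eq, φ.right_eq, hl, probe, Pi.add_apply, Pi.single_eq_of_ne hb',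
      Pi.single_eq_of_ne hb', add_zero, smul_zero, mul_zero]

/-- The eigenspaces, in terms of the two components of the current. -/
theorem inEigenspace_iff_current (hU : IsOpen U) (hW : IsOpen W) (hWne : W.Nonempty)
    (hA : A.IsGeneralizedMetric U) (hVF : IsSection U e V F) {c : ℝ} (hc : c * c = 1) :
    InEigenspace U A c V F ↔ ∀ (N : ℕ) (φ : Fields d s N U W), ∀ p ∈ W,
      φ.current A c V F p = φ.jVF V F p ∧ φ.current A (-c) V F p = 0 := by
  rw [inEigenspace_iff hc]
  constructor
  · intro h N φ p hp
    have h0 := φ.current_eq_zero hU hA hVF hp h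
    refine ⟨?_, h0⟩
    rw [← φ.current_add_current hU hA hp c, h0, add_zero]
  · intro h a x hx
    exact row_projector_eq_zero hU hW hWne hA hVF (fun N φ p hp => (h N φ p hp).2) a hx

theorem fderiv_eq_zero_of_eqOn {N : ℕ} (hW : IsOpen W) {g : ℝ × ℝ → Gr N}
    (h : ∀ p ∈ W, g p = 0) {p : ℝ × ℝ} (hp : p ∈ W) : fderiv ℝ g p = 0 := by
  have h' : g =ᶠ[nhds p] fun _ => 0 := Filter.eventuallyEq_of_mem (hW.mem_nhds hp) h
  rw [h'.fderiv_eq, fderiv_const_apply]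

/-- Here `j_z̄` vanishes identically on the open worldsheet, hence so do its derivatives, and
conservation reduces to holomorphy of `j_z`. -/
theorem holomorphic_of_inEigenspace (hU : IsOpen U) (hW : IsOpen W) (hWne : W.Nonempty)
    (hA : A.IsGeneralizedMetric U) (hVF : IsSection U e V F) (h : InEigenspace U A 1 V F) :
    (∀ (N : ℕ) (φ : Fields d s N U W), ∀ p ∈ W,
      delbar (φ.jz A V F) p + del (φ.jzbar A V F) p = delbar (φ.jz A V F) p) ∧
    (CurrentHolomorphic U W A V F ↔ SymmetryConditions U e A V F) := by
  rw [inEigenspace_iff_current hU hW hWne hA hVF (one_mul 1)] at h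
  have h1 : ∀ (N : ℕ) (φ : Fields d s N U W), ∀ p ∈ W,
      delbar (φ.jz A V F) p + del (φ.jzbar A V F) p = delbar (φ.jz A V F) p := by
    intro N φ p hp
    have h2 := fderiv_eq_zero_of_eqOn hW (g := φ.jzbar A V F) (fun q hq => (h N φ q hq).2) hp
    rw [del, dt, dσ, h2]
    simp
  refine ⟨h1, ?_⟩
  rw [← currentConserved_iff hU hW hWne hA hVF]
  exact forall_congr' fun N => forall_congr' fun φ => forall_congr' fun _ =>
    forall_congr' fun p => forall_congr' fun hp => by rw [h1 N φ p hp]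

theorem antiholomorphic_of_inEigenspace (hU : IsOpen U) (hW : IsOpen W) (hWne : W.Nonempty)
    (hA : A.IsGeneralizedMetric U) (hVF : IsSection U e V F) (h : InEigenspace U A (-1) V F) :
    (∀ (N : ℕ) (φ : Fields d s N U W), ∀ p ∈ W,
      delbar (φ.jz A V F) p + del (φ.jzbar A V F) p = del (φ.jzbar A V F) p) ∧
    (CurrentAntiholomorphic U W A V F ↔ SymmetryConditions U e A V F) := by
  rw [inEigenspace_iff_current hU hW hWne hA hVF (by norm_num), neg_neg] at h
  have h1 : ∀ (N : ℕ) (φ : Fields d s N U W), ∀ p ∈ W,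
      delbar (φ.jz A V F) p + del (φ.jzbar A V F) p = del (φ.jzbar A V F) p := by
    intro N φ p hp
    have h2 := fderiv_eq_zero_of_eqOn hW (g := φ.jz A V F)
      (fun q hq => (h N φ q hq).2) hp
    rw [delbar, dt, dσ, h2]
    simp
  refine ⟨h1, ?_⟩
  rw [← currentConserved_iff hU hW hWne hA hVF]
  exact forall_congr' fun N => forall_congr' fun φ => forall_congr' fun _ =>
    forall_congr' fun p => forall_congr' fun hp => by rw [h1 N φ p hp]

end SuperSigma

theorem mainTheorem4 (d s : ℕ) (U : Set (Fin d → ℝ)) (hU : IsOpen U)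
    (W : Set (ℝ × ℝ)) (hW : IsOpen W) (hW_ne : W.Nonempty)
    (A : SuperSigma.BlockTensor d s) (hA : A.IsGeneralizedMetric U)
    (e : ZMod 2) (V F : SuperSigma.Idx d s → SuperSigma.SFun d s)
    (hVF : SuperSigma.IsSection U e V F) :
    (SuperSigma.CurrentConserved U W A V F ↔ SuperSigma.SymmetryConditions U e A V F) ∧
    (SuperSigma.SymmetryConditions U e A V F ↔
      ∀ a b, ∀ x ∈ U, SuperSigma.lieSec e V F A.op a b x = 0) ∧
    (SuperSigma.InEigenspace U A 1 V F ↔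
      ∀ (N : ℕ) (φ : SuperSigma.Fields d s N U W), ∀ p ∈ W,
        φ.jz A V F p = φ.jVF V F p ∧ φ.jzbar A V F p = 0) ∧
    (SuperSigma.InEigenspace U A (-1) V F ↔
      ∀ (N : ℕ) (φ : SuperSigma.Fields d s N U W), ∀ p ∈ W,
        φ.jz A V F p = 0 ∧ φ.jzbar A V F p = φ.jVF V F p) ∧
    (SuperSigma.InEigenspace U A 1 V F →
      (∀ (N : ℕ) (φ : SuperSigma.Fields d s N U W), ∀ p ∈ W,
        SuperSigma.delbar (φ.jz A V F) p + SuperSigma.del (φ.jzbar A V F) p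
          = SuperSigma.delbar (φ.jz A V F) p) ∧
      (SuperSigma.CurrentHolomorphic U W A V F ↔ SuperSigma.SymmetryConditions U e A V F)) ∧
    (SuperSigma.InEigenspace U A (-1) V F →
      (∀ (N : ℕ) (φ : SuperSigma.Fields d s N U W), ∀ p ∈ W,
        SuperSigma.delbar (φ.jz A V F) p + SuperSigma.del (φ.jzbar A V F) p
          = SuperSigma.del (φ.jzbar A V F) p) ∧
      (SuperSigma.CurrentAntiholomorphic U W A V F ↔
        SuperSigma.SymmetryConditions U e A V F)) := by
  have h1 := SuperSigma.inEigenspace_iff_current hU hW hW_ne hA hVF (c := 1) (by norm_num)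
  have h2 := SuperSigma.inEigenspace_iff_current hU hW hW_ne hA hVF (c := -1) (by norm_num)
  rw [neg_neg] at h2
  exact ⟨SuperSigma.currentConserved_iff hU hW hW_ne hA hVF,
    SuperSigma.symmetryConditions_iff_lieSec hU hA hVF, h1,
    h2.trans (forall_congr' fun _ => forall_congr' fun _ => forall_congr' fun _ =>
      forall_congr' fun _ => and_comm),
    SuperSigma.holomorphic_of_inEigenspace hU hW hW_ne hA hVF,
    SuperSigma.antiholomorphic_of_inEigenspace hU hW hW_ne hA hVF⟩
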